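/- Let $\delta>2$ and write $\delta=q+q^{-1}$ with $q$ real; put $[k]=\frac{q^k-q^{-k}}{q-q^{-1}}$. Let $\mathcal{TL}_k$ be the Temperley–Lieb algebra on $k$ strands with modulus $\delta$: the complex vector space with basis the planar (non-crossing) pairings of $k$ top and $k$ bottom points of a rectangle, with multiplication by stacking ($xy$ is $x$ on top of $y$, each closed loop being replaced by the factor $\delta$), with $x^*$ the conjugate-linear extension of vertical reflection (exchanging top and bottom), with the unnormalized Markov trace $\operatorname{Tr}$ (a diagram goes to $\delta$ to the number of loops in its closure), and with $\langle x,y\rangle=\operatorname{Tr}(x^*y)$. The element $\widehat{X}\in\mathcal{TL}_k$ dual to a diagram $X$ is the element with $\langle \widehat X,X\rangle=1$ and $\langle\widehat X,Y\rangle=0$ for all diagrams $Y\ne X$. Let $f^{(k)}\in\mathcal{TL}_k$ be the Jones–Wenzl projection, given by $f^{(0)}=1_0$, $f^{(1)}=1_1$ and $f^{(k+1)}=f^{(k)}\otimes 1_1-\frac{[k]}{[k+1]}(f^{(k)}\otimes 1_1)E_k(f^{(k)}\otimes 1_1)$ for $k\ge 1$, where $\otimes$ is horizontal juxtaposition and $E_k\in\mathcal{TL}_{k+1}$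 is the diagram with a cup at the two rightmost top points, a cap at the two rightmost bottom points, and $k-1$ vertical strands. Let $a,b\ge 0$ and $n=a+b$. Let $E_{a,b}\in\mathcal{TL}_{n+2}$ be the diagram in which the two rightmost top points are joined, the bottom points number $a+1$ and $a+2$ (from the left) are joined, and the remaining $n$ top points are joined, in order, to the remaining $n$ bottom points. Let $$D=(f^{(n+1)}\otimes 1_1)\,E_{a,b}\,(f^{(a+1)}\otimes f^{(b+1)})\in\mathcal{TL}_{n+2}.$$ Then the element dual to $E_{a,b}$ exists, is unique, and equals $$\widehat{E_{a,b}}=\frac{[a+1][b+1]}{[n+2]^2}\,D-\frac{(-1)^b[a+1]}{[n+2][n+3]}\,f^{(n+2)}.$$ The element dual to the vertical reflection of $E_{a,b}$ likewise exists, is unique, and is obtained by keeping the coefficients and reflecting $D$ and $f^{(n+2)}$ vertically. -/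

import Mathlib

noncomputable section

open scoped Classical

namespace TemperleyLieb

/-- The `2 k` boundary points of a rectangle: `Sum.inl i` is the `i`-th point of the top edge and
`Sum.inr i` the `i`-th point of the bottom edge, both counted from the left, starting at `0`. -/
abbrev Point (k : ℕ) : Type := Fin k ⊕ Fin k

/-- The place of a boundary point when the boundary of the rectangle is traversed clockwise from
the upper left corner: first the top edge from left to right, then the bottom edge from right to
left. -/
def pos {k : ℕ} : Point k → ℕ
  | Sum.inl i => i.val
  | Sum.inr i => 2 * k - 1 - i.val

/-- A Temperley-Lieb diagram on `k` strands (up to isotopy): a perfect matching of the `2 k`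
boundary points of a rectangle that can be drawn in the rectangle without crossings. -/
@[ext]
structure Diagram (k : ℕ) where
  /-- the other end point of the string that starts at a given boundary point -/
  pair : Point k → Point k
  pair_pair : ∀ p, pair (pair p) = p
  pair_ne : ∀ p, pair p ≠ p
  noncrossing : ∀ p r, ¬ (pos p < pos r ∧ pos r < pos (pair p) ∧ pos (pair p) < pos (pair r))

instance (k : ℕ) : Finite (Diagram k) :=
  Finite.of_injective (fun X : Diagram k => X.pair) (fun _ _ h => Diagram.ext h)

instance (k : ℕ) : Fintype (Diagram k) := Fintype.ofFinite _

instance (k : ℕ) : DecidableEq (Diagram k) := Classical.decEq _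

/-- The identity diagram `1_k`: all strands are vertical. -/
def Diagram.one (k : ℕ) : Diagram k where
  pair := Sum.swap
  pair_pair := Sum.swap_swap
  pair_ne := by rintro (i | i) <;> simp
  noncrossing := by
    rintro (⟨i, hi⟩ | ⟨i, hi⟩) (⟨j, hj⟩ | ⟨j, hj⟩) <;>
      simp only [Sum.swap_inl, Sum.swap_inr, pos] <;> omega

/-- The vertical reflection (top and bottom exchanged) of a diagram. -/
def Diagram.reflect {k : ℕ} (X : Diagram k) : Diagram k where
  pair p := (X.pair p.swap).swap
  pair_pair p := by simp [X.pair_pair]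
  pair_ne p h := X.pair_ne p.swap (by
    have h' := congrArg Sum.swap h
    rwa [Sum.swap_swap] at h')
  noncrossing p r := by
    have key : ∀ s : Point k, pos s.swap + pos s = 2 * k - 1 ∧ 0 < k := by
      rintro (⟨i, hi⟩ | ⟨i, hi⟩) <;> simp only [Sum.swap_inl, Sum.swap_inr, pos] <;> omega
    have h := X.noncrossing (X.pair r.swap) (X.pair p.swap)
    rw [X.pair_pair, X.pair_pair] at h
    have h1 := key p
    have h2 := key r
    have h3 := key (X.pair p.swap)
    have h4 := key (X.pair r.swap)
    omega

/-- The end points of the strings of `Diagram.twoCup a b`. -/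
def twoCupPair (a b : ℕ) : Point (a + b + 2) → Point (a + b + 2)
  | Sum.inl i =>
    if h1 : i.val < a then Sum.inr ⟨i.val, by omega⟩
    else if h2 : i.val < a + b then Sum.inr ⟨i.val + 2, by omega⟩
    else if i.val = a + b then Sum.inl ⟨a + b + 1, by omega⟩
    else Sum.inl ⟨a + b, by omega⟩
  | Sum.inr j =>
    if h1 : j.val < a then Sum.inl ⟨j.val, by omega⟩
    else if j.val = a then Sum.inr ⟨a + 1, by omega⟩
    else if j.val = a + 1 then Sum.inr ⟨a, by omega⟩
    else Sum.inl ⟨j.val - 2, by omega⟩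

/-- The diagram on `a + b + 2` strands with `a + b` through strings, one cup joining the two
rightmost points of the top edge, and one cap joining the two points of the bottom edge that have
`a` points to their left and `b` points to their right. -/
def Diagram.twoCup (a b : ℕ) : Diagram (a + b + 2) where
  pair := twoCupPair a b
  pair_pair := by
    rintro (⟨i, hi⟩ | ⟨i, hi⟩) <;> rw [twoCupPair] <;> split_ifs <;>
      rw [twoCupPair] <;> split_ifs <;> first | omega | (simp_all; done) | (simp_all; omega)
  pair_ne := by
    rintro (⟨i, hi⟩ | ⟨i, hi⟩) <;> simp only [twoCupPair] <;> split_ifs <;>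
      simp only [ne_eq, Sum.inl.injEq, Sum.inr.injEq, Fin.mk.injEq, reduceCtorEq,
        not_false_eq_true] <;> omega
  noncrossing := by
    rintro (⟨i, hi⟩ | ⟨i, hi⟩) (⟨j, hj⟩ | ⟨j, hj⟩) <;> simp only [twoCupPair] <;> split_ifs <;>
      simp only [pos] <;> omega

/-- The vector space `TL_k`: formal complex linear combinations of Temperley-Lieb diagrams on `k`
strands, given by their coefficients. -/
abbrev TL (k : ℕ) : Type := Diagram k → ℂ

/-- A diagram as an element of the diagrammatic basis of `TL_k`. -/
def ofDiagram {k : ℕ} (X : Diagram k) : TL k := Pi.single X 1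

/-! ### Stacking -/

/-- Three rows of `k` points, for two stacked rectangles: row `0` is the top edge of the upper
rectangle, row `1` the edge that the rectangles share, row `2` the bottom edge of the lower one. -/
abbrev StackPoint (k : ℕ) : Type := Fin 3 × Fin k

/-- Boundary points of the upper rectangle. -/
def upper {k : ℕ} : Point k → StackPoint k := Sum.elim (fun i => (0, i)) (fun i => (1, i))

/-- Boundary points of the lower rectangle. -/
def lower {k : ℕ} : Point k → StackPoint k := Sum.elim (fun i => (1, i)) (fun i => (2, i))

/-- Boundary points of the rectangle formed by the two. -/
def outer {k : ℕ} : Point k → StackPoint k := Sum.elim (fun i => (0, i)) (fun i => (2, i))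

/-- The strings of `X`, drawn in the upper rectangle, and of `Y`, drawn in the lower one. -/
def stackGraph {k : ℕ} (X Y : Diagram k) : SimpleGraph (StackPoint k) :=
  SimpleGraph.fromRel fun u v =>
    ∃ p, (u = upper p ∧ v = upper (X.pair p)) ∨ (u = lower p ∧ v = lower (Y.pair p))

/-- `Z` is the diagram that remains when `X` is stacked on top of `Y` and closed loops are
removed: its strings join the outer points that are connected in the stack. -/
def IsStack {k : ℕ} (X Y Z : Diagram k) : Prop :=
  ∀ p, (stackGraph X Y).Reachable (outer p) (outer (Z.pair p))

/-- The number of closed loops when `X` is stacked on top of `Y`: the connected components that do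
not reach the outer boundary. -/
def stackLoops {k : ℕ} (X Y : Diagram k) : ℕ :=
  Nat.card {c : (stackGraph X Y).ConnectedComponent //
    ∀ p, (stackGraph X Y).connectedComponentMk (outer p) ≠ c}

/-- Multiplication of `TL_k` with modulus `δ`, the bilinear extension of stacking (`x` on top of
`y`): `X Y = δ ^ (number of closed loops) Z`, where `Z` is the diagram that remains. -/
def mul (δ : ℝ) {k : ℕ} (x y : TL k) : TL k := fun Z =>
  ∑ X, ∑ Y, if IsStack X Y Z then (δ : ℂ) ^ stackLoops X Y * (x X * y Y) else 0

/-! ### Juxtaposition -/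

/-- Boundary points of the left one of two juxtaposed rectangles. -/
def left {k l m : ℕ} (h : k + l = m) : Point k → Point m :=
  Sum.map (fun i => Fin.cast h (Fin.castAdd l i)) (fun i => Fin.cast h (Fin.castAdd l i))

/-- Boundary points of the right one of two juxtaposed rectangles. -/
def right {k l m : ℕ} (h : k + l = m) : Point l → Point m :=
  Sum.map (fun i => Fin.cast h (Fin.natAdd k i)) (fun i => Fin.cast h (Fin.natAdd k i))

/-- `Z` is the diagram `X ⊗ Y`, that is, `X` with `Y` drawn to the right of it. -/
def IsTensor {k l m : ℕ} (h : k + l = m) (X : Diagram k) (Y : Diagram l) (Z : Diagram m) : Prop :=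
  (∀ p, Z.pair (left h p) = left h (X.pair p)) ∧ (∀ p, Z.pair (right h p) = right h (Y.pair p))

/-- The bilinear extension `TL_k × TL_l → TL_{k + l}` of juxtaposition. -/
def tensor {k l m : ℕ} (h : k + l = m) (x : TL k) (y : TL l) : TL m := fun Z =>
  ∑ X, ∑ Y, if IsTensor h X Y Z then x X * y Y else 0

/-! ### Reflection, trace and inner product -/

/-- The linear extension of the vertical reflection of diagrams. -/
def reflect {k : ℕ} (x : TL k) : TL k := fun X => x X.reflect

/-- The adjoint: the conjugate-linear extension of the vertical reflection of diagrams. -/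
def adjoint {k : ℕ} (x : TL k) : TL k := fun X => (starRingEnd ℂ) (x X.reflect)

/-- The strings of `X` together with `k` strings that join the `i`-th top point to the `i`-th
bottom point outside the rectangle. -/
def closureGraph {k : ℕ} (X : Diagram k) : SimpleGraph (Point k) :=
  SimpleGraph.fromRel fun p r => r = X.pair p ∨ r = p.swap

/-- The (unnormalized) Markov trace: the linear map that sends a diagram to `δ` to the number of
closed loops in its closure. -/
def trace (δ : ℝ) {k : ℕ} (x : TL k) : ℂ :=
  ∑ X, x X * (δ : ℂ) ^ Nat.card (closureGraph X).ConnectedComponent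

/-- The inner product `⟨x, y⟩ = Tr (x^* y)`, linear on the right. -/
def inner (δ : ℝ) {k : ℕ} (x y : TL k) : ℂ := trace δ (mul δ (adjoint x) y)

/-- `v` is an element of `TL_k` dual to the diagram `X` with respect to the diagrammatic basis:
`⟨v, X⟩ = 1` and `⟨v, Y⟩ = 0` for every other diagram `Y`. -/
def IsDualTo (δ : ℝ) {k : ℕ} (v : TL k) (X : Diagram k) : Prop :=
  ∀ Y : Diagram k, inner δ v (ofDiagram Y) = if Y = X then 1 else 0

/-! ### Jones-Wenzl projections -/

/-- The quantum integer `[k] = (q ^ k - q ^ (-k)) / (q - q ^ (-1))`. -/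
def qInt (q : ℝ) (k : ℕ) : ℝ := (q ^ k - (q⁻¹) ^ k) / (q - q⁻¹)

/-- The Jones-Wenzl projection `f^(k)` in `TL_k` with modulus `q + q⁻¹`, by Wenzl's recursion
`f^(k+1) = f^(k) ⊗ 1 - ([k] / [k + 1]) (f^(k) ⊗ 1) E_k (f^(k) ⊗ 1)`, where `E_k` has its cup and
its cap at the two rightmost points. -/
def jonesWenzl (q : ℝ) : (k : ℕ) → TL k
  | 0 => ofDiagram (Diagram.one 0)
  | 1 => ofDiagram (Diagram.one 1)
  | k + 2 =>
    let g : TL (k + 2) := tensor (l := 1) rfl (jonesWenzl q (k + 1)) (ofDiagram (Diagram.one 1))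
    g - (qInt q (k + 1) / qInt q (k + 2)) •
      mul (q + q⁻¹) (mul (q + q⁻¹) g (ofDiagram (Diagram.twoCup k 0))) g

/-- The element `D` of `TL_{a + b + 2}`, from top to bottom: `f^(a+b+1)` with one strand to its
right, then the two-cup diagram, then `f^(a+1)` and `f^(b+1)` side by side. So the cup joins the
last lower end of `f^(a+b+1)` to the rightmost point of the top edge, the cap joins the last upper
end of `f^(a+1)` to the first upper end of `f^(b+1)`, and the first `a` and the other `b` lower ends
of `f^(a+b+1)` run to `f^(a+1)` and to `f^(b+1)`. -/
def diagramD (q : ℝ) (a b : ℕ) : TL (a + b + 2) :=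
  mul (q + q⁻¹)
    (mul (q + q⁻¹)
      (tensor (l := 1) rfl (jonesWenzl q (a + b + 1)) (ofDiagram (Diagram.one 1)))
      (ofDiagram (Diagram.twoCup a b)))
    (tensor (by omega) (jonesWenzl q (a + 1)) (jonesWenzl q (b + 1)))

end TemperleyLieb

end

/-!
The trace form `⟨x, y⟩ = Tr (x^* y)` is nondegenerate for modulus greater than `2`, so a dual
element is unique, and it is enough to compute the pairings of `D` and of the Jones-Wenzl
projection `f = f^(n+2)` with all diagrams.

* All products of `f` with a diagram other than the identity vanish, since such a diagram has a
  cup between neighbours on its top edge (`Diagram.exists_cup_of_ne_one`). So `f` pairs only with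
  the identity, and the value is `Tr f = [n+3]` (`IsTL.trace_jw`).
* In the pairing of `D` with a diagram `Y` a cup of `Y` between neighbours on the top edge, at
  another place than the right end, meets `f^(n+1)`, and one on the bottom edge, at another place
  than that of the cap of `E_{a,b}`, meets `f^(a+1)` or `f^(b+1)`. So the pairing vanishes unless
  `Y` is the identity or `E_{a,b}`, which are the only diagrams without such cups
  (`Diagram.eq_one_or_eq_twoCup`).
* `⟨D, 1⟩ = (-1)^b [n+2] / [b+1]`: in the trace `f^(b+1)` is expanded by Wenzl's recursion, where
  only the second term survives, and a partial trace lowers `b` by one (`IsTL.trace_pairing_one`).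
* `⟨D, E_{a,b}⟩ = [n+2]^2 / ([a+1] [b+1])`: the turn contracts one strand of `f^(n+1)`, which
  gives a multiple of `f^(n)`; the recursions for `f^(a+1)` and `f^(b+1)` from the sides of the
  cap, expanded below `f^(n)`, leave three multiples of the same element, with the sum
  `[2] - [a] / [a+1] - [b] / [b+1] = [n+2] / ([a+1] [b+1])` of the coefficients
  (`IsTL.jw_conj`, `IsTL.trace_pairing_twoCup`).

The stated combination of `D` and `f` therefore pairs to `1` with `E_{a,b}` and to `0` with all
other diagrams. Reflection is an antiautomorphism that preserves the trace and commutes with the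
adjoint, which yields the second half.

Nondegeneracy is proved by induction on the number of strands (`eq_zero_of_tr_mul_eq_zero`),
without the determinant of the form.

Identities between diagrams are verified in a model: the matrix `mat X` of a diagram records which
two-colourings of the boundary points are constant along its strings. Stacking becomes matrix
multiplication and closure becomes the matrix trace, each closed loop counting for `2`. The matrix
determines the diagram, and a power of `2` determines its exponent, so that an identity of
matrices gives the diagram and the number of loops for each modulus (`eq_of_smul_mat_eq`). In
particular the multiplication is associative. The computations with Jones-Wenzl projections use
only the Temperley-Lieb relations (`IsTL`) and the Markov property of the trace (`IsMarkov`), and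
they are done for an arbitrary algebra with these properties.
-/

noncomputable section

open scoped Classical

namespace TemperleyLieb

/-! ### Stacked diagrams -/

section Stack

variable {k : ℕ} (X Y Z : Diagram k)

theorem upper_injective : Function.Injective (upper (k := k)) := by
  rintro (i | i) (j | j) h <;> simp_all [upper]

theorem lower_injective : Function.Injective (lower (k := k)) := by
  rintro (i | i) (j | j) h <;> simp_all [lower]

theorem outer_injective : Function.Injective (outer (k := k)) := by
  rintro (i | i) (j | j) h <;> simp_all [outer]

theorem stackGraph_adj_upper (p : Point k) :
    (stackGraph X Y).Adj (upper p) (upper (X.pair p)) := by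
  rw [stackGraph, SimpleGraph.fromRel_adj]
  exact ⟨fun h => X.pair_ne p (upper_injective h).symm, Or.inl ⟨p, Or.inl ⟨rfl, rfl⟩⟩⟩

theorem stackGraph_adj_lower (p : Point k) :
    (stackGraph X Y).Adj (lower p) (lower (Y.pair p)) := by
  rw [stackGraph, SimpleGraph.fromRel_adj]
  exact ⟨fun h => Y.pair_ne p (lower_injective h).symm, Or.inl ⟨p, Or.inr ⟨rfl, rfl⟩⟩⟩

theorem stackGraph_adj_iff {u v : StackPoint k} : (stackGraph X Y).Adj u v ↔
    (∃ p, u = upper p ∧ v = upper (X.pair p)) ∨ (∃ p, u = lower p ∧ v = lower (Y.pair p)) := by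
  constructor
  · intro h
    rw [stackGraph, SimpleGraph.fromRel_adj] at h
    obtain ⟨-, ⟨p, h | h⟩ | ⟨p, h | h⟩⟩ := h
    · exact Or.inl ⟨p, h⟩
    · exact Or.inr ⟨p, h⟩
    · exact Or.inl ⟨X.pair p, h.2, by rw [X.pair_pair]; exact h.1⟩
    · exact Or.inr ⟨Y.pair p, h.2, by rw [Y.pair_pair]; exact h.1⟩
  · rintro (⟨p, rfl, rfl⟩ | ⟨p, rfl, rfl⟩)
    · exact stackGraph_adj_upper X Y p
    · exact stackGraph_adj_lower X Y p

/-- The number of strings that end at a point of a stack: two for the points of the common edge,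
one for the others. -/
theorem degree_add_le (C : (stackGraph X Y).ConnectedComponent) (v : C) :
    C.toSimpleGraph.degree v + (if v.1.1 = 1 then 0 else 1) ≤ 2 := by
  have key : ∀ (t : Finset (StackPoint k)),
      (∀ w, (stackGraph X Y).Adj v.1 w → w ∈ t) → C.toSimpleGraph.degree v ≤ t.card := by
    intro t ht
    rw [← SimpleGraph.card_neighborFinset_eq_degree]
    refine Finset.card_le_card_of_injOn (fun w => w.1) ?_ (Subtype.val_injective.injOn)
    intro w hw
    rw [Finset.mem_coe, SimpleGraph.mem_neighborFinset] at hw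
    exact ht _ hw
  obtain ⟨⟨x, i⟩, hv⟩ := v
  dsimp only at key ⊢
  fin_cases x
  · have := key {upper (X.pair (Sum.inl i))} (by
      intro w hw
      rcases (stackGraph_adj_iff X Y).1 hw with ⟨p | p, h1, h2⟩ | ⟨p | p, h1, h2⟩ <;>
        simp_all [upper, lower])
    simpa using this
  · have := key {upper (X.pair (Sum.inr i)), lower (Y.pair (Sum.inl i))} (by
      intro w hw
      rcases (stackGraph_adj_iff X Y).1 hw with ⟨p | p, h1, h2⟩ | ⟨p | p, h1, h2⟩ <;>
        simp_all [upper, lower])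
    simpa using this.trans Finset.card_le_two
  · have := key {lower (Y.pair (Sum.inr i))} (by
      intro w hw
      rcases (stackGraph_adj_iff X Y).1 hw with ⟨p | p, h1, h2⟩ | ⟨p | p, h1, h2⟩ <;>
        simp_all [upper, lower])
    simpa using this

theorem outer_row_ne (p : Point k) : (outer p).1 ≠ 1 := by
  rcases p with i | i <;> simp [outer]

/-- A component of a stack has at most two outer points: it has at least one edge less than
vertices, whereas each outer point lowers the count of half-edges by one. -/
theorem outer_unique {p p' p'' : Point k}
    (h' : (stackGraph X Y).Reachable (outer p) (outer p'))
    (h'' : (stackGraph X Y).Reachable (outer p) (outer p''))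
    (hp' : p' ≠ p) (hp'' : p'' ≠ p) : p' = p'' := by
  by_contra hne
  set C := (stackGraph X Y).connectedComponentMk (outer p) with hC
  have h1 := C.connected_toSimpleGraph.card_vert_le_card_edgeSet_add_one
  have h2 := C.toSimpleGraph.sum_degrees_eq_twice_card_edges
  have h3 : ∑ v : C, (C.toSimpleGraph.degree v + (if v.1.1 = 1 then 0 else 1)) ≤ ∑ _v : C, 2 :=
    Finset.sum_le_sum fun v _ => degree_add_le X Y C v
  rw [Finset.sum_add_distrib, h2] at h3
  have m0 : outer p ∈ C := rfl
  have m1 : outer p' ∈ C := SimpleGraph.ConnectedComponent.sound h'.symm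
  have m2 : outer p'' ∈ C := SimpleGraph.ConnectedComponent.sound h''.symm
  have h4 : ({⟨outer p, m0⟩, ⟨outer p', m1⟩, ⟨outer p'', m2⟩} : Finset C).card ≤
      ∑ v : C, (if v.1.1 = 1 then 0 else 1) := by
    rw [Finset.card_eq_sum_ones]
    refine (Finset.sum_le_sum (g := fun v : C => if v.1.1 = 1 then 0 else 1) ?_).trans
      (Finset.sum_le_sum_of_subset (Finset.subset_univ _))
    intro v hv
    simp only [Finset.mem_insert, Finset.mem_singleton] at hv
    rcases hv with rfl | rfl | rfl <;> simp [outer_row_ne]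
  rw [Finset.card_eq_three.2 ⟨_, _, _, ?_, ?_, ?_, rfl⟩] at h4
  · simp only [Finset.sum_const, Finset.card_univ, smul_eq_mul] at h3
    rw [Nat.card_eq_fintype_card, Nat.card_eq_fintype_card, ← SimpleGraph.edgeFinset_card] at h1
    omega
  · simpa using fun h => hp' (outer_injective h).symm
  · simpa using fun h => hp'' (outer_injective h).symm
  · simpa using fun h => hne (outer_injective h)

/-! ### Composition of planar diagrams -/

/-- The indicator function, modulo `2`, of a component of a stack. -/
def mark (C : (stackGraph X Y).ConnectedComponent) (v : StackPoint k) : ZMod 2 :=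
  if (stackGraph X Y).connectedComponentMk v = C then 1 else 0

variable {X Y}

theorem mark_upper (C : (stackGraph X Y).ConnectedComponent) (p : Point k) :
    mark X Y C (upper (X.pair p)) = mark X Y C (upper p) := by
  have h := SimpleGraph.ConnectedComponent.sound (stackGraph_adj_upper X Y p).reachable
  simp only [mark, h]

theorem mark_lower (C : (stackGraph X Y).ConnectedComponent) (p : Point k) :
    mark X Y C (lower (Y.pair p)) = mark X Y C (lower p) := by
  have h := SimpleGraph.ConnectedComponent.sound (stackGraph_adj_lower X Y p).reachable
  simp only [mark, h]

theorem Diagram.sum_eq_zero {X : Diagram k} (c : Point k → ZMod 2) (hc : ∀ p, c (X.pair p) = c p) :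
    ∑ p, c p = 0 :=
  Finset.sum_involution (fun p _ => X.pair p)
    (fun p _ => by rw [hc]; exact CharTwo.add_self_eq_zero _)
    (fun p _ _ => X.pair_ne p) (fun _ _ => Finset.mem_univ _) (fun p _ => X.pair_pair p)

theorem sum_mark_rows (C : (stackGraph X Y).ConnectedComponent) :
    ∑ i, mark X Y C (0, i) = ∑ i, mark X Y C (1, i) ∧
      ∑ i, mark X Y C (2, i) = ∑ i, mark X Y C (1, i) := by
  have h1 := Diagram.sum_eq_zero (X := X) (fun p => mark X Y C (upper p)) (mark_upper C)
  have h2 := Diagram.sum_eq_zero (X := Y) (fun p => mark X Y C (lower p)) (mark_lower C)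
  rw [Fintype.sum_sum_type] at h1 h2
  exact ⟨CharTwo.add_eq_zero.1 h1, (CharTwo.add_eq_zero.1 h2).symm⟩

/-- A component of a stack has an even number of outer points, so that they do not occur alone. -/
theorem exists_partner (X Y : Diagram k) (p : Point k) :
    ∃ p', p' ≠ p ∧ (stackGraph X Y).Reachable (outer p) (outer p') := by
  by_contra! hcon
  set C := (stackGraph X Y).connectedComponentMk (outer p) with hC
  have h := sum_mark_rows C
  have h0 : ∑ p', mark X Y C (outer p') = 0 := by
    rw [Fintype.sum_sum_type]
    simp only [outer, Sum.elim_inl, Sum.elim_inr]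
    rw [h.1, h.2, CharTwo.add_self_eq_zero]
  rw [Finset.sum_eq_single p] at h0
  · simp [mark, hC] at h0
  · intro p' _ hp'
    refine if_neg fun h' => hcon p' hp' (SimpleGraph.ConnectedComponent.exact h').symm
  · simp

/-- Unions of strings of a planar diagram have even linking number along the boundary: for two
disjoint sets `c`, `d` of boundary points that are closed under the pairing, the
number of pairs in which the point of `c` comes first is even. -/
theorem Diagram.linking_eq_zero {X : Diagram k} (c d : Point k → ZMod 2)
    (hc : ∀ p, c (X.pair p) = c p) (hd : ∀ p, d (X.pair p) = d p) (hcd : ∀ p, c p * d p = 0) :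
    ∑ r, ∑ p, c p * d r * (if pos p < pos r then 1 else 0) = 0 := by
  have pos_inj : ∀ p r : Point k, pos p = pos r → p = r := by
    rintro (⟨i, hi⟩ | ⟨i, hi⟩) (⟨j, hj⟩ | ⟨j, hj⟩) h <;> simp only [pos] at h <;>
      simp only [Sum.inl.injEq, Sum.inr.injEq, Fin.mk.injEq, reduceCtorEq] <;> omega
  refine Finset.sum_involution (fun r _ => X.pair r) (fun r _ => ?_)
    (fun p _ _ => X.pair_ne p) (fun _ _ => Finset.mem_univ _) (fun p _ => X.pair_pair p)
  rw [← Finset.sum_add_distrib]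
  refine Diagram.sum_eq_zero (X := X) _ fun p => ?_
  rw [hc, hd]
  by_cases hz : c p * d r = 0
  · simp [hz]
  have hpr : p ≠ r := by rintro rfl; exact hz (hcd p)
  have hpr' : X.pair p ≠ r := by rintro rfl; exact hz (by rw [hd]; exact hcd p)
  have hpr2 : p ≠ X.pair r := by rintro rfl; exact hpr' (X.pair_pair r)
  have hpr3 : X.pair p ≠ X.pair r := fun h => hpr (by
    rw [← X.pair_pair p, h, X.pair_pair])
  have n1 := mt (pos_inj _ _) hpr
  have n2 := mt (pos_inj _ _) hpr'
  have n3 := mt (pos_inj _ _) hpr2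
  have n4 := mt (pos_inj _ _) hpr3
  have c1 := X.noncrossing p r
  have c2 := X.noncrossing r p
  have c3 := X.noncrossing (X.pair p) r
  have c4 := X.noncrossing p (X.pair r)
  have c5 := X.noncrossing (X.pair p) (X.pair r)
  have c6 := X.noncrossing (X.pair r) p
  have c7 := X.noncrossing r (X.pair p)
  have c8 := X.noncrossing (X.pair r) (X.pair p)
  simp only [X.pair_pair] at c1 c2 c3 c4 c5 c6 c7 c8
  rw [← mul_add, ← mul_add]
  congr 1
  split_ifs <;> first | rfl | (exfalso; omega)

/-- Two different components of a stack have even linking number along the outer boundary: it is the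
sum of those in the two rectangles, and the contributions of the common edge cancel because the two
rectangles trace it in opposite directions. -/
theorem sum_outer (C C' : (stackGraph X Y).ConnectedComponent) (hne : C ≠ C') :
    ∑ r : Point k, ∑ p : Point k, mark X Y C (outer p) * mark X Y C' (outer r) *
      (if pos p < pos r then 1 else 0) = 0 := by
  have dis : ∀ v, mark X Y C v * mark X Y C' v = 0 := by
    intro v
    unfold mark
    split_ifs with h1 h2 <;> simp
    exact hne (h1.symm.trans h2)
  have h1 := Diagram.linking_eq_zero (X := X) (fun p => mark X Y C (upper p))
    (fun p => mark X Y C' (upper p)) (mark_upper C) (mark_upper C') (fun p => dis _)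
  have h2 := Diagram.linking_eq_zero (X := Y) (fun p => mark X Y C (lower p))
    (fun p => mark X Y C' (lower p)) (mark_lower C) (mark_lower C') (fun p => dis _)
  have e1 : ∀ i j : Fin k, (pos (Sum.inl i : Point k) < pos (Sum.inl j : Point k)) ↔ i < j :=
    fun i j => Iff.rfl
  have e2 : ∀ i j : Fin k, (pos (Sum.inl i : Point k) < pos (Sum.inr j : Point k)) ↔ True := by
    intro i j; simp only [pos, iff_true]; omega
  have e3 : ∀ i j : Fin k, (pos (Sum.inr i : Point k) < pos (Sum.inl j : Point k)) ↔ False := by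
    intro i j; simp only [pos, iff_false]; omega
  have e4 : ∀ i j : Fin k, (pos (Sum.inr i : Point k) < pos (Sum.inr j : Point k)) ↔ j < i := by
    intro i j; simp only [pos]; omega
  simp only [Fintype.sum_sum_type, upper, lower, outer, Sum.elim_inl, Sum.elim_inr, e1, e2, e3, e4,
    if_true, if_false, mul_one, mul_zero, Finset.sum_const_zero, zero_add,
    Finset.sum_add_distrib, ← Finset.sum_mul, ← Finset.mul_sum] at h1 h2 ⊢
  have s1 := sum_mark_rows C
  have s2 := sum_mark_rows C'
  rw [s1.1, s2.2]
  rw [s1.1] at h1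
  rw [s2.2] at h2
  have mid : ∑ r, ∑ p, mark X Y C (1, p) * mark X Y C' (1, r) * (if r < p then 1 else 0) +
      ∑ r, ∑ p, mark X Y C (1, p) * mark X Y C' (1, r) * (if p < r then 1 else 0) =
      (∑ i, mark X Y C (1, i)) * ∑ i, mark X Y C' (1, i) := by
    rw [← Finset.sum_add_distrib, Finset.mul_sum]
    refine Finset.sum_congr rfl fun r _ => ?_
    rw [← Finset.sum_add_distrib, Finset.sum_mul]
    refine Finset.sum_congr rfl fun p _ => ?_
    rcases lt_trichotomy p r with h | rfl | h
    · simp [h, h.not_gt]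
    · simp [dis]
    · simp [h, h.not_gt]
  have t : ∀ x : ZMod 2, x + x = 0 := CharTwo.add_self_eq_zero
  linear_combination h1 + h2 - mid - t ((∑ i, mark X Y C (1, i)) * ∑ i, mark X Y C' (1, i))

/-- Stacking two planar diagrams leaves a planar diagram. -/
theorem exists_isStack (X Y : Diagram k) : ∃ Z, IsStack X Y Z := by
  choose f hf hr using exists_partner X Y
  have hff : ∀ p, f (f p) = p := fun p =>
    outer_unique X Y (hr (f p)) (hr p).symm (hf _) (hf p).symm
  refine ⟨⟨f, hff, hf, ?_⟩, hr⟩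
  rintro p r ⟨h1, h2, h3⟩
  set C := (stackGraph X Y).connectedComponentMk (outer p) with hC
  set C' := (stackGraph X Y).connectedComponentMk (outer r) with hC'
  have mem : ∀ s t : Point k, mark X Y ((stackGraph X Y).connectedComponentMk (outer s)) (outer t)
      = if t = s ∨ t = f s then 1 else 0 := by
    intro s t
    unfold mark
    congr 1
    rw [SimpleGraph.ConnectedComponent.eq, eq_iff_iff]
    constructor
    · intro h
      by_cases hts : t = s
      · exact Or.inl hts
      · exact Or.inr (outer_unique X Y h.symm (hr s) hts (hf s))
    · rintro (rfl | rfl)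
      · exact SimpleGraph.Reachable.rfl
      · exact (hr s).symm
  have hne : C ≠ C' := by
    intro h
    have := mem p r
    rw [← hC, h, mark, if_pos rfl] at this
    have h' : r = p ∨ r = f p := by
      by_contra hc
      rw [if_neg hc] at this
      exact one_ne_zero this
    rcases h' with rfl | rfl
    · exact lt_irrefl _ h1
    · exact lt_irrefl _ h2
  -- strings that cross have the linking number `1`
  have hs := sum_outer C C' hne
  have split : ∀ (s : Point k) (g : Point k → ZMod 2),
      ∑ t, (if t = s ∨ t = f s then 1 else 0) * g t = g s + g (f s) := by
    intro s g
    have e : ∀ t, (if t = s ∨ t = f s then (1 : ZMod 2) else 0) * g t =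
        (if t = s then g t else 0) + (if t = f s then g t else 0) := by
      intro t
      have := hf s
      by_cases a1 : t = s <;> by_cases a2 : t = f s <;> simp_all
    simp only [e, Finset.sum_add_distrib, Finset.sum_ite_eq', Finset.mem_univ, if_true]
  simp only [hC, hC', mem, mul_assoc, split] at hs
  simp only [← mul_add, split] at hs
  rw [if_pos h1, if_neg h2.not_gt, if_pos (h1.trans (h2.trans h3)), if_pos h3] at hs
  exact absurd hs (by decide)

end Stack

/-! ### The colouring matrix of a diagram -/

section Colouring

/-- Two-colourings of a graph with monochromatic edges are two-colourings of its components. -/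
def colouringEquiv {V : Type*} (G : SimpleGraph V) :
    {c : V → Bool // ∀ u v, G.Adj u v → c u = c v} ≃ (G.ConnectedComponent → Bool) where
  toFun c := SimpleGraph.ConnectedComponent.lift c.1 (by
    intro v w p hp
    clear hp
    induction p with
    | nil => rfl
    | cons h _ ih => exact (c.2 _ _ h).trans ih)
  invFun g := ⟨fun v => g (G.connectedComponentMk v), fun u v h => by
    exact congrArg g (SimpleGraph.ConnectedComponent.sound h.reachable)⟩
  left_inv c := rfl
  right_inv g := by
    ext c
    induction c using SimpleGraph.ConnectedComponent.ind
    rfl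

variable {k : ℕ} (X Y Z : Diagram k)

/-- A colouring of the boundary points in which both ends of each string have the same colour. -/
def Diagram.Respects (c : Point k → Bool) : Prop := ∀ p, c (X.pair p) = c p

/-- The matrix of a diagram in the two-colour model: its entries are `1` or `0` according to whether
the colours of the top edge and those of the bottom edge agree along all strings. A closed loop
counts for `2` in this model, so that it records loops by powers of `2`. -/
def mat : Matrix (Fin k → Bool) (Fin k → Bool) ℕ :=
  fun s t => if X.Respects (Sum.elim s t) then 1 else 0

variable {X Y Z}

theorem elim_row (c : Point k → Bool) :
    Sum.elim (fun i => c (Sum.inl i)) (fun i => c (Sum.inr i)) = c := by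
  ext (i | i) <;> rfl

/-- The colouring that singles out one string of `X` shows that `Y` has this string too. -/
theorem Diagram.eq_of_forall_respects
    (h : ∀ c, X.Respects c → Y.Respects c) : X = Y := by
  ext1
  funext p
  have h1 := h (fun r => decide (r = p ∨ r = X.pair p)) (by
    intro r
    rw [decide_eq_decide]
    constructor
    · rintro (h | h)
      · exact Or.inr (by rw [← h, X.pair_pair])
      · exact Or.inl (by rw [← X.pair_pair r, h, X.pair_pair])
    · rintro (h | h)
      · exact Or.inr (by rw [h])
      · exact Or.inl (by rw [h, X.pair_pair])) p
  rw [decide_eq_decide] at h1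
  exact ((h1.2 (Or.inl rfl)).resolve_left (Y.pair_ne p)).symm

/-- The colouring matrix of a diagram, even up to a power of `2`, determines the diagram and the
power. -/
theorem eq_of_smul_mat_eq {e f : ℕ} (h : 2 ^ e • mat X = 2 ^ f • mat Y) : e = f ∧ X = Y := by
  constructor
  · have h0 := congrFun (congrFun h fun _ => true) fun _ => true
    have hr : ∀ W : Diagram k, mat W (fun _ => true) (fun _ => true) = 1 := fun W =>
      if_pos (by rintro p; cases p <;> cases W.pair _ <;> rfl)
    simp only [Matrix.smul_apply, hr, smul_eq_mul, mul_one] at h0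
    exact Nat.pow_right_injective le_rfl h0
  · refine Diagram.eq_of_forall_respects fun c hc => ?_
    have h0 := congrFun (congrFun h fun i => c (Sum.inl i)) fun i => c (Sum.inr i)
    rw [← elim_row c] at hc ⊢
    by_contra hn
    simp [Matrix.smul_apply, mat, hc, hn] at h0

theorem stackGraph_colouring_iff (c : StackPoint k → Bool) :
    (∀ u v, (stackGraph X Y).Adj u v → c u = c v) ↔
      X.Respects (fun p => c (upper p)) ∧ Y.Respects (fun p => c (lower p)) := by
  constructor
  · exact fun h => ⟨fun p => (h _ _ (stackGraph_adj_upper X Y p)).symm,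
      fun p => (h _ _ (stackGraph_adj_lower X Y p)).symm⟩
  · rintro ⟨h1, h2⟩ u v h
    rcases (stackGraph_adj_iff X Y).1 h with ⟨p, rfl, rfl⟩ | ⟨p, rfl, rfl⟩
    · exact (h1 p).symm
    · exact (h2 p).symm

/-- The colouring of a stack with the given colours of the three rows. -/
def rows (s t r : Fin k → Bool) (v : StackPoint k) : Bool := ![s, t, r] v.1 v.2

theorem rows_upper (s t r : Fin k → Bool) : (fun p => rows s t r (upper p)) = Sum.elim s t := by
  ext (i | i) <;> rfl

theorem rows_lower (s t r : Fin k → Bool) : (fun p => rows s t r (lower p)) = Sum.elim t r := by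
  ext (i | i) <;> rfl

theorem rows_outer (s t r : Fin k → Bool) (p : Point k) :
    rows s t r (outer p) = Sum.elim s r p := by
  rcases p with i | i <;> rfl

theorem mat_mul_apply (s r : Fin k → Bool) : (mat X * mat Y) s r =
    Nat.card {t : Fin k → Bool // X.Respects (Sum.elim s t) ∧ Y.Respects (Sum.elim t r)} := by
  rw [Matrix.mul_apply, Nat.card_eq_fintype_card, Fintype.card_subtype, Finset.card_eq_sum_ones,
    Finset.sum_filter]
  refine Finset.sum_congr rfl fun t _ => ?_
  simp only [mat]
  split_ifs <;> simp_all

/-- The colours of the common edge correspond to the colourings of the components of the stack that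
extend the colours of the outer points. -/
def middleEquiv (X Y : Diagram k) (s r : Fin k → Bool) :
    {t : Fin k → Bool // X.Respects (Sum.elim s t) ∧ Y.Respects (Sum.elim t r)} ≃
      {g : (stackGraph X Y).ConnectedComponent → Bool //
        ∀ p, g ((stackGraph X Y).connectedComponentMk (outer p)) = Sum.elim s r p} where
  toFun t := ⟨colouringEquiv _ ⟨rows s t.1 r, (stackGraph_colouring_iff _).2 (by
    rw [rows_upper, rows_lower]; exact t.2)⟩, fun p => rows_outer s t.1 r p⟩
  invFun g := ⟨fun i => g.1 ((stackGraph X Y).connectedComponentMk (1, i)), by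
    have h := (stackGraph_colouring_iff _).1 ((colouringEquiv (stackGraph X Y)).symm g.1).2
    convert h using 3
    · rename_i p
      rcases p with i | i
      · exact (g.2 (Sum.inl i)).symm
      · rfl
    · rename_i p
      rcases p with i | i
      · rfl
      · exact (g.2 (Sum.inr i)).symm⟩
  left_inv t := rfl
  right_inv g := by
    apply Subtype.ext
    apply (colouringEquiv (stackGraph X Y)).symm.injective
    rw [Equiv.symm_apply_apply]
    apply Subtype.ext
    funext ⟨x, i⟩
    fin_cases x
    · exact (g.2 (Sum.inl i)).symm
    · rfl
    · exact (g.2 (Sum.inr i)).symm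

theorem IsStack.reachable_iff (h : IsStack X Y Z) {p r : Point k} :
    (stackGraph X Y).Reachable (outer p) (outer r) ↔ r = p ∨ r = Z.pair p := by
  constructor
  · intro hr
    by_cases hrp : r = p
    · exact Or.inl hrp
    · exact Or.inr (outer_unique X Y hr (h p) hrp (Z.pair_ne p))
  · rintro (rfl | rfl)
    · exact SimpleGraph.Reachable.rfl
    · exact h p

/-- The colouring matrix turns stacking into matrix multiplication, a closed loop counting for
`2`. -/
theorem IsStack.mat_mul_mat (h : IsStack X Y Z) :
    mat X * mat Y = 2 ^ stackLoops X Y • mat Z := by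
  ext s r
  rw [mat_mul_apply, Nat.card_congr (middleEquiv X Y s r), Matrix.smul_apply, mat]
  split_ifs with hc
  · set L := {c : (stackGraph X Y).ConnectedComponent //
      ∀ p, (stackGraph X Y).connectedComponentMk (outer p) ≠ c}
    let e : {g : (stackGraph X Y).ConnectedComponent → Bool //
        ∀ p, g ((stackGraph X Y).connectedComponentMk (outer p)) = Sum.elim s r p} ≃
        (L → Bool) :=
      { toFun := fun g c => g.1 c.1
        invFun := fun g => ⟨fun c =>
          if hc : ∃ p, (stackGraph X Y).connectedComponentMk (outer p) = c then
            Sum.elim s r hc.choose else g ⟨c, not_exists.1 hc⟩, fun p => by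
            have hp : ∃ p', (stackGraph X Y).connectedComponentMk (outer p') =
              (stackGraph X Y).connectedComponentMk (outer p) := ⟨p, rfl⟩
            refine (dif_pos hp).trans ?_
            rcases h.reachable_iff.1 (SimpleGraph.ConnectedComponent.exact hp.choose_spec)
              with h1 | h1
            · exact (congrArg _ h1).symm
            · exact ((congrArg _ h1).trans (hc _)).symm⟩
        left_inv := fun g => by
          apply Subtype.ext
          funext c
          dsimp only
          split_ifs with hp
          · conv_rhs => rw [← hp.choose_spec]
            exact (g.2 _).symm
          · rfl
        right_inv := fun g => by
          funext c
          exact dif_neg (not_exists.2 c.2) }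
    rw [Nat.card_congr e, Nat.card_fun]
    simp [stackLoops, L]
  · rw [smul_zero, Nat.card_eq_zero]
    left
    constructor
    rintro ⟨g, hg⟩
    refine hc fun p => ?_
    rw [← hg, ← hg, SimpleGraph.ConnectedComponent.sound (h p)]

theorem trace_mat (X : Diagram k) :
    (mat X).trace = 2 ^ Nat.card (closureGraph X).ConnectedComponent := by
  let e : {s : Fin k → Bool // X.Respects (Sum.elim s s)} ≃
      {c : Point k → Bool // ∀ u v, (closureGraph X).Adj u v → c u = c v} :=
    { toFun := fun s => ⟨Sum.elim s.1 s.1, by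
        have hs : ∀ u : Point k, Sum.elim s.1 s.1 u.swap = Sum.elim s.1 s.1 u := by
          rintro (i | i) <;> rfl
        intro u v h
        rw [closureGraph, SimpleGraph.fromRel_adj] at h
        obtain ⟨-, (rfl | rfl) | (rfl | rfl)⟩ := h
        · exact (s.2 u).symm
        · exact (hs u).symm
        · exact s.2 v
        · exact hs v⟩
      invFun := fun c => ⟨fun i => c.1 (Sum.inl i), by
        have hs : Sum.elim (fun i => c.1 (Sum.inl i)) (fun i => c.1 (Sum.inl i)) = c.1 := by
          ext (i | i)
          · rfl
          · refine c.2 _ _ ?_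
            rw [closureGraph, SimpleGraph.fromRel_adj]
            exact ⟨by simp, Or.inl (Or.inr rfl)⟩
        rw [hs]
        intro p
        refine (c.2 _ _ ?_).symm
        rw [closureGraph, SimpleGraph.fromRel_adj]
        exact ⟨(X.pair_ne p).symm, Or.inl (Or.inl rfl)⟩⟩
      left_inv := fun s => rfl
      right_inv := fun c => by
        apply Subtype.ext
        ext (i | i)
        · rfl
        · refine c.2 _ _ ?_
          rw [closureGraph, SimpleGraph.fromRel_adj]
          exact ⟨by simp, Or.inl (Or.inr rfl)⟩ }
  have h := Nat.card_congr (e.trans (colouringEquiv (closureGraph X)))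
  rw [Nat.card_fun, Nat.card_eq_fintype_card, Nat.card_eq_fintype_card (α := Bool),
    Fintype.card_bool] at h
  rw [← h, Matrix.trace, Fintype.card_subtype, Finset.card_eq_sum_ones, Finset.sum_filter]
  exact Finset.sum_congr rfl fun s _ => rfl

theorem mat_one : mat (Diagram.one k) = 1 := by
  ext s t
  rw [Matrix.one_apply, mat]
  congr 1
  rw [eq_iff_iff]
  constructor
  · intro h
    funext i
    exact (h (Sum.inl i)).symm
  · rintro rfl (i | i) <;> rfl

theorem mat_reflect (X : Diagram k) : mat X.reflect = (mat X).transpose := by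
  ext s t
  rw [Matrix.transpose_apply, mat, mat]
  congr 1
  have e : ∀ p : Point k, Sum.elim s t p.swap = Sum.elim t s p := by rintro (i | i) <;> rfl
  rw [eq_iff_iff]
  constructor
  · intro h p
    have := h p.swap
    simp only [Diagram.reflect, Sum.swap_swap, e] at this
    exact this
  · intro h p
    have h1 := h p.swap
    have h2 := e p.swap
    rw [Sum.swap_swap] at h2
    rw [← h2] at h1
    simpa only [Diagram.reflect, e] using h1

end Colouring

/-! ### The Temperley-Lieb algebra -/

section Algebra

variable {k : ℕ} {δ : ℝ}

/-- The diagram that is left when `X` is stacked on top of `Y`. -/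
def Diagram.comp (X Y : Diagram k) : Diagram k := (exists_isStack X Y).choose

theorem Diagram.isStack_comp (X Y : Diagram k) : IsStack X Y (X.comp Y) :=
  (exists_isStack X Y).choose_spec

theorem mat_mul_mat (X Y : Diagram k) : mat X * mat Y = 2 ^ stackLoops X Y • mat (X.comp Y) :=
  (X.isStack_comp Y).mat_mul_mat

theorem isStack_iff {X Y Z : Diagram k} : IsStack X Y Z ↔ Z = X.comp Y := by
  constructor
  · intro h
    exact (eq_of_smul_mat_eq (h.mat_mul_mat.symm.trans (mat_mul_mat X Y))).2
  · rintro rfl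
    exact X.isStack_comp Y

theorem mul_eq_sum (x y : TL k) : mul δ x y = ∑ X, ∑ Y,
    ((δ : ℂ) ^ stackLoops X Y * (x X * y Y)) • ofDiagram (X.comp Y) := by
  funext Z
  simp only [mul, isStack_iff, Finset.sum_apply, Pi.smul_apply, ofDiagram, Pi.single_apply,
    smul_eq_mul, mul_ite, mul_one, mul_zero]

theorem mul_ofDiagram (X Y : Diagram k) : mul δ (ofDiagram X) (ofDiagram Y) =
    (δ : ℂ) ^ stackLoops X Y • ofDiagram (X.comp Y) := by
  rw [mul_eq_sum, Finset.sum_eq_single X, Finset.sum_eq_single Y]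
  · simp [ofDiagram]
  · intro Y' _ h; simp [ofDiagram, h]
  · simp
  · intro X' _ h; simp [ofDiagram, h]
  · simp

theorem eq_sum_ofDiagram (x : TL k) : x = ∑ X, x X • ofDiagram X := by
  funext Z
  simp [Finset.sum_apply, ofDiagram, Pi.single_apply]

theorem mul_add_left (x x' y : TL k) :
    mul δ (x + x') y = mul δ x y + mul δ x' y := by
  funext Z
  simp only [mul, Pi.add_apply, ← Finset.sum_add_distrib]
  refine Finset.sum_congr rfl fun X _ => Finset.sum_congr rfl fun Y _ => ?_
  split_ifs <;> ring

theorem mul_smul_left (c : ℂ) (x y : TL k) :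
    mul δ (c • x) y = c • mul δ x y := by
  funext Z
  simp only [mul, Pi.smul_apply, smul_eq_mul, Finset.mul_sum]
  refine Finset.sum_congr rfl fun X _ => Finset.sum_congr rfl fun Y _ => ?_
  split_ifs <;> ring

theorem mul_add_right (x y y' : TL k) :
    mul δ x (y + y') = mul δ x y + mul δ x y' := by
  funext Z
  simp only [mul, Pi.add_apply, ← Finset.sum_add_distrib]
  refine Finset.sum_congr rfl fun X _ => Finset.sum_congr rfl fun Y _ => ?_
  split_ifs <;> ring

theorem mul_smul_right (c : ℂ) (x y : TL k) :
    mul δ x (c • y) = c • mul δ x y := by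
  funext Z
  simp only [mul, Pi.smul_apply, smul_eq_mul, Finset.mul_sum]
  refine Finset.sum_congr rfl fun X _ => Finset.sum_congr rfl fun Y _ => ?_
  split_ifs <;> ring

/-- The vector space `TL k`, as the carrier of the Temperley-Lieb algebra with modulus `δ`. -/
def Alg (_δ : ℝ) (k : ℕ) : Type := TL k

instance : AddCommGroup (Alg δ k) := inferInstanceAs (AddCommGroup (TL k))

instance : Module ℂ (Alg δ k) := inferInstanceAs (Module ℂ (TL k))

instance : Module ℝ (Alg δ k) := inferInstanceAs (Module ℝ (TL k))

instance : IsScalarTower ℝ ℂ (Alg δ k) := inferInstanceAs (IsScalarTower ℝ ℂ (TL k))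

/-- A diagram as an element of the Temperley-Lieb algebra. -/
def Alg.of (δ : ℝ) (X : Diagram k) : Alg δ k := ofDiagram X

theorem Alg.eq_sum_of (x : Alg δ k) : x = ∑ X, x X • Alg.of δ X := eq_sum_ofDiagram x

theorem Alg.induction {p : Alg δ k → Prop} (x : Alg δ k) (of : ∀ X, p (Alg.of δ X))
    (add : ∀ x y, p x → p y → p (x + y)) (smul : ∀ (c : ℂ) x, p x → p (c • x)) : p x := by
  rw [Alg.eq_sum_of x]
  refine Finset.sum_induction _ p add ?_ fun X _ => smul _ _ (of X)
  simpa using smul 0 _ (of (Diagram.one k))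

/-- The product of the Temperley-Lieb algebra as a bilinear map. -/
def mulHom (δ : ℝ) (k : ℕ) : Alg δ k →ₗ[ℂ] Alg δ k →ₗ[ℂ] Alg δ k :=
  LinearMap.mk₂ ℂ (fun x y => (mul δ x y : TL k)) mul_add_left mul_smul_left mul_add_right
    mul_smul_right

instance : Mul (Alg δ k) := ⟨fun x y => mulHom δ k x y⟩

instance : One (Alg δ k) := ⟨Alg.of δ (Diagram.one k)⟩

theorem Alg.one_def : (1 : Alg δ k) = Alg.of δ (Diagram.one k) := rfl

theorem Alg.smul_mul (c : ℂ) (x y : Alg δ k) : c • x * y = c • (x * y) :=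
  (mulHom δ k).map_smul₂ c x y

theorem Alg.mul_smul (c : ℂ) (x y : Alg δ k) : x * c • y = c • (x * y) :=
  (mulHom δ k x).map_smul c y

theorem Alg.of_mul_of (X Y : Diagram k) : Alg.of δ X * Alg.of δ Y =
    (δ : ℂ) ^ stackLoops X Y • Alg.of δ (X.comp Y) := mul_ofDiagram X Y

/-- Products of diagrams can be read off from the colouring matrices. -/
theorem Alg.of_mul_of_eq {X Y Z : Diagram k} {e : ℕ} (h : mat X * mat Y = 2 ^ e • mat Z) :
    Alg.of δ X * Alg.of δ Y = (δ : ℂ) ^ e • Alg.of δ Z := by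
  obtain ⟨h1, h2⟩ := eq_of_smul_mat_eq ((mat_mul_mat X Y).symm.trans h)
  rw [Alg.of_mul_of, h1, h2]

theorem Alg.of_mul_of_eq' {X Y Z : Diagram k} (h : mat X * mat Y = mat Z) :
    Alg.of δ X * Alg.of δ Y = Alg.of δ Z := by
  simpa using Alg.of_mul_of_eq (δ := δ) (e := 0) (by simpa using h)

theorem Alg.mul_add' (x y z : Alg δ k) : x * (y + z) = x * y + x * z :=
  (mulHom δ k x).map_add y z

theorem Alg.add_mul' (x y z : Alg δ k) : (x + y) * z = x * z + y * z :=
  (mulHom δ k).map_add₂ x y z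

theorem Alg.mul_assoc' (x y z : Alg δ k) : x * y * z = x * (y * z) := by
  induction x using Alg.induction with
  | add x x' h h' => simp only [Alg.add_mul', h, h']
  | smul c x h => simp only [Alg.smul_mul, h]
  | of X =>
    induction y using Alg.induction with
    | add x x' h h' => simp only [Alg.add_mul', Alg.mul_add', h, h']
    | smul c x h => simp only [Alg.smul_mul, Alg.mul_smul, h]
    | of Y =>
      induction z using Alg.induction with
      | add x x' h h' => simp only [Alg.mul_add', h, h']
      | smul c x h => simp only [Alg.mul_smul, h]
      | of Z =>
        rw [Alg.of_mul_of X Y, Alg.of_mul_of Y Z, Alg.smul_mul, Alg.mul_smul, Alg.of_mul_of,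
          Alg.of_mul_of, smul_smul, smul_smul, ← pow_add, ← pow_add]
        have h := Matrix.mul_assoc (mat X) (mat Y) (mat Z)
        rw [mat_mul_mat X Y, mat_mul_mat Y Z, Matrix.smul_mul, Matrix.mul_smul, mat_mul_mat,
          mat_mul_mat, smul_smul, smul_smul, ← pow_add, ← pow_add] at h
        obtain ⟨h1, h2⟩ := eq_of_smul_mat_eq h
        rw [h1, h2]

instance : Ring (Alg δ k) :=
  { (inferInstance : AddCommGroup (Alg δ k)), (inferInstance : Mul (Alg δ k)),
    (inferInstance : One (Alg δ k)) with
    left_distrib := Alg.mul_add'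
    right_distrib := Alg.add_mul'
    zero_mul := fun x => (mulHom δ k).map_zero₂ x
    mul_zero := fun x => (mulHom δ k x).map_zero
    mul_assoc := Alg.mul_assoc'
    one_mul := fun x => by
      induction x using Alg.induction with
      | add x x' h h' => simp only [Alg.mul_add', h, h']
      | smul c x h => simp only [Alg.mul_smul, h]
      | of X => exact Alg.of_mul_of_eq' (by rw [mat_one, Matrix.one_mul])
    mul_one := fun x => by
      induction x using Alg.induction with
      | add x x' h h' => simp only [Alg.add_mul', h, h']
      | smul c x h => simp only [Alg.smul_mul, h]
      | of X => exact Alg.of_mul_of_eq' (by rw [mat_one, Matrix.mul_one]) }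

instance : Algebra ℂ (Alg δ k) := Algebra.ofModule Alg.smul_mul Alg.mul_smul

theorem Alg.real_smul (r : ℝ) (x : Alg δ k) : r • x = (r : ℂ) • x := by
  rw [← smul_one_smul ℂ r x, Complex.real_smul, mul_one]

instance : Algebra ℝ (Alg δ k) := Algebra.ofModule
  (fun r x y => by rw [Alg.real_smul, Alg.real_smul, smul_mul_assoc])
  (fun r x y => by rw [Alg.real_smul, Alg.real_smul, mul_smul_comm])

/-- The Markov trace as a linear functional. -/
def Alg.tr (δ : ℝ) (k : ℕ) : Alg δ k →ₗ[ℂ] ℂ where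
  toFun x := trace δ x
  map_add' x y := by
    simp only [trace, ← Finset.sum_add_distrib, ← add_mul]
    rfl
  map_smul' c x := by
    simp only [trace, smul_eq_mul, Finset.mul_sum, ← mul_assoc, RingHom.id_apply]
    rfl

theorem Alg.tr_of (X : Diagram k) :
    Alg.tr δ k (Alg.of δ X) = (δ : ℂ) ^ Nat.card (closureGraph X).ConnectedComponent := by
  change ∑ Y, ofDiagram X Y * _ = _
  rw [Finset.sum_eq_single X]
  · simp [ofDiagram]
  · intro Y _ h; simp [ofDiagram, h]
  · simp

theorem Alg.tr_of_eq {X : Diagram k} {e : ℕ} (h : (mat X).trace = 2 ^ e) :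
    Alg.tr δ k (Alg.of δ X) = (δ : ℂ) ^ e := by
  rw [trace_mat] at h
  rw [Alg.tr_of, Nat.pow_right_injective le_rfl h]

/-- The trace of a product of two diagrams is the power of `δ` that corresponds to the power of `2`
in the two-colour model. -/
theorem Alg.exists_tr_mul (X Y : Diagram k) : ∃ e : ℕ, (mat X * mat Y).trace = 2 ^ e ∧
    ∀ δ, Alg.tr δ k (Alg.of δ X * Alg.of δ Y) = (δ : ℂ) ^ e := by
  refine ⟨stackLoops X Y + Nat.card (closureGraph (X.comp Y)).ConnectedComponent, ?_, fun δ => ?_⟩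
  · rw [mat_mul_mat, Matrix.trace_smul, trace_mat, smul_eq_mul, pow_add]
  · rw [Alg.of_mul_of, map_smul, Alg.tr_of, smul_eq_mul, pow_add]

theorem Alg.tr_mul_of_eq {X Y : Diagram k} {e : ℕ} (h : (mat X * mat Y).trace = 2 ^ e) :
    Alg.tr δ k (Alg.of δ X * Alg.of δ Y) = (δ : ℂ) ^ e := by
  obtain ⟨f, h1, h2⟩ := Alg.exists_tr_mul X Y
  rw [h2, Nat.pow_right_injective le_rfl (h1.symm.trans h)]

theorem Alg.tr_mul_comm (x y : Alg δ k) : Alg.tr δ k (x * y) = Alg.tr δ k (y * x) := by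
  induction x using Alg.induction with
  | add x x' h h' => simp only [add_mul, mul_add, map_add, h, h']
  | smul c x h => simp only [smul_mul_assoc, mul_smul_comm, map_smul, h]
  | of X =>
    induction y using Alg.induction with
    | add x x' h h' => simp only [add_mul, mul_add, map_add, h, h']
    | smul c x h => simp only [smul_mul_assoc, mul_smul_comm, map_smul, h]
    | of Y =>
      obtain ⟨e, h1, h2⟩ := Alg.exists_tr_mul X Y
      rw [h2, Alg.tr_mul_of_eq (by rw [Matrix.trace_mul_comm, h1])]

/-! ### Reflection -/

theorem Diagram.reflect_reflect (X : Diagram k) : X.reflect.reflect = X := by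
  ext p
  simp [Diagram.reflect]

theorem Diagram.reflect_eq_iff {X Y : Diagram k} : X.reflect = Y ↔ X = Y.reflect :=
  ⟨fun h => by rw [← h, X.reflect_reflect], fun h => by rw [h, Y.reflect_reflect]⟩

/-- Vertical reflection as a linear map. -/
def Alg.refl (δ : ℝ) (k : ℕ) : Alg δ k →ₗ[ℂ] Alg δ k where
  toFun x := (reflect x : TL k)
  map_add' _ _ := rfl
  map_smul' _ _ := rfl

theorem Alg.refl_of (X : Diagram k) : Alg.refl δ k (Alg.of δ X) = Alg.of δ X.reflect := by
  funext Y
  change ofDiagram X Y.reflect = ofDiagram X.reflect Y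
  simp only [ofDiagram, Pi.single_apply, Diagram.reflect_eq_iff]

theorem Alg.refl_refl (x : Alg δ k) : Alg.refl δ k (Alg.refl δ k x) = x := by
  funext X
  change x X.reflect.reflect = x X
  rw [X.reflect_reflect]

theorem Alg.refl_mul (x y : Alg δ k) :
    Alg.refl δ k (x * y) = Alg.refl δ k y * Alg.refl δ k x := by
  induction x using Alg.induction with
  | add x x' h h' => simp only [add_mul, mul_add, map_add, h, h']
  | smul c x h => simp only [smul_mul_assoc, mul_smul_comm, map_smul, h]
  | of X =>
    induction y using Alg.induction with
    | add x x' h h' => simp only [add_mul, mul_add, map_add, h, h']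
    | smul c x h => simp only [smul_mul_assoc, mul_smul_comm, map_smul, h]
    | of Y =>
      rw [Alg.of_mul_of, map_smul, Alg.refl_of, Alg.refl_of, Alg.refl_of]
      refine (Alg.of_mul_of_eq ?_).symm
      rw [mat_reflect, mat_reflect, mat_reflect, ← Matrix.transpose_mul, mat_mul_mat,
        Matrix.transpose_smul]

theorem Alg.tr_refl (x : Alg δ k) : Alg.tr δ k (Alg.refl δ k x) = Alg.tr δ k x := by
  induction x using Alg.induction with
  | add x x' h h' => simp only [map_add, h, h']
  | smul c x h => simp only [map_smul, h]
  | of X =>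
    rw [Alg.refl_of, Alg.tr_of X]
    exact Alg.tr_of_eq (by rw [mat_reflect, Matrix.trace_transpose, trace_mat])

/-- The coefficientwise complex conjugate. -/
def Alg.conj (x : Alg δ k) : Alg δ k := fun X => starRingEnd ℂ (x X)

theorem Alg.conj_add (x y : Alg δ k) : (x + y).conj = x.conj + y.conj :=
  funext fun X => map_add (starRingEnd ℂ) (x X) (y X)

theorem Alg.conj_smul (c : ℂ) (x : Alg δ k) : (c • x).conj = starRingEnd ℂ c • x.conj :=
  funext fun X => map_mul (starRingEnd ℂ) c (x X)

theorem Alg.conj_of (X : Diagram k) : (Alg.of δ X).conj = Alg.of δ X := by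
  funext Y
  change starRingEnd ℂ (ofDiagram X Y) = ofDiagram X Y
  simp only [ofDiagram, Pi.single_apply]
  split_ifs <;> simp

theorem Alg.conj_mul (x y : Alg δ k) : (x * y).conj = x.conj * y.conj := by
  induction x using Alg.induction with
  | add x x' h h' => simp only [add_mul, Alg.conj_add, h, h']
  | smul c x h => simp only [smul_mul_assoc, Alg.conj_smul, h]
  | of X =>
    induction y using Alg.induction with
    | add x x' h h' => simp only [mul_add, Alg.conj_add, h, h']
    | smul c x h => simp only [mul_smul_comm, Alg.conj_smul, h]
    | of Y => simp [Alg.of_mul_of, Alg.conj_smul, Alg.conj_of]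

instance : StarRing (Alg δ k) where
  star x := (adjoint x : TL k)
  star_involutive x := by
    funext X
    change starRingEnd ℂ (starRingEnd ℂ (x X.reflect.reflect)) = x X
    rw [X.reflect_reflect, Complex.conj_conj]
  star_mul x y := by
    change (Alg.refl δ k (x * y)).conj = (Alg.refl δ k y).conj * (Alg.refl δ k x).conj
    rw [Alg.refl_mul, Alg.conj_mul]
  star_add x y := by
    change (Alg.refl δ k (x + y)).conj = (Alg.refl δ k x).conj + (Alg.refl δ k y).conj
    rw [map_add, Alg.conj_add]

theorem Alg.star_def (x : Alg δ k) : star x = (Alg.refl δ k x).conj := rfl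

theorem Alg.star_of (X : Diagram k) : star (Alg.of δ X) = Alg.of δ X.reflect := by
  rw [Alg.star_def, Alg.refl_of, Alg.conj_of]

theorem Alg.star_refl (x : Alg δ k) : star (Alg.refl δ k x) = Alg.refl δ k (star x) := rfl

instance : StarModule ℝ (Alg δ k) where
  star_smul r x := by
    rw [Alg.real_smul, Alg.real_smul, Alg.star_def, map_smul, Alg.conj_smul, Complex.conj_ofReal]
    rfl

end Algebra

/-! ### Quantum integers -/

section QuantumIntegers

variable {q : ℝ}

theorem qInt_zero (q : ℝ) : qInt q 0 = 0 := by simp [qInt]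

theorem sub_inv_ne_zero (hq : 2 < q + q⁻¹) : q - q⁻¹ ≠ 0 := by
  intro h
  have h0 : q ≠ 0 := by rintro rfl; norm_num at hq
  have h1 : q * q⁻¹ = 1 := mul_inv_cancel₀ h0
  nlinarith

theorem qInt_one (hq : 2 < q + q⁻¹) : qInt q 1 = 1 := by
  simp [qInt, div_self (sub_inv_ne_zero hq)]

theorem qInt_add_two (hq : 2 < q + q⁻¹) (k : ℕ) :
    qInt q (k + 2) = (q + q⁻¹) * qInt q (k + 1) - qInt q k := by
  have h0 : q ≠ 0 := by rintro rfl; norm_num at hq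
  have h1 : q * q⁻¹ = 1 := mul_inv_cancel₀ h0
  have h := sub_inv_ne_zero hq
  simp only [qInt]
  rw [← mul_div_assoc, ← sub_div]
  congr 1
  linear_combination (q⁻¹ ^ k - q ^ k) * h1

theorem qInt_succ_pos (hq : 2 < q + q⁻¹) (k : ℕ) : 0 < qInt q (k + 1) := by
  have h : ∀ k, 0 ≤ qInt q k ∧ qInt q k < qInt q (k + 1) := by
    intro k
    induction k with
    | zero => simp [qInt_zero, qInt_one hq]
    | succ k ih =>
      rw [qInt_add_two hq]
      constructor <;> nlinarith
  exact (h k).1.trans_lt (h k).2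

theorem qInt_add_two_div (hq : 2 < q + q⁻¹) (k : ℕ) :
    qInt q (k + 2) / qInt q (k + 1) = q + q⁻¹ - qInt q k / qInt q (k + 1) := by
  rw [qInt_add_two hq, sub_div, mul_div_cancel_right₀ _ (qInt_succ_pos hq k).ne']

/-- The analogue of the identity `a + b + 2 = (a + 2) * (b + 1) - (a + 1) * b` for quantum
integers. -/
theorem qInt_add_add_two (hq : 2 < q + q⁻¹) (a b : ℕ) :
    qInt q (a + b + 2) = qInt q (a + 2) * qInt q (b + 1) - qInt q (a + 1) * qInt q b := by
  induction b generalizing a with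
  | zero => simp [qInt_zero, qInt_one hq]
  | succ b ih =>
    rw [show a + (b + 1) + 2 = a + 1 + b + 2 by omega, ih (a + 1), qInt_add_two hq b,
      show a + 1 + 2 = (a + 1) + 2 from rfl, qInt_add_two hq (a + 1)]
    ring

end QuantumIntegers

/-! ### Jones-Wenzl elements of an abstract algebra -/

section Abstract

variable {A : Type*} [Ring A] [Algebra ℝ A] {q δ : ℝ} {K : ℕ} {u : ℕ → A}

/-- The Jones-Wenzl element on `k` strands by Wenzl's recursion, for a sequence `u` of elements of
an algebra in the role of the generators. -/
def jw (q : ℝ) (u : ℕ → A) : ℕ → A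
  | 0 => 1
  | 1 => 1
  | k + 2 => jw q u (k + 1) -
      (qInt q (k + 1) / qInt q (k + 2)) • (jw q u (k + 1) * u k * jw q u (k + 1))

/-- Wenzl's recursion holds for `k = 0` too, since its coefficient vanishes. -/
theorem jw_succ (q : ℝ) (u : ℕ → A) (k : ℕ) : jw q u (k + 1) =
    jw q u k - (qInt q k / qInt q (k + 1)) • (jw q u k * u (k - 1) * jw q u k) := by
  cases k with
  | zero => simp [jw, qInt_zero]
  | succ k => rfl

theorem jw_congr {v : ℕ → A} (k : ℕ) (h : ∀ i, i + 1 < k → u i = v i) : jw q u k = jw q v k := by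
  induction k with
  | zero => rfl
  | succ k ih =>
    cases k with
    | zero => rfl
    | succ k =>
      rw [jw, jw, ih fun i hi => h i (by omega), h k (by omega)]

theorem map_jw {B : Type*} [Ring B] [Algebra ℝ B] (φ : A →ₐ[ℝ] B) (k : ℕ) :
    φ (jw q u k) = jw q (fun i => φ (u i)) k := by
  induction k with
  | zero => exact map_one φ
  | succ k ih => rw [jw_succ, jw_succ, map_sub, map_smul, map_mul, map_mul, ih]

theorem jw_mem (S : Subalgebra ℝ A) (k : ℕ) (h : ∀ i, i + 1 < k → u i ∈ S) : jw q u k ∈ S := by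
  induction k with
  | zero => exact S.one_mem
  | succ k ih =>
    cases k with
    | zero => exact S.one_mem
    | succ k =>
      have h1 := ih fun i hi => h i (by omega)
      exact S.sub_mem h1 (S.smul_mem (S.mul_mem (S.mul_mem h1 (h k (by omega))) h1) _)

theorem commute_jw {x : A} (k : ℕ) (h : ∀ i, i + 1 < k → Commute x (u i)) :
    Commute x (jw q u k) := by
  have h1 := jw_mem (q := q) (u := u) (Subalgebra.centralizer ℝ {x}) k fun i hi y hy => by
    rw [Set.mem_singleton_iff.1 hy]
    exact h i hi
  exact h1 x rfl

/-- A Jones-Wenzl element is `1` modulo the ideal of the generators, and so acts as `1` on what the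
generators kill. -/
theorem mul_jw {p : A} (k : ℕ) (h : ∀ i, i + 1 < k → p * u i = 0) : p * jw q u k = p := by
  induction k with
  | zero => exact mul_one p
  | succ k ih =>
    cases k with
    | zero => exact mul_one p
    | succ k =>
      rw [jw, mul_sub, mul_smul_comm, ← mul_assoc, ← mul_assoc, ih fun i hi => h i (by omega),
        h k (by omega), zero_mul, smul_zero, sub_zero]

theorem jw_mul {p : A} (k : ℕ) (h : ∀ i, i + 1 < k → u i * p = 0) : jw q u k * p = p := by
  induction k with
  | zero => exact one_mul p
  | succ k ih =>
    cases k with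
    | zero => exact one_mul p
    | succ k =>
      rw [jw, sub_mul, smul_mul_assoc, mul_assoc, mul_assoc, ih fun i hi => h i (by omega),
        h k (by omega), mul_zero, smul_zero, sub_zero]

variable [StarRing A]

/-- The first `K` terms of the sequence `u` satisfy the Temperley-Lieb relations with modulus `δ`;
all terms are self-adjoint. -/
structure IsTL (δ : ℝ) (K : ℕ) (u : ℕ → A) : Prop where
  star_eq : ∀ i, star (u i) = u i
  sq : ∀ i, i < K → u i * u i = δ • u i
  up : ∀ i, i + 1 < K → u i * u (i + 1) * u i = u i
  down : ∀ i, i + 1 < K → u (i + 1) * u i * u (i + 1) = u (i + 1)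
  comm : ∀ i j, j < K → i + 2 ≤ j → Commute (u i) (u j)

theorem star_jw [StarModule ℝ A] (h : ∀ i, star (u i) = u i) (k : ℕ) :
    star (jw q u k) = jw q u k := by
  induction k with
  | zero => exact star_one A
  | succ k ih =>
    rw [jw_succ, star_sub, star_smul, star_mul, star_mul, ih, h, star_trivial, mul_assoc]

namespace IsTL

theorem shift (h : IsTL δ K u) {m K' : ℕ} (hK : K' + m ≤ K) : IsTL δ K' (fun i => u (i + m)) where
  star_eq i := h.star_eq _
  sq i hi := h.sq _ (by omega)
  up i hi := by
    have := h.up (i + m) (by omega)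
    rwa [show i + m + 1 = i + 1 + m by omega] at this
  down i hi := by
    have := h.down (i + m) (by omega)
    rwa [show i + m + 1 = i + 1 + m by omega] at this
  comm i j hj hij := h.comm _ _ (by omega) (by omega)

theorem reverse (h : IsTL δ K u) : IsTL δ K (fun i => u (K - 1 - i)) where
  star_eq i := h.star_eq _
  sq i hi := h.sq _ (by omega)
  up i hi := by
    have := h.down (K - 1 - (i + 1)) (by omega)
    rwa [show K - 1 - (i + 1) + 1 = K - 1 - i by omega] at this
  down i hi := by
    have := h.up (K - 1 - (i + 1)) (by omega)
    rwa [show K - 1 - (i + 1) + 1 = K - 1 - i by omega] at this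
  comm i j hj hij := (h.comm _ _ (by omega) (by omega)).symm

theorem commute_jw_of_le (h : IsTL δ K u) {j k : ℕ} (hj : j < K) (hk : k ≤ j) :
    Commute (u j) (jw q u k) :=
  commute_jw k fun i hi => (h.comm i j hj (by omega)).symm

/-- The partial trace of a Jones-Wenzl element is a multiple of the preceding one, provided that the
latter is idempotent. -/
theorem cap_jw_of_idem (hq : 2 < q + q⁻¹) (h : IsTL (q + q⁻¹) K u) {k : ℕ} (hk : k < K)
    (hP : jw q u k * jw q u k = jw q u k) :
    u k * jw q u (k + 1) * u k = (qInt q (k + 2) / qInt q (k + 1)) • (jw q u k * u k) := by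
  have hc : u k * jw q u k = jw q u k * u k := h.commute_jw_of_le hk le_rfl
  rw [qInt_add_two_div hq, jw_succ, mul_sub, sub_mul, sub_smul]
  congr 1
  · rw [hc, mul_assoc, h.sq k hk, mul_smul_comm]
  · rw [mul_smul_comm, smul_mul_assoc]
    rcases Nat.eq_zero_or_pos k with rfl | hk0
    · simp [qInt_zero]
    obtain ⟨k, rfl⟩ := Nat.exists_eq_succ_of_ne_zero hk0.ne'
    congr 1
    calc u (k + 1) * (jw q u (k + 1) * u (k + 1 - 1) * jw q u (k + 1)) * u (k + 1)
        = (u (k + 1) * jw q u (k + 1)) * u k * (jw q u (k + 1) * u (k + 1)) := by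
          simp only [mul_assoc, Nat.add_sub_cancel]
      _ = jw q u (k + 1) * (u (k + 1) * u k * u (k + 1)) * jw q u (k + 1) := by
          rw [← hc]
          nth_rw 1 [hc]
          simp only [mul_assoc]
      _ = _ := by rw [h.down k hk, mul_assoc, hc, ← mul_assoc, hP]

/-- The generators kill the Jones-Wenzl element. By induction: for the last generator the recursion
and the partial trace give two terms that cancel. -/
theorem gen_mul_jw (hq : 2 < q + q⁻¹) (h : IsTL (q + q⁻¹) K u) {k : ℕ} (hk : k ≤ K + 1) {i : ℕ}
    (hi : i + 1 < k) : u i * jw q u k = 0 := by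
  induction k using Nat.strong_induction_on generalizing i with
  | _ k ih =>
    obtain ⟨k, rfl⟩ : ∃ m, k = m + 2 := ⟨k - 2, by omega⟩
    have hP : jw q u k * jw q u k = jw q u k :=
      jw_mul k fun j hj => ih k (by omega) (by omega) hj
    have hP' : jw q u k * jw q u (k + 1) = jw q u (k + 1) :=
      jw_mul k fun j hj => ih (k + 1) (by omega) (by omega) (by omega)
    have hpos := (qInt_succ_pos hq k).ne'
    have hpos' := (qInt_succ_pos hq (k + 1)).ne'
    rw [jw, mul_sub, mul_smul_comm]
    rcases Nat.lt_succ_iff_lt_or_eq.1 (Nat.lt_of_add_lt_add_right hi) with hi' | rfl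
    · rw [mul_assoc (jw q u (k + 1)), ← mul_assoc (u i),
        ih (k + 1) (by omega) (by omega) (by omega), zero_mul, smul_zero, sub_zero]
    · rw [← mul_assoc, ← mul_assoc, h.cap_jw_of_idem hq (by omega) hP, smul_mul_assoc, smul_smul,
        ← (h.commute_jw_of_le (by omega) le_rfl).eq, mul_assoc, hP', div_mul_div_comm,
        mul_comm (qInt q (i + 1)), div_self (mul_ne_zero hpos' hpos), one_smul, sub_self]

theorem jw_mul_gen [StarModule ℝ A] (hq : 2 < q + q⁻¹) (h : IsTL (q + q⁻¹) K u) {k : ℕ}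
    (hk : k ≤ K + 1) {i : ℕ} (hi : i + 1 < k) : jw q u k * u i = 0 := by
  have := congrArg star (h.gen_mul_jw hq hk hi)
  rwa [star_mul, star_jw h.star_eq, h.star_eq, star_zero] at this

theorem jw_mul_jw (hq : 2 < q + q⁻¹) (h : IsTL (q + q⁻¹) K u) {k l : ℕ} (hl : l ≤ K + 1)
    (hkl : k ≤ l) : jw q u k * jw q u l = jw q u l :=
  jw_mul k fun _ hi => h.gen_mul_jw hq hl (by omega)

theorem jw_mul_jw' [StarModule ℝ A] (hq : 2 < q + q⁻¹) (h : IsTL (q + q⁻¹) K u) {k l : ℕ}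
    (hl : l ≤ K + 1) (hkl : k ≤ l) : jw q u l * jw q u k = jw q u l :=
  mul_jw k fun _ hi => h.jw_mul_gen hq hl (by omega)

theorem cap_jw (hq : 2 < q + q⁻¹) (h : IsTL (q + q⁻¹) K u) {k : ℕ} (hk : k < K) :
    u k * jw q u (k + 1) * u k = (qInt q (k + 2) / qInt q (k + 1)) • (jw q u k * u k) :=
  h.cap_jw_of_idem hq hk (h.jw_mul_jw hq (by omega) le_rfl)

/-- Wenzl's recursion from the left: the Jones-Wenzl element of the reversed sequence of generators
is killed by the same elements, hence it is the same. -/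
theorem jw_succ_left [StarModule ℝ A] (hq : 2 < q + q⁻¹) (h : IsTL (q + q⁻¹) K u) :
    jw q u (K + 1) = jw q (fun i => u (K - 1 - i)) K - (qInt q K / qInt q (K + 1)) •
      (jw q (fun i => u (K - 1 - i)) K * u 0 * jw q (fun i => u (K - 1 - i)) K) := by
  have h1 : jw q u (K + 1) * jw q (fun i => u (K - 1 - i)) (K + 1) = jw q u (K + 1) :=
    mul_jw _ fun i hi => h.jw_mul_gen hq le_rfl (by omega)
  have h2 : jw q u (K + 1) * jw q (fun i => u (K - 1 - i)) (K + 1) =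
      jw q (fun i => u (K - 1 - i)) (K + 1) := by
    refine jw_mul _ fun i hi => ?_
    have := h.reverse.gen_mul_jw hq le_rfl (i := K - 1 - i) (by omega)
    rwa [show K - 1 - (K - 1 - i) = i by omega] at this
  rw [← h1, h2, jw_succ, show K - 1 - (K - 1) = 0 by omega]

end IsTL

/-! ### Words with one turn -/

/-- The product `u (a + b) * ⋯ * u (a + 1) * u a`, which is the two-cup diagram if `u` is the
sequence of the generators. -/
def desc {A : Type*} [Ring A] (u : ℕ → A) (a : ℕ) : ℕ → A
  | 0 => u a
  | b + 1 => u (a + b + 1) * desc u a b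

theorem desc_eq_mul {A : Type*} [Ring A] (u : ℕ → A) (a b : ℕ) :
    ∃ z, desc u a b = u (a + b) * z := by
  cases b with
  | zero => exact ⟨1, (mul_one _).symm⟩
  | succ b => exact ⟨_, rfl⟩

namespace IsTL

theorem commute_desc_of_le (h : IsTL δ K u) {a b j : ℕ} (hb : a + b < K) (hj : j + 2 ≤ a) :
    Commute (u j) (desc u a b) := by
  induction b with
  | zero => exact h.comm j a hb hj
  | succ b ih => exact (h.comm j (a + b + 1) hb (by omega)).mul_right (ih (by omega))

theorem commute_desc_of_ge (h : IsTL δ K u) {a b j : ℕ} (hj : j < K) (hb : a + b + 2 ≤ j) :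
    Commute (u j) (desc u a b) := by
  induction b with
  | zero => exact (h.comm a j hj hb).symm
  | succ b ih => exact (h.comm (a + b + 1) j hj (by omega)).symm.mul_right (ih (by omega))

/-- A generator to the right of the turn moves through the word two places to the left. -/
theorem desc_mul (h : IsTL δ K u) {a b j : ℕ} (hb : a + b < K) (hj : a ≤ j) (hj' : j + 2 ≤ a + b) :
    desc u a b * u (j + 2) = u j * desc u a b := by
  induction b with
  | zero => omega
  | succ b ih =>
    rcases Nat.lt_or_ge (a + b) (j + 2) with hlt | hge
    · obtain ⟨b, rfl⟩ : ∃ c, b = c + 1 := ⟨b - 1, by omega⟩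
      obtain rfl : j = a + b := by omega
      obtain ⟨z, hz⟩ := desc_eq_mul u a b
      have e1 : u (a + b + 2) * desc u a b = desc u a b * u (a + b + 2) :=
        h.commute_desc_of_ge (by omega) le_rfl
      have e2 := h.down (a + b + 1) hb
      have e3 := h.up (a + b) (by omega)
      have e4 : u (a + b) * u (a + b + 2) = u (a + b + 2) * u (a + b) :=
        h.comm (a + b) (a + b + 2) hb le_rfl
      change u (a + b + 2) * (u (a + b + 1) * desc u a b) * u (a + b + 2) =
        u (a + b) * (u (a + b + 2) * (u (a + b + 1) * desc u a b))
      calc _ = u (a + b + 2) * u (a + b + 1) * (desc u a b * u (a + b + 2)) := by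
            simp only [mul_assoc]
        _ = u (a + b + 2) * u (a + b + 1) * u (a + b + 2) * desc u a b := by
            rw [← e1]; simp only [mul_assoc]
        _ = u (a + b + 2) * (u (a + b) * u (a + b + 1) * u (a + b)) * z := by
            rw [e2, e3, hz, mul_assoc]
        _ = (u (a + b + 2) * u (a + b)) * (u (a + b + 1) * (u (a + b) * z)) := by
            simp only [mul_assoc]
        _ = _ := by rw [← e4, ← hz, mul_assoc]
    · have e : u (a + b + 1) * u j = u j * u (a + b + 1) :=
        (h.comm j (a + b + 1) hb (by omega)).symm
      rw [desc, mul_assoc, ih (by omega) hge, ← mul_assoc, e, mul_assoc]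

/-- The step from `b` to `b + 1` in the evaluation of a word with a turn and its reflection: the new
generators enclose `u (a + b)`, and the relation `down` applies. -/
theorem desc_conj_succ (h : IsTL δ K u) {a b : ℕ} (hb : a + b + 1 < K) {x y : A}
    (hy : Commute y (u (a + b + 1)))
    (hx : desc u a b * x * star (desc u a b) = y * u (a + b)) :
    desc u a (b + 1) * x * star (desc u a (b + 1)) = y * u (a + (b + 1)) := by
  have e := h.down (a + b) hb
  rw [desc, star_mul, h.star_eq]
  calc _ = u (a + b + 1) * (desc u a b * x * star (desc u a b)) * u (a + b + 1) := by
        simp only [mul_assoc]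
    _ = y * (u (a + b + 1) * u (a + b) * u (a + b + 1)) := by
        rw [hx, ← mul_assoc, ← hy.eq]; simp only [mul_assoc]
    _ = _ := by rw [e]; rfl

theorem desc_conj_one (h : IsTL δ K u) {a b : ℕ} (hb : a + b < K) :
    desc u a b * star (desc u a b) = δ • u (a + b) := by
  have key : desc u a b * 1 * star (desc u a b) = algebraMap ℝ A δ * u (a + b) := by
    induction b with
    | zero => rw [desc, h.star_eq, mul_one, h.sq a hb, Algebra.smul_def]; rfl
    | succ b ih => exact h.desc_conj_succ hb (Algebra.commutes _ _) (ih (by omega))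
  rwa [mul_one, ← Algebra.smul_def] at key

theorem desc_conj_left (h : IsTL δ K u) {a b : ℕ} (hb : a + 1 + b < K) :
    desc u (a + 1) b * u a * star (desc u (a + 1) b) = u (a + 1 + b) := by
  have key : desc u (a + 1) b * u a * star (desc u (a + 1) b) = 1 * u (a + 1 + b) := by
    induction b with
    | zero => rw [desc, h.star_eq, h.down a hb, one_mul]
    | succ b ih => exact h.desc_conj_succ hb (Commute.one_left _) (ih (by omega))
  rwa [one_mul] at key

theorem desc_conj_right (h : IsTL δ K u) {a b : ℕ} (hb : a + (b + 1) < K) :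
    desc u a (b + 1) * u (a + 1) * star (desc u a (b + 1)) = u (a + (b + 1)) := by
  have key : desc u a (b + 1) * u (a + 1) * star (desc u a (b + 1)) = 1 * u (a + (b + 1)) := by
    induction b with
    | zero =>
      rw [desc, desc, star_mul, h.star_eq, h.star_eq, one_mul]
      change u (a + 1) * u a * u (a + 1) * (u a * u (a + 1)) = u (a + 1)
      rw [h.down a hb, ← mul_assoc, h.down a hb]
    | succ b ih => exact h.desc_conj_succ hb (Commute.one_left _) (ih (by omega))
  rwa [one_mul] at key

theorem desc_conj_both (h : IsTL δ K u) {a b : ℕ} (hb : a + 1 + (b + 1) < K) :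
    desc u (a + 1) (b + 1) * (u a * u (a + 2)) * star (desc u (a + 1) (b + 1)) =
      u a * u (a + 1 + (b + 1)) := by
  induction b with
  | zero =>
    have e2 : u (a + 2) * u (a + 1) * u (a + 2) = u (a + 2) := h.down (a + 1) hb
    have e : u a * u (a + 2) = u (a + 2) * u a := h.comm a (a + 2) hb le_rfl
    rw [desc, desc, star_mul, h.star_eq, h.star_eq]
    change u (a + 2) * u (a + 1) * (u a * u (a + 2)) * (u (a + 1) * u (a + 2)) = u a * u (a + 2)
    calc _ = u (a + 2) * u (a + 1) * u (a + 2) * u a * (u (a + 1) * u (a + 2)) := by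
          rw [e]; simp only [mul_assoc]
      _ = _ := by rw [e2, ← e, mul_assoc, ← mul_assoc (u (a + 2)), e2]
  | succ b ih => exact h.desc_conj_succ hb (h.comm _ _ hb (by omega)) (ih (by omega))

end IsTL

end Abstract

/-! ### Markov traces -/

section Markov

variable {A : Type*} [Ring A] [Algebra ℝ A] {q δ : ℝ} {K : ℕ} {u : ℕ → A} {τ : A →ₗ[ℝ] ℂ}

/-- A tracial functional `τ` has the Markov property with respect to the first `K` terms of `u`. -/
structure IsMarkov (δ : ℝ) (K : ℕ) (u : ℕ → A) (τ : A →ₗ[ℝ] ℂ) : Prop where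
  comm : ∀ x y, τ (x * y) = τ (y * x)
  markov : ∀ k, k < K → ∀ x ∈ Algebra.adjoin ℝ (u '' Set.Iio k), δ • τ (x * u k) = τ x

theorem gen_mem_adjoin {k i : ℕ} (hi : i < k) : u i ∈ Algebra.adjoin ℝ (u '' Set.Iio k) :=
  Algebra.subset_adjoin ⟨i, hi, rfl⟩

theorem star_desc_mem [StarRing A] (hu : ∀ i, star (u i) = u i) (S : Subalgebra ℝ A) (a b : ℕ)
    (h : ∀ i, i ≤ a + b → u i ∈ S) : star (desc u a b) ∈ S := by
  induction b with
  | zero => rw [desc, hu]; exact h a le_rfl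
  | succ b ih =>
    rw [desc, star_mul, hu]
    exact S.mul_mem (ih fun i hi => h i (by omega)) (h _ le_rfl)

namespace IsTL

variable [StarRing A]

theorem trace_jw (hq : 2 < q + q⁻¹) (h : IsTL (q + q⁻¹) K u) (hτ : IsMarkov (q + q⁻¹) K u τ) {k : ℕ}
    (hk : k ≤ K + 1) : (q + q⁻¹) ^ k • τ (jw q u k) = qInt q (k + 1) • τ 1 := by
  induction k with
  | zero => simp [jw, qInt_one hq]
  | succ k ih =>
    have hpos := (qInt_succ_pos hq k).ne'
    have key : (q + q⁻¹) • τ (jw q u (k + 1)) =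
        (qInt q (k + 2) / qInt q (k + 1)) • τ (jw q u k) := by
      rw [qInt_add_two_div hq, jw_succ, map_sub, map_smul, smul_sub, sub_smul, smul_comm (q + q⁻¹)]
      congr 1
      rcases Nat.eq_zero_or_pos k with rfl | hk0
      · simp [qInt_zero]
      congr 1
      rw [hτ.comm, ← mul_assoc, h.jw_mul_jw hq (by omega) le_rfl]
      exact hτ.markov (k - 1) (by omega) _
        (jw_mem _ k fun i hi => gen_mem_adjoin (by omega))
    rw [pow_succ, mul_smul, key, smul_comm, ih (by omega), smul_smul, div_mul_cancel₀ _ hpos]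

variable [StarModule ℝ A]

/-- The trace that gives the pairing of `D` with the identity diagram. -/
theorem trace_pairing_one (hq : 2 < q + q⁻¹) (h : IsTL (q + q⁻¹) K u)
    (hτ : IsMarkov (q + q⁻¹) K u τ) {a b : ℕ} (hb : a + b < K) :
    (q + q⁻¹) ^ (a + b + 2) •
      τ (jw q u (a + b + 1) * jw q (fun i => u (i + (a + 1))) (b + 1) * star (desc u a b)) =
      ((-1) ^ b * qInt q (a + b + 2) / qInt q (b + 1)) • τ 1 := by
  induction b with
  | zero =>
    have h1 := hτ.markov a hb (jw q u (a + 1)) (jw_mem _ _ fun i hi => gen_mem_adjoin (by omega))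
    have h2 := h.trace_jw hq hτ (k := a + 1) (by omega)
    simp only [jw, mul_one, desc, h.star_eq, qInt_one hq, pow_zero, one_mul, div_one, add_zero]
    rw [pow_succ, mul_smul]
    rw [h1, h2]
  | succ b ih =>
    -- the first term of the recursion for the shifted element vanishes by `hPa`, the second one is
    -- contracted by `hcap` and the Markov property
    set R := jw q (fun i => u (i + (a + 1))) (b + 1) with hR
    have hPR : jw q u (a + (b + 1) + 1) * R = jw q u (a + (b + 1) + 1) :=
      mul_jw _ fun i hi => h.jw_mul_gen hq (by omega) (by omega)
    have hPa : jw q u (a + (b + 1) + 1) * star (desc u a (b + 1)) = 0 := by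
      have h0 : desc u a (b + 1) * jw q u (a + (b + 1) + 1) = 0 := by
        clear ih hPR
        have h1 : ∀ c, c ≤ b → desc u a c * jw q u (a + (b + 1) + 1) = 0 := by
          intro c hc
          induction c with
          | zero => exact h.gen_mul_jw hq (by omega) (by omega)
          | succ c ih => rw [desc, mul_assoc, ih (by omega), mul_zero]
        rw [desc, mul_assoc, h1 b le_rfl, mul_zero]
      have := congrArg star h0
      rwa [star_mul, star_jw h.star_eq, star_zero] at this
    have hmem : R * star (desc u a b) * jw q u (a + b + 1) ∈
        Algebra.adjoin ℝ (u '' Set.Iio (a + b + 1)) := by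
      refine Subalgebra.mul_mem _ (Subalgebra.mul_mem _ ?_ ?_) ?_
      · exact jw_mem _ _ fun i hi => gen_mem_adjoin (by omega)
      · exact star_desc_mem h.star_eq _ _ _ fun i hi => gen_mem_adjoin (by omega)
      · exact jw_mem _ _ fun i hi => gen_mem_adjoin (by omega)
    have hcap := h.cap_jw hq hb
    have e1 : τ (jw q u (a + (b + 1) + 1) * (R * u (a + (b + 1)) * R) *
        star (desc u a (b + 1))) = (qInt q (a + b + 3) / qInt q (a + b + 2)) •
          τ (R * star (desc u a b) * jw q u (a + b + 1) * u (a + b + 1)) := by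
      calc _ = τ ((jw q u (a + (b + 1) + 1) * R) * u (a + (b + 1)) * (R * star (desc u a b)) *
            u (a + (b + 1))) := by
            rw [desc, star_mul, h.star_eq]
            simp only [mul_assoc]
            rfl
        _ = τ ((u (a + (b + 1)) * jw q u (a + (b + 1) + 1) * u (a + (b + 1))) *
            (R * star (desc u a b))) := by
            rw [hPR, hτ.comm]
            simp only [mul_assoc]
        _ = _ := by
            rw [hcap, smul_mul_assoc, map_smul, hτ.comm, ← mul_assoc]
            rfl
    have e2 := hτ.markov _ hb _ hmem
    rw [jw_succ q (fun i => u (i + (a + 1))) (b + 1), ← hR]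
    rw [mul_sub, sub_mul, hPR, hPa, zero_sub, map_neg, mul_smul_comm, smul_mul_assoc, map_smul]
    have e3 : u (b + 1 - 1 + (a + 1)) = u (a + (b + 1)) := by
      congr 1
      omega
    have e4 : τ (R * star (desc u a b) * jw q u (a + b + 1)) =
        τ (jw q u (a + b + 1) * R * star (desc u a b)) := by
      rw [hτ.comm, mul_assoc]
    rw [e3, e1, show a + (b + 1) + 2 = a + b + 2 + 1 by omega, pow_succ, mul_smul, smul_neg,
      smul_comm (q + q⁻¹), smul_comm (q + q⁻¹)]
    erw [e2]
    rw [e4, smul_neg, smul_comm (_ ^ _), smul_comm (_ ^ _), ih (by omega), smul_smul, smul_smul,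
      ← neg_smul]
    congr 1
    have p1 := (qInt_succ_pos hq b).ne'
    have p2 := (qInt_succ_pos hq (b + 1)).ne'
    have p3 := (qInt_succ_pos hq (a + b + 1)).ne'
    rw [show a + b + 2 + 1 = a + b + 3 from rfl, pow_succ]
    field_simp

/-- The product of Jones-Wenzl elements on `a + 1` and on the following `b + 1` strands, between a
word with one turn and its adjoint and below the Jones-Wenzl element on `a + b` strands, which
absorbs all but the terms `t1`, `t2`, `t3` of the expansion by the recursions on both sides
of the turn. -/
theorem jw_conj (hq : 2 < q + q⁻¹) (h : IsTL (q + q⁻¹) K u) {a b : ℕ} (hb : a + b < K) :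
    jw q u (a + b) * desc u a b * (jw q u (a + 1) * jw q (fun i => u (i + (a + 1))) (b + 1)) *
      (star (desc u a b) * jw q u (a + b)) =
    (qInt q (a + b + 2) / (qInt q (a + 1) * qInt q (b + 1))) •
      (jw q u (a + b) * u (a + b)) := by
  set P := jw q u (a + b) with hP
  set p := P * desc u a b with hp
  set Pa := jw q u a with hPa
  set R := jw q (fun i => (fun j => u (j + (a + 1))) (b - 1 - i)) b with hR
  set x := u (a - 1) with hx
  set y := u (a + 1) with hy
  set ca := qInt q a / qInt q (a + 1) with hca
  set cb := qInt q b / qInt q (b + 1) with hcb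
  have hw : IsTL (q + q⁻¹) b (fun i => u (i + (a + 1))) := h.shift (by omega)
  have hPs : star P = P := star_jw h.star_eq _
  have hps : star p = star (desc u a b) * P := by rw [hp, star_mul, hPs]
  have hPas : star Pa = Pa := star_jw h.star_eq _
  have hRs : star R = R := star_jw (fun i => h.star_eq _) _
  have hpPa : p * Pa = p := mul_jw _ fun i hi => by
    rw [hp, mul_assoc, ← (h.commute_desc_of_le hb (by omega)).eq, ← mul_assoc,
      h.jw_mul_gen hq (by omega) (by omega), zero_mul]
  have hpR : p * R = p := mul_jw _ fun i hi => by
    have e := h.desc_mul hb (j := b - 2 - i + a) (by omega) (by omega)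
    rw [show b - 2 - i + a + 2 = b - 1 - i + (a + 1) by omega] at e
    dsimp only
    rw [hp, mul_assoc, e, ← mul_assoc, h.jw_mul_gen hq (by omega) (by omega), zero_mul]
  have hPap : Pa * star p = star p := by
    have := congrArg star hpPa
    rwa [star_mul, hPas] at this
  have hRp : R * star p = star p := by
    have := congrArg star hpR
    rwa [star_mul, hRs] at this
  have hPP : P * P = P := h.jw_mul_jw hq (by omega) le_rfl
  have hPu : u (a + b) * P = P * u (a + b) := h.commute_jw_of_le hb le_rfl
  have hPuP : P * u (a + b) * P = P * u (a + b) := by rw [mul_assoc, hPu, ← mul_assoc, hPP]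
  have sandwich : ∀ z, p * z * star p = P * (desc u a b * z * star (desc u a b)) * P := by
    intro z
    rw [hps, hp]
    simp only [mul_assoc]
  have t1 : p * (Pa * R) * star p = (q + q⁻¹) • (P * u (a + b)) := by
    rw [← mul_assoc, hpPa, hpR, hps, hp, mul_assoc, ← mul_assoc (desc u a b), h.desc_conj_one hb,
      smul_mul_assoc, mul_smul_comm, ← mul_assoc, hPuP]
  have t2 : cb • (p * (Pa * (R * y * R)) * star p) = cb • (P * u (a + b)) := by
    rcases Nat.eq_zero_or_pos b with rfl | hb0
    · simp [hcb, qInt_zero]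
    obtain ⟨c, rfl⟩ := Nat.exists_eq_succ_of_ne_zero hb0.ne'
    congr 1
    calc _ = p * Pa * R * y * (R * star p) := by simp only [mul_assoc]
      _ = p * y * star p := by rw [hpPa, hpR, hRp]
      _ = _ := by rw [sandwich, h.desc_conj_right hb, hPuP]
  have t3 : ca • (p * (Pa * x * Pa * R) * star p) = ca • (P * u (a + b)) := by
    rcases Nat.eq_zero_or_pos a with rfl | ha0
    · simp [hca, qInt_zero]
    obtain ⟨c, rfl⟩ := Nat.exists_eq_succ_of_ne_zero ha0.ne'
    congr 1
    calc _ = p * Pa * x * (Pa * (R * star p)) := by simp only [mul_assoc]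
      _ = p * x * star p := by rw [hpPa, hRp, hPap]
      _ = _ := by rw [sandwich, hx, Nat.succ_sub_one, h.desc_conj_left hb, hPuP]
  have t4 : (ca * cb) • (p * (Pa * x * Pa * (R * y * R)) * star p) = 0 := by
    rcases Nat.eq_zero_or_pos b with rfl | hb0
    · simp [hcb, qInt_zero]
    rcases Nat.eq_zero_or_pos a with rfl | ha0
    · simp [hca, qInt_zero]
    obtain ⟨c, rfl⟩ := Nat.exists_eq_succ_of_ne_zero hb0.ne'
    obtain ⟨d, rfl⟩ := Nat.exists_eq_succ_of_ne_zero ha0.ne'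
    have hxR : x * R = R * x :=
      commute_jw _ fun i hi => h.comm _ _ (by omega) (by omega)
    have hyPa : y * Pa = Pa * y := h.commute_jw_of_le (by omega) (by omega)
    have hRPa : Pa * R = R * Pa :=
      commute_jw _ fun i hi => (h.commute_jw_of_le (by omega) (by omega)).symm
    -- conjugation by the word leaves `u (a - 1)` in place, where the projection `P` kills it
    have hz : p * (x * y) * star p = 0 := by
      rw [sandwich]
      erw [h.desc_conj_both hb]
      rw [← mul_assoc, h.jw_mul_gen hq (by omega) (by omega), zero_mul, zero_mul]
    rw [show p * (Pa * x * Pa * (R * y * R)) * star p = 0 from ?_, smul_zero]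
    calc _ = p * Pa * x * (Pa * R) * (y * (R * star p)) := by simp only [mul_assoc]
      _ = p * (x * R) * (Pa * y) * star p := by
          rw [hpPa, hRp, hRPa]
          simp only [mul_assoc]
      _ = p * R * x * y * (Pa * star p) := by
          rw [hxR, ← hyPa]
          simp only [mul_assoc]
      _ = 0 := by rw [hpR, hPap, mul_assoc p, hz]
  have hQ : jw q (fun i => u (i + (a + 1))) (b + 1) = R - cb • (R * y * R) := by
    rw [hw.jw_succ_left hq, zero_add]
  rw [← hps, hQ, jw_succ, ← hPa, ← hx, ← hca]
  have p1 := (qInt_succ_pos hq a).ne'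
  have p2 := (qInt_succ_pos hq b).ne'
  have hcoef : qInt q (a + b + 2) / (qInt q (a + 1) * qInt q (b + 1)) = (q + q⁻¹) - cb - ca := by
    rw [qInt_add_add_two hq, qInt_add_two hq a, hca, hcb]
    field_simp
    ring
  rw [hcoef, sub_smul, sub_smul, ← t1, ← t2, ← t3]
  have expand : p * ((Pa - ca • (Pa * x * Pa)) * (R - cb • (R * y * R))) * star p =
      p * (Pa * R) * star p - cb • (p * (Pa * (R * y * R)) * star p) -
        ca • (p * (Pa * x * Pa * R) * star p) +
        (ca * cb) • (p * (Pa * x * Pa * (R * y * R)) * star p) := by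
    simp only [sub_mul, mul_sub, smul_mul_assoc, mul_smul_comm, smul_sub, smul_smul,
      mul_comm cb ca]
    abel
  rw [expand, t4, add_zero]

/-- The trace that gives the pairing of `D` with the two-cup diagram. -/
theorem trace_pairing_twoCup (hq : 2 < q + q⁻¹) (h : IsTL (q + q⁻¹) K u)
    (hτ : IsMarkov (q + q⁻¹) K u τ) {a b : ℕ} (hb : a + b < K) :
    (q + q⁻¹) ^ (a + b + 2) •
      τ (jw q u (a + 1) * jw q (fun i => u (i + (a + 1))) (b + 1) * star (desc u a b) *
        jw q u (a + b + 1) * desc u a b) =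
      (qInt q (a + b + 2) ^ 2 / (qInt q (a + 1) * qInt q (b + 1))) • τ 1 := by
  set X := jw q u (a + 1) * jw q (fun i => u (i + (a + 1))) (b + 1) with hX
  set P := jw q u (a + b) with hP
  set d := desc u a b with hd
  obtain ⟨z, hz⟩ := desc_eq_mul u a b
  have hds : star d = star z * u (a + b) := by rw [hd, hz, star_mul, h.star_eq]
  have hPP : P * P = P := h.jw_mul_jw hq (by omega) le_rfl
  have hPu : u (a + b) * P = P * u (a + b) := h.commute_jw_of_le hb le_rfl
  have turn : (q + q⁻¹) • (star d * jw q u (a + b + 1) * d) =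
      (qInt q (a + b + 2) / qInt q (a + b + 1)) • (star d * P * (P * d)) := by
    have e : star d * jw q u (a + b + 1) * d =
        star z * (u (a + b) * jw q u (a + b + 1) * u (a + b)) * z := by
      rw [hds, hd, hz]
      simp only [mul_assoc]
    have e' : star d * P * (P * d) = (q + q⁻¹) • (star z * (P * u (a + b)) * z) := by
      calc _ = star z * (u (a + b) * (P * P) * u (a + b)) * z := by
            rw [hds, hd, hz]
            simp only [mul_assoc]
        _ = star z * (P * (u (a + b) * u (a + b))) * z := by rw [hPP, hPu, mul_assoc P]
        _ = _ := by rw [h.sq _ hb, mul_smul_comm, mul_smul_comm, smul_mul_assoc]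
    rw [e, e', h.cap_jw hq hb, mul_smul_comm, smul_mul_assoc, smul_comm]
  have key : (q + q⁻¹) • τ (X * star d * jw q u (a + b + 1) * d) =
      (qInt q (a + b + 2) / qInt q (a + b + 1)) •
        (qInt q (a + b + 2) / (qInt q (a + 1) * qInt q (b + 1))) • τ (P * u (a + b)) := by
    have hX' : τ (X * (star d * P * (P * d))) = τ (P * d * X * (star d * P)) := by
      rw [← mul_assoc, hτ.comm]
      simp only [mul_assoc]
    calc _ = τ (X * ((q + q⁻¹) • (star d * jw q u (a + b + 1) * d))) := by
          rw [mul_smul_comm, map_smul]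
          simp only [mul_assoc]
      _ = (qInt q (a + b + 2) / qInt q (a + b + 1)) • τ (P * d * X * (star d * P)) := by
          rw [turn, mul_smul_comm, map_smul, hX']
      _ = _ := by rw [hP, hd, hX, h.jw_conj hq hb, map_smul]
  have hm := hτ.markov _ hb P (jw_mem _ _ fun i hi => gen_mem_adjoin (by omega))
  have ht := h.trace_jw hq hτ (k := a + b) (by omega)
  have p1 := (qInt_succ_pos hq (a + b)).ne'
  rw [pow_succ, mul_smul, key, pow_succ, mul_smul, smul_comm (q + q⁻¹), smul_comm (q + q⁻¹), hm,
    smul_comm (_ ^ _), smul_comm (_ ^ _), ht, smul_smul, smul_smul]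
  congr 1
  field_simp

end IsTL

end Markov

/-! ### Juxtaposition of diagrams -/

section Tensor

variable {k l m : ℕ} (h : k + l = m) {δ : ℝ}

theorem left_or_right (p : Point m) : (∃ p', left h p' = p) ∨ (∃ p', right h p' = p) := by
  subst h
  have key : ∀ i : Fin (k + l), (∃ j, Fin.castAdd l j = i) ∨ (∃ j, Fin.natAdd k j = i) := by
    intro i
    induction i using Fin.addCases with
    | left j => exact Or.inl ⟨j, rfl⟩
    | right j => exact Or.inr ⟨j, rfl⟩
  rcases p with i | i <;> rcases key i with ⟨j, rfl⟩ | ⟨j, rfl⟩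
  exacts [Or.inl ⟨Sum.inl j, rfl⟩, Or.inr ⟨Sum.inl j, rfl⟩, Or.inl ⟨Sum.inr j, rfl⟩,
    Or.inr ⟨Sum.inr j, rfl⟩]

theorem pos_left_lt_left (p r : Point k) : pos (left h p) < pos (left h r) ↔ pos p < pos r := by
  subst h
  rcases p with ⟨i, hi⟩ | ⟨i, hi⟩ <;> rcases r with ⟨j, hj⟩ | ⟨j, hj⟩ <;>
    simp [left, pos] <;> omega

theorem pos_right_lt_right (p r : Point l) : pos (right h p) < pos (right h r) ↔ pos p < pos r := by
  subst h
  rcases p with ⟨i, hi⟩ | ⟨i, hi⟩ <;> rcases r with ⟨j, hj⟩ | ⟨j, hj⟩ <;>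
    simp [right, pos] <;> omega

theorem pos_left_lt_right (p : Point k) (r : Point l) :
    pos (left h p) < pos (right h r) ↔ p.isLeft := by
  subst h
  rcases p with ⟨i, hi⟩ | ⟨i, hi⟩ <;> rcases r with ⟨j, hj⟩ | ⟨j, hj⟩ <;>
    simp [left, right, pos] <;> omega

theorem pos_right_lt_left (p : Point k) (r : Point l) :
    pos (right h r) < pos (left h p) ↔ ¬ p.isLeft := by
  subst h
  rcases p with ⟨i, hi⟩ | ⟨i, hi⟩ <;> rcases r with ⟨j, hj⟩ | ⟨j, hj⟩ <;>
    simp [left, right, pos] <;> omega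

theorem sumElim_left_right_bijective :
    Function.Bijective (Sum.elim (left h) (right h) : Point k ⊕ Point l → Point m) := by
  subst h
  constructor
  · rintro ((⟨i, hi⟩ | ⟨i, hi⟩) | (⟨i, hi⟩ | ⟨i, hi⟩))
      ((⟨j, hj⟩ | ⟨j, hj⟩) | (⟨j, hj⟩ | ⟨j, hj⟩)) <;>
      simp [left, right] <;> omega
  · intro p
    rcases left_or_right rfl p with ⟨p', hp⟩ | ⟨p', hp⟩
    exacts [⟨Sum.inl p', hp⟩, ⟨Sum.inr p', hp⟩]

/-- The points of two juxtaposed rectangles are the points of the left one and those of the right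
one. -/
def pointEquiv : Point k ⊕ Point l ≃ Point m := Equiv.ofBijective _ (sumElim_left_right_bijective h)

/-- The juxtaposition of two diagrams. -/
def Diagram.tensor (X : Diagram k) (Y : Diagram l) : Diagram m where
  pair p := pointEquiv h (Sum.map X.pair Y.pair ((pointEquiv h).symm p))
  pair_pair p := by
    obtain ⟨r | r, rfl⟩ := (pointEquiv h).surjective p <;> simp [X.pair_pair, Y.pair_pair]
  pair_ne p := by
    obtain ⟨r | r, rfl⟩ := (pointEquiv h).surjective p <;> simp [X.pair_ne, Y.pair_ne]
  noncrossing p r := by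
    have e1 : ∀ p, pointEquiv h (Sum.inl p) = left h p := fun _ => rfl
    have e2 : ∀ p, pointEquiv h (Sum.inr p) = right h p := fun _ => rfl
    obtain ⟨p | p, rfl⟩ := (pointEquiv h).surjective p <;>
      obtain ⟨r | r, rfl⟩ := (pointEquiv h).surjective r <;>
      simp only [Equiv.symm_apply_apply, Sum.map_inl, Sum.map_inr] <;>
      simp only [e1, e2, pos_left_lt_left, pos_right_lt_right, pos_left_lt_right,
        pos_right_lt_left]
    · exact X.noncrossing p r
    · tauto
    · tauto
    · exact Y.noncrossing p r

theorem Diagram.tensor_left (X : Diagram k) (Y : Diagram l) (p : Point k) :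
    (X.tensor h Y).pair (left h p) = left h (X.pair p) := by
  change pointEquiv h (Sum.map X.pair Y.pair ((pointEquiv h).symm (pointEquiv h (Sum.inl p)))) = _
  rw [Equiv.symm_apply_apply]
  rfl

theorem Diagram.tensor_right (X : Diagram k) (Y : Diagram l) (p : Point l) :
    (X.tensor h Y).pair (right h p) = right h (Y.pair p) := by
  change pointEquiv h (Sum.map X.pair Y.pair ((pointEquiv h).symm (pointEquiv h (Sum.inr p)))) = _
  rw [Equiv.symm_apply_apply]
  rfl

theorem isTensor_iff {X : Diagram k} {Y : Diagram l} {Z : Diagram m} :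
    IsTensor h X Y Z ↔ Z = X.tensor h Y := by
  constructor
  · rintro ⟨h1, h2⟩
    ext1
    funext p
    rcases left_or_right h p with ⟨p, rfl⟩ | ⟨p, rfl⟩
    · rw [h1, Diagram.tensor_left]
    · rw [h2, Diagram.tensor_right]
  · rintro rfl
    exact ⟨X.tensor_left h Y, X.tensor_right h Y⟩

/-- Colourings of the edge of two juxtaposed rectangles. -/
def edgeEquiv : (Fin m → Bool) ≃ (Fin k → Bool) × (Fin l → Bool) where
  toFun s := (fun i => s (Fin.cast h (Fin.castAdd l i)), fun i => s (Fin.cast h (Fin.natAdd k i)))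
  invFun f := fun j => Fin.append f.1 f.2 (Fin.cast h.symm j)
  left_inv s := by
    subst h
    exact (Fin.appendEquiv k l).right_inv s
  right_inv f := by
    subst h
    exact (Fin.appendEquiv k l).left_inv f

theorem mat_tensor (X : Diagram k) (Y : Diagram l) : mat (X.tensor h Y) =
    (Matrix.kroneckerMap (· * ·) (mat X) (mat Y)).submatrix (edgeEquiv h) (edgeEquiv h) := by
  ext s t
  rw [Matrix.submatrix_apply, Matrix.kroneckerMap_apply, mat, mat, mat,
    ite_zero_mul_ite_zero, mul_one]
  congr 1
  have e1 : ∀ p, Sum.elim (edgeEquiv h s).1 (edgeEquiv h t).1 p = Sum.elim s t (left h p) := by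
    rintro (i | i) <;> rfl
  have e2 : ∀ p, Sum.elim (edgeEquiv h s).2 (edgeEquiv h t).2 p = Sum.elim s t (right h p) := by
    rintro (i | i) <;> rfl
  rw [eq_iff_iff]
  constructor
  · intro hr
    refine ⟨fun p => ?_, fun p => ?_⟩
    · rw [e1, e1, ← X.tensor_left h Y]; exact hr _
    · rw [e2, e2, ← X.tensor_right h Y]; exact hr _
  · rintro ⟨h1, h2⟩ p
    rcases left_or_right h p with ⟨p, rfl⟩ | ⟨p, rfl⟩
    · rw [Diagram.tensor_left, ← e1, ← e1]; exact h1 p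
    · rw [Diagram.tensor_right, ← e2, ← e2]; exact h2 p

theorem mat_tensor_mul (X X' : Diagram k) (Y Y' : Diagram l) :
    mat (X.tensor h Y) * mat (X'.tensor h Y') =
      (Matrix.kroneckerMap (· * ·) (mat X * mat X') (mat Y * mat Y')).submatrix (edgeEquiv h)
        (edgeEquiv h) := by
  rw [mat_tensor, mat_tensor, Matrix.submatrix_mul_equiv, Matrix.mul_kronecker_mul]

theorem trace_mat_tensor_mul (X X' : Diagram k) (Y Y' : Diagram l) :
    (mat (X.tensor h Y) * mat (X'.tensor h Y')).trace =
      (mat X * mat X').trace * (mat Y * mat Y').trace := by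
  rw [mat_tensor_mul, ← Matrix.trace_kronecker]
  exact Equiv.sum_comp (edgeEquiv h) fun x =>
    Matrix.kroneckerMap (· * ·) (mat X * mat X') (mat Y * mat Y') x x

theorem tensor_eq_sum (x : TL k) (y : TL l) : tensor h x y =
    ∑ X, ∑ Y, (x X * y Y) • ofDiagram (X.tensor h Y) := by
  funext Z
  simp only [tensor, isTensor_iff, Finset.sum_apply, Pi.smul_apply, ofDiagram, Pi.single_apply,
    smul_eq_mul, mul_ite, mul_one, mul_zero]

theorem tensor_ofDiagram (X : Diagram k) (Y : Diagram l) :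
    tensor h (ofDiagram X) (ofDiagram Y) = ofDiagram (X.tensor h Y) := by
  rw [tensor_eq_sum, Finset.sum_eq_single X, Finset.sum_eq_single Y]
  · simp [ofDiagram]
  · intro Y' _ h; simp [ofDiagram, h]
  · simp
  · intro X' _ h; simp [ofDiagram, h]
  · simp

theorem tensor_add_left (x x' : TL k) (y : TL l) :
    tensor h (x + x') y = tensor h x y + tensor h x' y := by
  funext Z
  simp only [tensor, Pi.add_apply, ← Finset.sum_add_distrib]
  refine Finset.sum_congr rfl fun X _ => Finset.sum_congr rfl fun Y _ => ?_
  split_ifs <;> ring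

theorem tensor_smul_left (c : ℂ) (x : TL k) (y : TL l) :
    tensor h (c • x) y = c • tensor h x y := by
  funext Z
  simp only [tensor, Pi.smul_apply, smul_eq_mul, Finset.mul_sum]
  refine Finset.sum_congr rfl fun X _ => Finset.sum_congr rfl fun Y _ => ?_
  split_ifs <;> ring

theorem tensor_add_right (x : TL k) (y y' : TL l) :
    tensor h x (y + y') = tensor h x y + tensor h x y' := by
  funext Z
  simp only [tensor, Pi.add_apply, ← Finset.sum_add_distrib]
  refine Finset.sum_congr rfl fun X _ => Finset.sum_congr rfl fun Y _ => ?_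
  split_ifs <;> ring

theorem tensor_smul_right (c : ℂ) (x : TL k) (y : TL l) :
    tensor h x (c • y) = c • tensor h x y := by
  funext Z
  simp only [tensor, Pi.smul_apply, smul_eq_mul, Finset.mul_sum]
  refine Finset.sum_congr rfl fun X _ => Finset.sum_congr rfl fun Y _ => ?_
  split_ifs <;> ring

/-- Juxtaposition as a bilinear map. -/
def tensorHom (δ : ℝ) : Alg δ k →ₗ[ℂ] Alg δ l →ₗ[ℂ] Alg δ m :=
  LinearMap.mk₂ ℂ (fun x y => (tensor h x y : TL m)) (tensor_add_left h) (tensor_smul_left h)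
    (tensor_add_right h) (tensor_smul_right h)

theorem tensorHom_of (X : Diagram k) (Y : Diagram l) :
    tensorHom h δ (Alg.of δ X) (Alg.of δ Y) = Alg.of δ (X.tensor h Y) := tensor_ofDiagram h X Y

theorem tensorHom_mul (x x' : Alg δ k) (y y' : Alg δ l) :
    tensorHom h δ (x * x') (y * y') = tensorHom h δ x y * tensorHom h δ x' y' := by
  induction x using Alg.induction with
  | add x z hx hz => simp only [add_mul, map_add, LinearMap.add_apply, hx, hz]
  | smul c x hx => simp only [smul_mul_assoc, map_smul, LinearMap.smul_apply, hx]
  | of X =>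
  induction x' using Alg.induction with
  | add x z hx hz => simp only [mul_add, map_add, LinearMap.add_apply, hx, hz]
  | smul c x hx => simp only [mul_smul_comm, map_smul, LinearMap.smul_apply, hx]
  | of X' =>
  induction y using Alg.induction with
  | add x z hx hz => simp only [add_mul, map_add, hx, hz]
  | smul c x hx => simp only [smul_mul_assoc, map_smul, hx]
  | of Y =>
  induction y' using Alg.induction with
  | add x z hx hz => simp only [mul_add, map_add, hx, hz]
  | smul c x hx => simp only [mul_smul_comm, map_smul, hx]
  | of Y' =>
  rw [Alg.of_mul_of, Alg.of_mul_of, map_smul, map_smul, LinearMap.smul_apply, tensorHom_of,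
    tensorHom_of, tensorHom_of, smul_smul, ← pow_add]
  refine (Alg.of_mul_of_eq ?_).symm
  rw [mat_tensor_mul, mat_mul_mat, mat_mul_mat, mat_tensor, Matrix.smul_kronecker,
    Matrix.kronecker_smul, smul_smul, pow_add, mul_comm]
  rfl

theorem Diagram.one_tensor_one : (Diagram.one k).tensor h (Diagram.one l) = Diagram.one m := by
  refine ((isTensor_iff h).1 ⟨?_, ?_⟩).symm <;> rintro (i | i) <;> rfl

theorem tensorHom_one : tensorHom h δ 1 1 = 1 := by
  rw [Alg.one_def, Alg.one_def, tensorHom_of, Diagram.one_tensor_one]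
  rfl

/-- The algebra homomorphism that draws `l` vertical strands to the right. -/
def tensorLeft (δ : ℝ) : Alg δ k →ₐ[ℝ] Alg δ m :=
  AlgHom.ofLinearMap (((tensorHom h δ).flip 1).restrictScalars ℝ) (tensorHom_one h)
    fun x y => by
      have := tensorHom_mul h x y (1 : Alg δ l) 1
      rwa [mul_one] at this

/-- The algebra homomorphism that draws `k` vertical strands to the left. -/
def tensorRight (δ : ℝ) : Alg δ l →ₐ[ℝ] Alg δ m :=
  AlgHom.ofLinearMap ((tensorHom h δ 1).restrictScalars ℝ) (tensorHom_one h)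
    fun x y => by
      have := tensorHom_mul h (1 : Alg δ k) 1 x y
      rwa [mul_one] at this

theorem tensorLeft_apply (x : Alg δ k) : tensorLeft h δ x = tensorHom h δ x 1 := rfl

theorem tensorRight_apply (x : Alg δ l) : tensorRight h δ x = tensorHom h δ 1 x := rfl

theorem tensorHom_eq_mul (x : Alg δ k) (y : Alg δ l) :
    tensorHom h δ x y = tensorLeft h δ x * tensorRight h δ y := by
  rw [tensorLeft_apply, tensorRight_apply, ← tensorHom_mul, mul_one, one_mul]

end Tensor

/-! ### The generators -/

section Generators

variable {k : ℕ} {δ : ℝ}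

/-- The end points of the strings of `Diagram.hook`. -/
def hookPair (i : ℕ) (h : i + 1 < k) : Point k → Point k
  | Sum.inl j => if j.val = i then Sum.inl ⟨i + 1, h⟩
    else if j.val = i + 1 then Sum.inl ⟨i, by omega⟩ else Sum.inr j
  | Sum.inr j => if j.val = i then Sum.inr ⟨i + 1, h⟩
    else if j.val = i + 1 then Sum.inr ⟨i, by omega⟩ else Sum.inl j

/-- The generator with a cup at the top points `i` and `i + 1`, a cap at the bottom points `i` and
`i + 1`, and vertical strands elsewhere. -/
def Diagram.hook (i : ℕ) (h : i + 1 < k) : Diagram k where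
  pair := hookPair i h
  pair_pair := by
    rintro (⟨j, hj⟩ | ⟨j, hj⟩) <;> rw [hookPair] <;> split_ifs <;>
      rw [hookPair] <;> split_ifs <;> first | omega | simp_all
  pair_ne := by
    rintro (⟨j, hj⟩ | ⟨j, hj⟩) <;> simp only [hookPair] <;> split_ifs <;>
      simp only [ne_eq, Sum.inl.injEq, Sum.inr.injEq, Fin.mk.injEq, reduceCtorEq,
        not_false_eq_true] <;> omega
  noncrossing := by
    rintro (⟨i, hi⟩ | ⟨i, hi⟩) (⟨j, hj⟩ | ⟨j, hj⟩) <;> simp only [hookPair] <;> split_ifs <;>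
      simp only [pos] <;> omega

/-- The generators of the Temperley-Lieb algebra, continued by `0`. -/
def gen (δ : ℝ) (k i : ℕ) : Alg δ k :=
  if h : i + 1 < k then Alg.of δ (Diagram.hook i h) else 0

theorem gen_of_lt {i : ℕ} (h : i + 1 < k) : gen δ k i = Alg.of δ (Diagram.hook i h) := dif_pos h

/-- A colouring of an edge with new colour `b` at the points `i` and `i + 1`. -/
def recolour (i : ℕ) (b : Bool) (s : Fin k → Bool) (j : Fin k) : Bool :=
  if j.val = i ∨ j.val = i + 1 then b else s j

theorem mat_hook_apply {i : ℕ} (h : i + 1 < k) (s r : Fin k → Bool) :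
    mat (Diagram.hook i h) s r =
      if s ⟨i, by omega⟩ = s ⟨i + 1, h⟩ ∧ r = recolour i (r ⟨i, by omega⟩) s then 1 else 0 := by
  rw [mat]
  congr 1
  rw [eq_iff_iff]
  constructor
  · intro hr
    have h1 := hr (Sum.inl ⟨i, by omega⟩)
    have h2 := hr (Sum.inr ⟨i, by omega⟩)
    simp only [Diagram.hook, hookPair, if_true, Sum.elim_inl, Sum.elim_inr] at h1 h2
    refine ⟨h1.symm, funext fun j => ?_⟩
    rw [recolour]
    split_ifs with hj
    · rcases hj with hj | hj
      · congr 1; exact Fin.ext hj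
      · rw [← h2]; congr 1; exact Fin.ext hj
    · rw [not_or] at hj
      have h3 := hr (Sum.inl j)
      simpa only [Diagram.hook, hookPair, hj.1, hj.2, if_false, Sum.elim_inl, Sum.elim_inr] using h3
  · rintro ⟨h1, h2⟩
    have h3 : ∀ j : Fin k, r j = recolour i (r ⟨i, by omega⟩) s j := fun j => congrFun h2 j
    rintro (j | j) <;> simp only [Diagram.hook, hookPair] <;> split_ifs with hj hj' <;>
      simp only [Sum.elim_inl, Sum.elim_inr]
    · rw [← h1]; congr 1; exact Fin.ext hj.symm
    · rw [h1]; congr 1; exact Fin.ext hj'.symm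
    · rw [h3 j, recolour, if_neg (by tauto)]
    · rw [h3 ⟨i + 1, h⟩, h3 j, recolour, recolour, if_pos (by simp), if_pos (by tauto)]
    · rw [h3 j, recolour, if_pos (by tauto)]
    · rw [h3 j, recolour, if_neg (by tauto)]

theorem mat_hook_mul_apply {i : ℕ} (h : i + 1 < k) (M : Matrix (Fin k → Bool) (Fin k → Bool) ℕ)
    (s t : Fin k → Bool) : (mat (Diagram.hook i h) * M) s t =
      if s ⟨i, by omega⟩ = s ⟨i + 1, h⟩ then ∑ b, M (recolour i b s) t else 0 := by
  rw [Matrix.mul_apply]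
  simp only [mat_hook_apply, ite_and, ite_mul, one_mul, zero_mul]
  split_ifs with hs
  · have e : ∀ r : Fin k → Bool, (if r = recolour i (r ⟨i, by omega⟩) s then M r t else 0) =
        ∑ b, if r = recolour i b s then M r t else 0 := by
      intro r
      rw [Finset.sum_eq_single (r ⟨i, by omega⟩)]
      · intro b _ hb
        refine if_neg fun hr => hb ?_
        rw [hr, recolour, if_pos (Or.inl rfl)]
      · simp
    simp only [e]
    rw [Finset.sum_comm]
    simp
  · simp

/-- Stacking a generator on a diagram that starts with the same cup closes one loop. -/
theorem mat_hook_mul_of_arc {i : ℕ} (h : i + 1 < k) {Y : Diagram k}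
    (hY : Y.pair (Sum.inl ⟨i, by omega⟩) = Sum.inl ⟨i + 1, h⟩) :
    mat (Diagram.hook i h) * mat Y = 2 ^ 1 • mat Y := by
  have hY' : Y.pair (Sum.inl ⟨i + 1, h⟩) = Sum.inl ⟨i, by omega⟩ := by rw [← hY, Y.pair_pair]
  ext s t
  rw [mat_hook_mul_apply]
  split_ifs with hs
  · have e : ∀ b, mat Y (recolour i b s) t = mat Y s t := by
      intro b
      rw [mat, mat]
      congr 1
      have o : ∀ p : Point k, p ≠ Sum.inl ⟨i, by omega⟩ → p ≠ Sum.inl ⟨i + 1, h⟩ →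
          Sum.elim (recolour i b s) t p = Sum.elim s t p := by
        rintro (j | j) h1 h2
        · simp only [ne_eq, Sum.inl.injEq, Fin.ext_iff] at h1 h2
          simp [recolour, h1, h2]
        · rfl
      rw [eq_iff_iff]
      refine forall_congr' fun p => ?_
      by_cases h1 : p = Sum.inl ⟨i, by omega⟩
      · subst h1
        simp [hY, recolour, hs]
      by_cases h2 : p = Sum.inl ⟨i + 1, h⟩
      · subst h2
        simp [hY', recolour, hs]
      rw [o p h1 h2, o (Y.pair p)]
      · intro h3; exact h2 (by rw [← hY, ← h3, Y.pair_pair])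
      · intro h3; exact h1 (by rw [← hY', ← h3, Y.pair_pair])
    simp [e, two_mul]
  · have e : mat Y s t = 0 := by
      refine if_neg fun hr => hs ?_
      have := hr (Sum.inl ⟨i, by omega⟩)
      rw [hY] at this
      exact this.symm
    simp [e]

/-- Stacking a generator on a diagram joins the two strings that end at the top points `i` and
`i + 1`. -/
theorem mat_hook_mul_of_join {i : ℕ} (h : i + 1 < k) {Y Z : Diagram k}
    (hne : Y.pair (Sum.inl ⟨i, by omega⟩) ≠ Sum.inl ⟨i + 1, h⟩)
    (h1 : Z.pair (Sum.inl ⟨i, by omega⟩) = Sum.inl ⟨i + 1, h⟩)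
    (h2 : Z.pair (Y.pair (Sum.inl ⟨i, by omega⟩)) = Y.pair (Sum.inl ⟨i + 1, h⟩))
    (h3 : ∀ p, p ≠ Sum.inl ⟨i, by omega⟩ → p ≠ Sum.inl ⟨i + 1, h⟩ →
      p ≠ Y.pair (Sum.inl ⟨i, by omega⟩) → p ≠ Y.pair (Sum.inl ⟨i + 1, h⟩) →
      Z.pair p = Y.pair p) :
    mat (Diagram.hook i h) * mat Y = mat Z := by
  set p0 : Point k := Sum.inl ⟨i, by omega⟩ with hp0
  set p1 : Point k := Sum.inl ⟨i + 1, h⟩ with hp1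
  have h01 : p0 ≠ p1 := by simp [hp0, hp1]
  have ne0 : Y.pair p0 ≠ p0 := Y.pair_ne p0
  have ne1 : Y.pair p1 ≠ p1 := Y.pair_ne p1
  have ne2 : Y.pair p1 ≠ p0 := fun e => hne (by rw [← e, Y.pair_pair])
  have h1' : Z.pair p1 = p0 := by rw [← h1, Z.pair_pair]
  have h2' : Z.pair (Y.pair p1) = Y.pair p0 := by rw [← h2, Z.pair_pair]
  ext s t
  rw [mat_hook_mul_apply]
  have hs0 : s ⟨i, by omega⟩ = Sum.elim s t p0 := rfl
  have hs1 : s ⟨i + 1, h⟩ = Sum.elim s t p1 := rfl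
  rw [hs0, hs1]
  split_ifs with hs
  · have o : ∀ b (p : Point k), p ≠ p0 → p ≠ p1 →
        Sum.elim (recolour i b s) t p = Sum.elim s t p := by
      rintro b (j | j) h1 h2
      · simp only [hp0, hp1, ne_eq, Sum.inl.injEq, Fin.ext_iff] at h1 h2
        simp [recolour, h1, h2]
      · rfl
    have o0 : ∀ b, Sum.elim (recolour i b s) t p0 = b := by intro b; simp [hp0, recolour]
    have o1 : ∀ b, Sum.elim (recolour i b s) t p1 = b := by intro b; simp [hp1, recolour]
    have key : ∀ b, Y.Respects (Sum.elim (recolour i b s) t) ↔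
        b = Sum.elim s t (Y.pair p0) ∧ Z.Respects (Sum.elim s t) := by
      intro b
      constructor
      · intro hr
        have r0 := hr p0
        have r1 := hr p1
        rw [o0, o b _ ne0 hne] at r0
        rw [o1, o b _ ne2 ne1] at r1
        refine ⟨r0.symm, fun p => ?_⟩
        by_cases a0 : p = p0
        · rw [a0, h1, hs]
        by_cases a1 : p = p1
        · rw [a1, h1', hs]
        by_cases a2 : p = Y.pair p0
        · rw [a2, h2, r0, r1]
        by_cases a3 : p = Y.pair p1
        · rw [a3, h2', r0, r1]
        have r := hr p
        rw [o b _ a0 a1, o b] at r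
        · rw [h3 p a0 a1 a2 a3, r]
        · intro e; exact a2 (by rw [← e, Y.pair_pair])
        · intro e; exact a3 (by rw [← e, Y.pair_pair])
      · rintro ⟨rfl, hr⟩ p
        have r01 : Sum.elim s t (Y.pair p1) = Sum.elim s t (Y.pair p0) := by rw [← h2]; exact hr _
        by_cases a0 : p = p0
        · rw [a0, o0, o _ _ ne0 hne]
        by_cases a1 : p = p1
        · rw [a1, o1, o _ _ ne2 ne1, r01]
        by_cases a2 : p = Y.pair p0
        · rw [a2, Y.pair_pair, o0, o _ _ ne0 hne]
        by_cases a3 : p = Y.pair p1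
        · rw [a3, Y.pair_pair, o1, o _ _ ne2 ne1, r01]
        rw [o _ _ a0 a1, o]
        · rw [← h3 p a0 a1 a2 a3]; exact hr p
        · intro e; exact a2 (by rw [← e, Y.pair_pair])
        · intro e; exact a3 (by rw [← e, Y.pair_pair])
    simp only [mat, key, ite_and, Finset.sum_ite_eq', Finset.mem_univ, if_true]
  · exact (if_neg fun hr => hs (by rw [← hr p0, h1])).symm

theorem Alg.of_congr {X Y X' Y' : Diagram k} (h : mat X * mat Y = mat X' * mat Y') :
    Alg.of δ X * Alg.of δ Y = Alg.of δ X' * Alg.of δ Y' := by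
  rw [mat_mul_mat X' Y'] at h
  rw [Alg.of_mul_of_eq h, Alg.of_mul_of]

theorem Alg.of_mul_of_mul_of_eq {X Y W Z : Diagram k} (h : mat X * mat Y * mat W = mat Z) :
    Alg.of δ X * Alg.of δ Y * Alg.of δ W = Alg.of δ Z := by
  rw [mat_mul_mat X Y, Matrix.smul_mul, mat_mul_mat, smul_smul, ← pow_add] at h
  obtain ⟨h1, h2⟩ := eq_of_smul_mat_eq (Y := Z) (f := 0) (h.trans (by simp))
  rw [Alg.of_mul_of X Y, smul_mul_assoc, Alg.of_mul_of, smul_smul, ← pow_add, h1, h2, pow_zero,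
    one_smul]

/-- The relation `u_i u_j u_i = u_i` for neighbours `i`, `j`. -/
theorem mat_hook_braid {i j : ℕ} (hi : i + 1 < k) (hj : j + 1 < k) (hij : i + 1 = j ∨ j + 1 = i) :
    mat (Diagram.hook i hi) * mat (Diagram.hook j hj) * mat (Diagram.hook i hi) =
      mat (Diagram.hook i hi) := by
  rw [Matrix.mul_assoc]
  nth_rw 2 [← Matrix.mul_one (mat (Diagram.hook i hi))]
  nth_rw 3 [← Matrix.mul_one (mat (Diagram.hook i hi))]
  ext s t
  simp only [mat_hook_mul_apply]
  split_ifs with hs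
  · rcases hij with rfl | rfl
    · have f1 : ∀ b, recolour i b s ⟨i + 1, hi⟩ = b := fun b => if_pos (Or.inr rfl)
      have f2 : ∀ b, recolour i b s ⟨i + 1 + 1, hj⟩ = s ⟨i + 1 + 1, hj⟩ := fun b =>
        if_neg (by dsimp only; omega)
      have f3 : ∀ b c, recolour (i + 1) c (recolour i b s) ⟨i, by omega⟩ = b := fun b c =>
        (if_neg (by dsimp only; omega)).trans (if_pos (Or.inl rfl))
      have f4 : ∀ b c, recolour (i + 1) c (recolour i b s) ⟨i + 1, hi⟩ = c := fun b c =>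
        if_pos (Or.inl rfl)
      have f5 : ∀ b d, recolour i d (recolour (i + 1) (s ⟨i + 1 + 1, hj⟩) (recolour i b s)) =
          recolour i d s := by
        intro b d
        funext x
        simp only [recolour]
        split_ifs with g1 g2
        · rfl
        · congr 1
          exact Fin.ext (by dsimp only; omega)
        · rfl
      simp [f1, f2, f3, f4, f5, Matrix.one_apply]
    · have f1 : ∀ b, recolour (j + 1) b s ⟨j + 1, hj⟩ = b := fun b => if_pos (Or.inl rfl)
      have f2 : ∀ b, recolour (j + 1) b s ⟨j, by omega⟩ = s ⟨j, by omega⟩ := fun b =>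
        if_neg (by dsimp only; omega)
      have f3 : ∀ b c, recolour j c (recolour (j + 1) b s) ⟨j + 1 + 1, hi⟩ = b := fun b c =>
        (if_neg (by dsimp only; omega)).trans (if_pos (Or.inr rfl))
      have f4 : ∀ b c, recolour j c (recolour (j + 1) b s) ⟨j + 1, hj⟩ = c := fun b c =>
        if_pos (Or.inr rfl)
      have f5 : ∀ b d, recolour (j + 1) d (recolour j (s ⟨j, by omega⟩) (recolour (j + 1) b s)) =
          recolour (j + 1) d s := by
        intro b d
        funext x
        simp only [recolour]
        split_ifs with g1 g2
        · rfl
        · congr 1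
          exact Fin.ext (by dsimp only; omega)
        · rfl
      simp [f1, f2, f3, f4, f5, Matrix.one_apply]
  · rfl

theorem mat_hook_comm {i j : ℕ} (hi : i + 1 < k) (hj : j + 1 < k) (hij : i + 2 ≤ j) :
    mat (Diagram.hook i hi) * mat (Diagram.hook j hj) =
      mat (Diagram.hook j hj) * mat (Diagram.hook i hi) := by
  nth_rw 1 [← Matrix.mul_one (mat (Diagram.hook j hj))]
  nth_rw 2 [← Matrix.mul_one (mat (Diagram.hook i hi))]
  ext s t
  simp only [mat_hook_mul_apply]
  have e1 : ∀ b, recolour i b s ⟨j, by omega⟩ = s ⟨j, by omega⟩ := fun b =>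
    if_neg (by dsimp only; omega)
  have e2 : ∀ b, recolour i b s ⟨j + 1, hj⟩ = s ⟨j + 1, hj⟩ := fun b =>
    if_neg (by dsimp only; omega)
  have e3 : ∀ b, recolour j b s ⟨i, by omega⟩ = s ⟨i, by omega⟩ := fun b =>
    if_neg (by dsimp only; omega)
  have e4 : ∀ b, recolour j b s ⟨i + 1, hi⟩ = s ⟨i + 1, hi⟩ := fun b =>
    if_neg (by dsimp only; omega)
  have e5 : ∀ b c, recolour j c (recolour i b s) = recolour i b (recolour j c s) := by
    intro b c
    funext x
    simp only [recolour]
    split_ifs <;> first | rfl | omega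
  simp only [e1, e2, e3, e4]
  split_ifs with h1 h2
  · rw [Finset.sum_comm]
    simp only [Matrix.one_apply, e5]
  · simp
  · simp
  · rfl

end Generators

/-! ### The Temperley-Lieb relations -/

section GeneratorRelations

variable {k l m : ℕ} {δ : ℝ}

theorem Diagram.reflect_hook {i : ℕ} (h : i + 1 < k) :
    (Diagram.hook i h).reflect = Diagram.hook i h := by
  ext1
  funext p
  rcases p with j | j <;> simp only [Diagram.reflect, Diagram.hook, Sum.swap_inl, Sum.swap_inr,
    hookPair] <;> split_ifs <;> rfl

theorem star_gen (i : ℕ) : star (gen δ k i) = gen δ k i := by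
  rw [gen]
  split_ifs
  · rw [Alg.star_of, Diagram.reflect_hook]
  · exact star_zero _

theorem Diagram.hook_pair {i : ℕ} (h : i + 1 < k) :
    (Diagram.hook i h).pair (Sum.inl ⟨i, by omega⟩) = Sum.inl ⟨i + 1, h⟩ := by
  simp [Diagram.hook, hookPair]

/-- A generator multiplies the diagrams that start with the same cup by the modulus. -/
theorem gen_mul_of {i : ℕ} (h : i + 1 < k) {Y : Diagram k}
    (hY : Y.pair (Sum.inl ⟨i, by omega⟩) = Sum.inl ⟨i + 1, h⟩) :
    gen δ k i * Alg.of δ Y = δ • Alg.of δ Y := by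
  rw [gen_of_lt h, Alg.of_mul_of_eq (mat_hook_mul_of_arc h hY), Alg.real_smul, pow_one]

theorem gen_isTL (δ : ℝ) {k K : ℕ} (hK : K ≤ k - 1) : IsTL δ K (gen δ k) where
  star_eq := star_gen
  sq i hi := by
    have h : i + 1 < k := by omega
    nth_rw 2 [gen_of_lt h]
    rw [gen_mul_of h (Diagram.hook_pair h), ← gen_of_lt]
  up i hi := by
    rw [gen_of_lt (show i + 1 < k by omega), gen_of_lt (show i + 1 + 1 < k by omega)]
    exact Alg.of_mul_of_mul_of_eq (mat_hook_braid _ _ (Or.inl rfl))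
  down i hi := by
    rw [gen_of_lt (show i + 1 < k by omega), gen_of_lt (show i + 1 + 1 < k by omega)]
    exact Alg.of_mul_of_mul_of_eq (mat_hook_braid _ _ (Or.inr rfl))
  comm i j hj hij := by
    rw [gen_of_lt (show i + 1 < k by omega), gen_of_lt (show j + 1 < k by omega)]
    exact Alg.of_congr (mat_hook_comm _ _ hij)

/-! ### The Markov property -/

theorem IsStack.vertical {X Y Z : Diagram k} (h : IsStack X Y Z) {j : Fin k}
    (hX : X.pair (Sum.inl j) = Sum.inr j) (hY : Y.pair (Sum.inl j) = Sum.inr j) :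
    Z.pair (Sum.inl j) = Sum.inr j := by
  have h1 := (stackGraph_adj_upper X Y (Sum.inl j)).reachable
  have h2 := (stackGraph_adj_lower X Y (Sum.inl j)).reachable
  rw [hX] at h1
  rw [hY] at h2
  have h3 : (stackGraph X Y).Reachable (outer (Sum.inl j)) (outer (Sum.inr j)) := h1.trans h2
  rcases h.reachable_iff.1 h3 with h4 | h4
  · simp at h4
  · exact h4.symm

/-- The combinations of diagrams in which the `j`-th strand is vertical. -/
def verticalSubalgebra (δ : ℝ) (j : Fin k) : Subalgebra ℝ (Alg δ k) where
  carrier := {x | ∀ Z : Diagram k, x Z ≠ 0 → Z.pair (Sum.inl j) = Sum.inr j}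
  mul_mem' {x y} hx hy Z hZ := by
    obtain ⟨X, -, hX⟩ := Finset.exists_ne_zero_of_sum_ne_zero hZ
    obtain ⟨Y, -, hY⟩ := Finset.exists_ne_zero_of_sum_ne_zero hX
    by_cases h : IsStack X Y Z
    · rw [if_pos h] at hY
      have h1 := right_ne_zero_of_mul hY
      exact h.vertical (hx X (left_ne_zero_of_mul h1)) (hy Y (right_ne_zero_of_mul h1))
    · exact absurd (if_neg h) hY
  add_mem' {x y} hx hy Z hZ := by
    by_cases h : x Z = 0
    · refine hy Z fun h' => hZ ?_
      change x Z + y Z = 0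
      rw [h, h', add_zero]
    · exact hx Z h
  algebraMap_mem' r Z hZ := by
    have h : (r • (1 : Alg δ k)) Z ≠ 0 := by rwa [Algebra.algebraMap_eq_smul_one] at hZ
    have h' : ofDiagram (Diagram.one k) Z ≠ 0 :=
      right_ne_zero_of_smul (show r • ofDiagram (Diagram.one k) Z ≠ 0 from h)
    by_cases hZ1 : Z = Diagram.one k
    · rw [hZ1]; rfl
    · simp [ofDiagram, hZ1] at h'

theorem gen_mem_verticalSubalgebra {i : ℕ} {j : Fin k} (h : i + 1 < j.val) :
    gen δ k i ∈ verticalSubalgebra δ j := by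
  intro Z hZ
  rw [gen_of_lt (by omega)] at hZ
  have h' : ofDiagram (Diagram.hook (k := k) i (by omega)) Z ≠ 0 := hZ
  by_cases hZ1 : Z = Diagram.hook i (by omega)
  · rw [hZ1]
    simp only [Diagram.hook, hookPair]
    rw [if_neg (by omega), if_neg (by omega)]
  · simp [ofDiagram, hZ1] at h'

/-- Closing a diagram with a vertical last strand against the generator at that strand undoes one
loop: half of the colourings of the closure survive. -/
theorem trace_mat_hook_mul {i : ℕ} (h : i + 1 < k) {Z : Diagram k}
    (hZ : Z.pair (Sum.inl ⟨i + 1, h⟩) = Sum.inr ⟨i + 1, h⟩) :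
    (mat Z).trace = 2 * (mat (Diagram.hook i h) * mat Z).trace := by
  let j0 : Fin k := ⟨i, by omega⟩
  let j : Fin k := ⟨i + 1, h⟩
  have hj : j0 ≠ j := by simp [j0, j]
  have hZ' : Z.pair (Sum.inr j) = Sum.inl j := by rw [← hZ, Z.pair_pair]
  have e1 : (mat (Diagram.hook i h) * mat Z).trace =
      ∑ s : Fin k → Bool, if s j0 = s j then mat Z s s else 0 := by
    refine Finset.sum_congr rfl fun s _ => ?_
    rw [Matrix.diag_apply, mat_hook_mul_apply]
    split_ifs with h'
    · rw [Finset.sum_eq_single (s j)]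
      · congr 1
        funext x
        rw [recolour]
        split_ifs with hx
        · rcases hx with hx | hx
          · rw [← h']; congr 1; exact Fin.ext hx.symm
          · congr 1; exact Fin.ext hx.symm
        · rfl
      · intro b _ hb
        refine if_neg fun hr => hb ?_
        have h1 := hr (Sum.inl j)
        rw [hZ] at h1
        simpa [recolour, j] using h1.symm
      · simp
    · rfl
  -- the reversal of the colour of the strand `j` exchanges the two halves
  let F : (Fin k → Bool) ≃ (Fin k → Bool) :=
    Function.Involutive.toPerm (fun s x => if x = j then !(s x) else s x) (by
      intro s
      funext x
      dsimp only
      split_ifs <;> simp)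
  have hF : ∀ s, mat Z (F s) (F s) = mat Z s s := by
    intro s
    rw [mat, mat]
    congr 1
    have e : ∀ p, Sum.elim (F s) (F s) p =
        if p = Sum.inl j ∨ p = Sum.inr j then !(Sum.elim s s p) else Sum.elim s s p := by
      have e0 : ∀ x, F s x = if x = j then !(s x) else s x := fun _ => rfl
      rintro (x | x) <;> simp [e0]
    have e' : ∀ p, (Z.pair p = Sum.inl j ∨ Z.pair p = Sum.inr j) ↔
        (p = Sum.inl j ∨ p = Sum.inr j) := by
      intro p
      constructor
      · rintro (h1 | h1)
        · exact Or.inr (by rw [← Z.pair_pair p, h1, hZ])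
        · exact Or.inl (by rw [← Z.pair_pair p, h1, hZ'])
      · rintro (rfl | rfl)
        · exact Or.inr hZ
        · exact Or.inl hZ'
    rw [eq_iff_iff]
    refine forall_congr' fun p => ?_
    rw [e, e]
    simp only [e']
    split_ifs
    · rw [Bool.not_inj_iff]
    · rfl
  have e2 : (mat Z).trace = (∑ s : Fin k → Bool, if s j0 = s j then mat Z s s else 0) +
      ∑ s : Fin k → Bool, if s j0 = s j then 0 else mat Z s s := by
    rw [← Finset.sum_add_distrib]
    refine Finset.sum_congr rfl fun s _ => ?_
    rw [Matrix.diag_apply]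
    split_ifs <;> simp
  have e3 : (∑ s : Fin k → Bool, if s j0 = s j then 0 else mat Z s s) =
      ∑ s : Fin k → Bool, if s j0 = s j then mat Z s s else 0 := by
    rw [← Equiv.sum_comp F]
    refine Finset.sum_congr rfl fun s _ => ?_
    rw [hF]
    have f1 : F s j0 = s j0 := if_neg hj
    have f2 : F s j = !(s j) := if_pos rfl
    rw [f1, f2]
    cases s j0 <;> cases s j <;> simp
  rw [e1, e2, e3, two_mul]

theorem gen_isMarkov (δ : ℝ) {k K : ℕ} (hK : K ≤ k - 1) :
    IsMarkov δ K (gen δ k) ((Alg.tr δ k).restrictScalars ℝ) where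
  comm x y := Alg.tr_mul_comm x y
  markov i hi x hx := by
    have h : i + 1 < k := by omega
    have hx' : x ∈ verticalSubalgebra δ (⟨i + 1, h⟩ : Fin k) := by
      refine (Algebra.adjoin_le ?_ : Algebra.adjoin ℝ _ ≤ verticalSubalgebra δ _) hx
      rintro _ ⟨i', hi', rfl⟩
      exact gen_mem_verticalSubalgebra (Nat.add_lt_add_right (Set.mem_Iio.1 hi') 1)
    change δ • Alg.tr δ k (x * gen δ k i) = Alg.tr δ k x
    rw [Alg.eq_sum_of x, Finset.sum_mul, map_sum, map_sum, Finset.smul_sum]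
    refine Finset.sum_congr rfl fun Z _ => ?_
    by_cases hZ : x Z = 0
    · simp [hZ]
    rw [smul_mul_assoc, map_smul, map_smul, smul_comm]
    congr 1
    rw [gen_of_lt h]
    obtain ⟨e, h1, h2⟩ := Alg.exists_tr_mul Z (Diagram.hook i h)
    have h3 := trace_mat_hook_mul h (hx' Z hZ)
    rw [Matrix.trace_mul_comm, h1, ← pow_succ'] at h3
    rw [h2, Alg.tr_of_eq h3, Complex.real_smul, pow_succ']

/-! ### Jones-Wenzl projections and two-cup diagrams in terms of generators -/

theorem tensorLeft_gen (h : k + l = m) {i : ℕ} (hi : i + 1 < k) :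
    tensorLeft h δ (gen δ k i) = gen δ m i := by
  rw [gen_of_lt hi, gen_of_lt (show i + 1 < m by omega), tensorLeft_apply, Alg.one_def,
    tensorHom_of, ← (isTensor_iff h).1]
  subst h
  constructor
  · rintro (⟨j, hj⟩ | ⟨j, hj⟩) <;> simp only [left, Diagram.hook, hookPair, Sum.map_inl,
      Sum.map_inr, Fin.val_cast, Fin.val_castAdd] <;> split_ifs <;> rfl
  · rintro (⟨j, hj⟩ | ⟨j, hj⟩) <;> simp only [right, Diagram.hook, hookPair, Sum.map_inl,
      Sum.map_inr, Fin.val_cast, Fin.val_natAdd] <;>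
      rw [if_neg (by omega), if_neg (by omega)] <;> rfl

theorem tensorRight_gen (h : k + l = m) {i : ℕ} (hi : i + 1 < l) :
    tensorRight h δ (gen δ l i) = gen δ m (i + k) := by
  rw [gen_of_lt hi, gen_of_lt (show i + k + 1 < m by omega), tensorRight_apply, Alg.one_def,
    tensorHom_of, ← (isTensor_iff h).1]
  subst h
  constructor
  · rintro (⟨j, hj⟩ | ⟨j, hj⟩) <;> simp only [left, Diagram.hook, hookPair, Sum.map_inl,
      Sum.map_inr, Fin.val_cast, Fin.val_castAdd] <;>
      rw [if_neg (by omega), if_neg (by omega)] <;> rfl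
  · rintro (⟨j, hj⟩ | ⟨j, hj⟩) <;> simp only [right, Diagram.hook, hookPair, Sum.map_inl,
      Sum.map_inr, Fin.val_cast, Fin.natAdd_mk] <;> split_ifs <;>
      first | omega | (simp; done) | (simp; omega)

theorem twoCup_zero (k : ℕ) : Diagram.twoCup k 0 = Diagram.hook k (by omega) := by
  ext1
  funext p
  rcases p with ⟨j, hj⟩ | ⟨j, hj⟩ <;> simp only [Diagram.twoCup, Diagram.hook, twoCupPair, hookPair]
    <;> split_ifs <;> first | rfl | omega

theorem jonesWenzl_eq_jw (q : ℝ) (k : ℕ) :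
    (jonesWenzl q k : Alg (q + q⁻¹) k) = jw q (gen (q + q⁻¹) k) k := by
  induction k with
  | zero => rfl
  | succ k ih =>
    cases k with
    | zero => rfl
    | succ k =>
      set g : Alg (q + q⁻¹) (k + 2) := jw q (gen (q + q⁻¹) (k + 2)) (k + 1) with hg
      have e1 : (tensor (l := 1) rfl (jonesWenzl q (k + 1)) (ofDiagram (Diagram.one 1)) :
          Alg (q + q⁻¹) (k + 2)) = g := by
        change tensorLeft (l := 1) rfl (q + q⁻¹) (jonesWenzl q (k + 1) : Alg (q + q⁻¹) (k + 1)) = g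
        rw [ih, map_jw]
        exact jw_congr _ fun i hi => tensorLeft_gen rfl hi
      have e2 : Alg.of (q + q⁻¹) (Diagram.twoCup k 0) = gen (q + q⁻¹) (k + 2) k := by
        rw [twoCup_zero, gen_of_lt]
      rw [jw, ← hg, ← e2, ← e1]
      rfl

theorem map_desc {A B : Type*} [Ring A] [Algebra ℝ A] [Ring B] [Algebra ℝ B] (φ : A →ₐ[ℝ] B)
    (u : ℕ → A) (a b : ℕ) : φ (desc u a b) = desc (fun i => φ (u i)) a b := by
  induction b with
  | zero => rfl
  | succ b ih => rw [desc, desc, map_mul, ih]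

theorem desc_congr {A : Type*} [Ring A] {u v : ℕ → A} (a b : ℕ) (h : ∀ i, i ≤ a + b → u i = v i) :
    desc u a b = desc v a b := by
  induction b with
  | zero => exact h a le_rfl
  | succ b ih => rw [desc, desc, ih fun i hi => h i (by omega), h (a + b + 1) le_rfl]

/-- Drawing a strand to the right of a two-cup diagram and then a generator on top moves the cup one
place to the right. -/
theorem of_twoCup_succ (a b : ℕ) : Alg.of δ (Diagram.twoCup a (b + 1)) =
    gen δ (a + b + 3) (a + b + 1) *
      tensorLeft (l := 1) rfl δ (Alg.of δ (Diagram.twoCup a b)) := by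
  have h : a + b + 1 + 1 < a + b + 3 := by omega
  rw [gen_of_lt h, tensorLeft_apply, Alg.one_def, tensorHom_of]
  set Y : Diagram (a + b + 2 + 1) := (Diagram.twoCup a b).tensor rfl (Diagram.one 1) with hY
  have y0 : Y.pair (Sum.inl ⟨a + b + 1, by omega⟩) = Sum.inl ⟨a + b, by omega⟩ := by
    refine ((Diagram.twoCup a b).tensor_left rfl (Diagram.one 1)
      (Sum.inl ⟨a + b + 1, by omega⟩)).trans ?_
    simp only [Diagram.twoCup, twoCupPair]
    rw [dif_neg (by omega), dif_neg (by omega), if_neg (by omega)]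
    rfl
  have y1 : Y.pair (Sum.inl ⟨a + b + 1 + 1, h⟩) = Sum.inr ⟨a + b + 1 + 1, h⟩ :=
    (Diagram.twoCup a b).tensor_right rfl (Diagram.one 1) (Sum.inl 0)
  symm
  refine Alg.of_mul_of_eq' (mat_hook_mul_of_join h ?_ ?_ ?_ ?_)
  · rw [y0]
    simp only [ne_eq, Sum.inl.injEq, Fin.mk.injEq]
    omega
  · simp only [Diagram.twoCup, twoCupPair]
    rw [dif_neg (by omega), dif_neg (by omega), if_pos (by omega)]
    rfl
  · rw [y0, y1]
    simp only [Diagram.twoCup, twoCupPair]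
    split_ifs <;> first | omega | rfl
  · rw [y0, y1]
    intro p
    rcases left_or_right (k := a + b + 2) (l := 1) rfl p with ⟨p, rfl⟩ | ⟨p, rfl⟩
    · rw [hY, Diagram.tensor_left]
      rcases p with ⟨j, hj⟩ | ⟨j, hj⟩ <;>
        simp only [left, Sum.map_inl, Sum.map_inr, Fin.cast_eq_self, Fin.castAdd_mk, ne_eq,
          Sum.inl.injEq, Sum.inr.injEq, Fin.mk.injEq, reduceCtorEq, not_false_eq_true,
          forall_true_left, Diagram.twoCup, twoCupPair] <;> intros <;> split_ifs <;>
        first | omega | rfl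
    · rcases p with ⟨j, hj⟩ | ⟨j, hj⟩ <;> obtain rfl : j = 0 := by omega
      · intro _ h2
        exact absurd rfl h2
      · intro _ _ _ h4
        exact absurd rfl h4

theorem of_twoCup (a b : ℕ) :
    Alg.of δ (Diagram.twoCup a b) = desc (gen δ (a + b + 2)) a b := by
  induction b with
  | zero => rw [twoCup_zero, desc, gen_of_lt]
  | succ b ih =>
    rw [of_twoCup_succ, ih, map_desc, desc,
      desc_congr (u := fun i => tensorLeft rfl δ (gen δ (a + b + 2) i))
        (v := gen δ (a + b + 3)) a b fun i hi => tensorLeft_gen rfl (by omega)]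
    rfl

theorem diagramD_eq (q : ℝ) (a b : ℕ) :
    (diagramD q a b : Alg (q + q⁻¹) (a + b + 2)) =
      jw q (gen (q + q⁻¹) (a + b + 2)) (a + b + 1) * desc (gen (q + q⁻¹) (a + b + 2)) a b *
        (jw q (gen (q + q⁻¹) (a + b + 2)) (a + 1) *
          jw q (fun i => gen (q + q⁻¹) (a + b + 2) (i + (a + 1))) (b + 1)) := by
  have e1 : tensorLeft (l := 1) rfl (q + q⁻¹)
      (jonesWenzl q (a + b + 1) : Alg (q + q⁻¹) (a + b + 1)) =
      jw q (gen (q + q⁻¹) (a + b + 2)) (a + b + 1) := by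
    rw [jonesWenzl_eq_jw, map_jw]
    exact jw_congr _ fun i hi => tensorLeft_gen rfl hi
  have h : a + 1 + (b + 1) = a + b + 2 := by omega
  have e2 : tensorLeft h (q + q⁻¹) (jonesWenzl q (a + 1) : Alg (q + q⁻¹) (a + 1)) =
      jw q (gen (q + q⁻¹) (a + b + 2)) (a + 1) := by
    rw [jonesWenzl_eq_jw, map_jw]
    exact jw_congr _ fun i hi => tensorLeft_gen h hi
  have e3 : tensorRight h (q + q⁻¹) (jonesWenzl q (b + 1) : Alg (q + q⁻¹) (b + 1)) =
      jw q (fun i => gen (q + q⁻¹) (a + b + 2) (i + (a + 1))) (b + 1) := by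
    rw [jonesWenzl_eq_jw, map_jw]
    exact jw_congr _ fun i hi => tensorRight_gen h hi
  rw [← e1, ← e2, ← e3, ← of_twoCup]
  exact congrArg (_ * ·) (tensorHom_eq_mul h (jonesWenzl q (a + 1) : Alg (q + q⁻¹) (a + 1))
    (jonesWenzl q (b + 1) : Alg (q + q⁻¹) (b + 1)))

end GeneratorRelations

/-! ### Innermost strings -/

section Combinatorics

variable {k : ℕ}

/-- Below a string that joins two top points there is one that joins two neighbours. -/
theorem Diagram.exists_adjacent (Y : Diagram k) {i j : ℕ} (hj : j < k) (hij : i < j)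
    (h : Y.pair (Sum.inl ⟨i, by omega⟩) = Sum.inl ⟨j, hj⟩) :
    ∃ l, ∃ hl : l + 1 < k, i ≤ l ∧ l + 1 ≤ j ∧
      Y.pair (Sum.inl ⟨l, by omega⟩) = Sum.inl ⟨l + 1, hl⟩ := by
  obtain ⟨d, hd⟩ : ∃ d, d = j - i := ⟨_, rfl⟩
  induction d using Nat.strong_induction_on generalizing i j with
  | _ d ih =>
    rcases Nat.eq_or_lt_of_le (Nat.succ_le_of_lt hij) with rfl | hlt
    · exact ⟨i, hj, le_rfl, le_rfl, h⟩
    have h1 := Y.noncrossing (Sum.inl ⟨i, by omega⟩) (Sum.inl ⟨i + 1, by omega⟩)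
    have h2 := Y.noncrossing (Y.pair (Sum.inl ⟨i + 1, by omega⟩)) (Sum.inl ⟨i, by omega⟩)
    rw [Y.pair_pair] at h2
    rw [h] at h1 h2
    have h3 := Y.pair_pair (Sum.inl ⟨i + 1, by omega⟩)
    have h4 := Y.pair_ne (Sum.inl ⟨i + 1, by omega⟩)
    rcases hp : Y.pair (Sum.inl ⟨i + 1, by omega⟩) with ⟨m, hm⟩ | ⟨m, hm⟩
    · rw [hp] at h1 h2 h3 h4
      simp only [pos] at h1 h2
      have h5 : m ≠ i + 1 := by rintro rfl; exact h4 rfl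
      have h6 : m ≠ j := by
        rintro rfl
        rw [← h, Y.pair_pair] at h3
        simp at h3
      have h7 : m ≠ i := by
        rintro rfl
        rw [h] at h3
        simp at h3
        omega
      obtain ⟨l, hl, l1, l2, l3⟩ := ih (m - (i + 1)) (by omega) hm (by omega) hp rfl
      exact ⟨l, hl, by omega, by omega, l3⟩
    · rw [hp] at h1
      simp only [pos] at h1
      omega

/-- Strings from top to bottom keep their order. -/
theorem Diagram.through_lt (Y : Diagram k) {i i' j j' : Fin k} (hii : i < i')
    (h : Y.pair (Sum.inl i) = Sum.inr j) (h' : Y.pair (Sum.inl i') = Sum.inr j') : j < j' := by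
  have h1 := Y.noncrossing (Sum.inl i) (Sum.inl i')
  rw [h, h'] at h1
  have h2 : j ≠ j' := by
    rintro rfl
    have := Y.pair_pair (Sum.inl i)
    rw [h, ← h', Y.pair_pair] at this
    simp only [Sum.inl.injEq] at this
    exact hii.ne' this
  simp only [pos] at h1
  omega

/-- A diagram in which all strings run from top to bottom is the identity. -/
theorem Diagram.eq_one_of_through (Y : Diagram k) (h : ∀ i, ∃ j, Y.pair (Sum.inl i) = Sum.inr j) :
    Y = Diagram.one k := by
  choose g hg using h
  have hm : StrictMono g := fun i i' hii => Y.through_lt hii (hg i) (hg i')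
  have hid : g = id := by
    refine (hm.range_inj strictMono_id).1 ?_
    rw [Set.range_id, (Finite.injective_iff_surjective.1 hm.injective).range_eq]
  ext1
  funext p
  rcases p with i | i
  · rw [hg, hid]; rfl
  · have := Y.pair_pair (Sum.inl i)
    rw [hg, hid] at this
    exact this

theorem Diagram.exists_cup_of_ne_one {Y : Diagram k} (h : Y ≠ Diagram.one k) :
    ∃ l, ∃ hl : l + 1 < k, Y.pair (Sum.inl ⟨l, by omega⟩) = Sum.inl ⟨l + 1, hl⟩ := by
  by_contra! hcon
  refine h (Y.eq_one_of_through fun i => ?_)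
  rcases hp : Y.pair (Sum.inl i) with j | j
  · exfalso
    rcases lt_trichotomy i j with hij | rfl | hij
    · obtain ⟨l, hl, -, -, h3⟩ := Y.exists_adjacent j.2 hij hp
      exact hcon l hl h3
    · exact Y.pair_ne _ hp
    · obtain ⟨l, hl, -, -, h3⟩ := Y.exists_adjacent (i := j) i.2 hij (by
        rw [← Y.pair_pair (Sum.inl ⟨i, _⟩), ← hp])
      exact hcon l hl h3
  · exact ⟨j, rfl⟩

theorem Diagram.reflect_pair_inl {Y : Diagram k} {i j : Fin k} :
    Y.reflect.pair (Sum.inl i) = Sum.inl j ↔ Y.pair (Sum.inr i) = Sum.inr j := by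
  simp only [Diagram.reflect, Sum.swap_inl]
  rcases Y.pair (Sum.inr i) with x | x <;> simp

theorem range_eq_compl_pair {n : ℕ} {g : Fin n → Fin (n + 2)} (hg : Function.Injective g)
    {x y : Fin (n + 2)} (hxy : x ≠ y) (hx : ∀ i, g i ≠ x) (hy : ∀ i, g i ≠ y) :
    Set.range g = {x, y}ᶜ := by
  have h : Finset.univ.image g = {x, y}ᶜ := by
    refine Finset.eq_of_subset_of_card_le ?_ ?_
    · intro z hz
      obtain ⟨i, -, rfl⟩ := Finset.mem_image.1 hz
      simp [hx i, hy i]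
    · rw [Finset.card_image_of_injective _ hg, Finset.card_compl, Finset.card_pair hxy]
      simp
  have h' := congrArg (fun s : Finset (Fin (n + 2)) => (s : Set (Fin (n + 2)))) h
  rw [Finset.coe_image, Finset.coe_univ, Set.image_univ] at h'
  rw [h', Finset.coe_compl, Finset.coe_pair]

/-- A diagram whose innermost strings are at most a cup at the right end of the top edge and a cap
at the place `a` of the bottom edge is the identity or the two-cup diagram. -/
theorem Diagram.eq_one_or_eq_twoCup {a b : ℕ} (Y : Diagram (a + b + 2))
    (htop : ∀ l (hl : l + 1 < a + b + 2),
      Y.pair (Sum.inl ⟨l, by omega⟩) = Sum.inl ⟨l + 1, hl⟩ → l = a + b)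
    (hbot : ∀ l (hl : l + 1 < a + b + 2),
      Y.pair (Sum.inr ⟨l, by omega⟩) = Sum.inr ⟨l + 1, hl⟩ → l = a) :
    Y = Diagram.one (a + b + 2) ∨ Y = Diagram.twoCup a b := by
  by_cases h1 : Y = Diagram.one (a + b + 2)
  · exact Or.inl h1
  right
  obtain ⟨l, hl, hY⟩ := Diagram.exists_cup_of_ne_one h1
  obtain rfl := htop l hl hY
  have hY' : Y.pair (Sum.inl ⟨a + b + 1, by omega⟩) = Sum.inl ⟨a + b, by omega⟩ := by
    rw [← hY, Y.pair_pair]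
  have h2 : Y.reflect ≠ Diagram.one (a + b + 2) := by
    intro h
    have h3 : Y.pair (Sum.inl ⟨a + b, by omega⟩) = Sum.inr ⟨a + b, by omega⟩ := by
      rw [Diagram.reflect_eq_iff.1 h]; rfl
    rw [hY] at h3
    simp at h3
  obtain ⟨l, hl', hZ⟩ := Diagram.exists_cup_of_ne_one h2
  rw [Diagram.reflect_pair_inl] at hZ
  obtain rfl := hbot l hl' hZ
  have hZ' : Y.pair (Sum.inr ⟨l + 1, by omega⟩) = Sum.inr ⟨l, by omega⟩ := by
    rw [← hZ, Y.pair_pair]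
  -- a top string other than the cup would contain a second innermost one
  have key : ∀ i j : ℕ, ∀ hj : j < l + b + 2, ∀ hij : i < j,
      Y.pair (Sum.inl ⟨i, by omega⟩) = Sum.inl ⟨j, hj⟩ → i = l + b := by
    intro i j hj hij h
    obtain ⟨c, hc, c1, c2, c3⟩ := Y.exists_adjacent hj hij h
    have c4 := htop c hc c3
    obtain rfl : j = l + b + 1 := by omega
    rw [← hY] at h
    have h5 := congrArg Y.pair h
    rw [Y.pair_pair, Y.pair_pair] at h5
    simpa using h5
  have hthrough : ∀ i : Fin (l + b), ∃ j, Y.pair (Sum.inl ⟨i, by omega⟩) = Sum.inr j := by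
    intro i
    rcases hp : Y.pair (Sum.inl ⟨i, by omega⟩) with ⟨j, hj⟩ | j
    · exfalso
      rcases lt_trichotomy i.val j with hij | hij | hij
      · have := key i j hj hij hp
        omega
      · exact Y.pair_ne _ (hp.trans (by simp [hij]))
      · have h5 := congrArg Y.pair hp
        rw [Y.pair_pair] at h5
        have := key j i (by omega) hij h5.symm
        omega
    · exact ⟨j, rfl⟩
  choose g hg using hthrough
  set E := Diagram.twoCup l b with hE
  let g0 : Fin (l + b) → Fin (l + b + 2) := fun i =>
    if i.val < l then ⟨i, by omega⟩ else ⟨i + 2, by omega⟩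
  have hg0 : ∀ i : Fin (l + b), E.pair (Sum.inl ⟨i, by omega⟩) = Sum.inr (g0 i) := by
    intro i
    simp only [hE, Diagram.twoCup, twoCupPair, g0]
    split_ifs <;> first | rfl | omega
  have hgm : StrictMono g := fun i i' hii => Y.through_lt (by exact hii) (hg i) (hg i')
  have hg0m : StrictMono g0 := fun i i' hii => E.through_lt (by exact hii) (hg0 i) (hg0 i')
  have hne : (⟨l, by omega⟩ : Fin (l + b + 2)) ≠ ⟨l + 1, by omega⟩ := by simp
  have hgg : g = g0 := by
    refine (hgm.range_inj hg0m).1 ?_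
    rw [range_eq_compl_pair hgm.injective hne, range_eq_compl_pair hg0m.injective hne]
    · intro i
      simp only [g0]
      split_ifs <;> simp <;> omega
    · intro i
      simp only [g0]
      split_ifs <;> simp <;> omega
    · intro i hi
      have h5 := Y.pair_pair (Sum.inl ⟨i, by omega⟩)
      rw [hg, hi, hZ] at h5
      simp at h5
    · intro i hi
      have h5 := Y.pair_pair (Sum.inl ⟨i, by omega⟩)
      rw [hg, hi, hZ'] at h5
      simp at h5
  have hinl : ∀ i, Y.pair (Sum.inl i) = E.pair (Sum.inl i) := by
    rintro ⟨i, hi⟩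
    by_cases c1 : i < l + b
    · have h5 := hg ⟨i, c1⟩
      have h6 := hg0 ⟨i, c1⟩
      rw [hgg] at h5
      exact h5.trans h6.symm
    · simp only [hE, Diagram.twoCup, twoCupPair]
      rw [dif_neg (by omega), dif_neg (by omega)]
      split_ifs with c2
      · subst c2; exact hY
      · obtain rfl : i = l + b + 1 := by omega
        exact hY'
  ext1
  funext p
  rcases p with i | ⟨j, hj⟩
  · exact hinl i
  · by_cases c1 : j = l
    · subst c1
      rw [hZ]
      simp [hE, Diagram.twoCup, twoCupPair]
    by_cases c2 : j = l + 1
    · subst c2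
      rw [hZ']
      simp [hE, Diagram.twoCup, twoCupPair]
    have h5 : ∃ i, E.pair (Sum.inr ⟨j, hj⟩) = Sum.inl i := by
      simp only [hE, Diagram.twoCup, twoCupPair]
      rw [if_neg c1, if_neg c2]
      split_ifs <;> exact ⟨_, rfl⟩
    obtain ⟨i, h5⟩ := h5
    rw [h5, ← Y.pair_pair (Sum.inl i), hinl, ← h5, E.pair_pair]

end Combinatorics

/-! ### Nondegeneracy of the trace form -/

section Nondegenerate

variable {q δ : ℝ} {k m : ℕ}

theorem of_mul_gen {i : ℕ} (h : i + 1 < k) {Y : Diagram k}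
    (hY : Y.pair (Sum.inr ⟨i, by omega⟩) = Sum.inr ⟨i + 1, h⟩) :
    Alg.of δ Y * gen δ k i = δ • Alg.of δ Y := by
  have h1 := congrArg star (gen_mul_of (δ := δ) h (Diagram.reflect_pair_inl.2 hY))
  rwa [star_mul, star_smul, star_gen, Alg.star_of, Diagram.reflect_reflect, star_trivial] at h1

theorem mul_of_eq_zero (hδ : δ ≠ 0) {x : Alg δ k} {i : ℕ} (h : i + 1 < k) {Y : Diagram k}
    (hx : x * gen δ k i = 0)
    (hY : Y.pair (Sum.inl ⟨i, by omega⟩) = Sum.inl ⟨i + 1, h⟩) : x * Alg.of δ Y = 0 := by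
  have h1 := congrArg (x * ·) (gen_mul_of (δ := δ) h hY)
  rw [← mul_assoc, hx, zero_mul, mul_smul_comm] at h1
  exact (smul_eq_zero.1 h1.symm).resolve_left hδ

theorem of_mul_eq_zero (hδ : δ ≠ 0) {x : Alg δ k} {i : ℕ} (h : i + 1 < k) {Y : Diagram k}
    (hx : gen δ k i * x = 0)
    (hY : Y.pair (Sum.inr ⟨i, by omega⟩) = Sum.inr ⟨i + 1, h⟩) : Alg.of δ Y * x = 0 := by
  have h1 := congrArg (· * x) (of_mul_gen (δ := δ) h hY)
  rw [mul_assoc, hx, mul_zero, smul_mul_assoc] at h1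
  exact (smul_eq_zero.1 h1.symm).resolve_left hδ

/-- The Jones-Wenzl projection, as an element of the algebra. -/
def jwProj (q : ℝ) (k : ℕ) : Alg (q + q⁻¹) k := jw q (gen (q + q⁻¹) k) k

theorem modulus_ne_zero (hq : 2 < q + q⁻¹) : q + q⁻¹ ≠ 0 := by linarith

theorem jwProj_mul_gen (hq : 2 < q + q⁻¹) {i : ℕ} (h : i + 1 < k) :
    jwProj q k * gen (q + q⁻¹) k i = 0 :=
  (gen_isTL (q + q⁻¹) le_rfl).jw_mul_gen hq (by omega) h

theorem gen_mul_jwProj (hq : 2 < q + q⁻¹) {i : ℕ} (h : i + 1 < k) :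
    gen (q + q⁻¹) k i * jwProj q k = 0 :=
  (gen_isTL (q + q⁻¹) le_rfl).gen_mul_jw hq (by omega) h

theorem jwProj_mul_of (hq : 2 < q + q⁻¹) {Y : Diagram k} (hY : Y ≠ Diagram.one k) :
    jwProj q k * Alg.of _ Y = 0 := by
  obtain ⟨l, hl, h⟩ := Diagram.exists_cup_of_ne_one hY
  exact mul_of_eq_zero (modulus_ne_zero hq) hl (jwProj_mul_gen hq hl) h

theorem of_mul_jwProj (hq : 2 < q + q⁻¹) {Y : Diagram k} (hY : Y ≠ Diagram.one k) :
    Alg.of _ Y * jwProj q k = 0 := by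
  have hY' : Y.reflect ≠ Diagram.one k := by
    intro h
    have h1 := congrArg Diagram.reflect h
    rw [Diagram.reflect_reflect] at h1
    refine hY (h1.trans ?_)
    ext1
    funext p
    rcases p with i | i <;> rfl
  obtain ⟨l, hl, h⟩ := Diagram.exists_cup_of_ne_one hY'
  exact of_mul_eq_zero (modulus_ne_zero hq) hl (gen_mul_jwProj hq hl) (Diagram.reflect_pair_inl.1 h)

/-- The Jones-Wenzl projection is a minimal central idempotent: it only sees the coefficient of the
identity diagram. -/
theorem jwProj_mul (hq : 2 < q + q⁻¹) (z : Alg (q + q⁻¹) k) :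
    jwProj q k * z = z (Diagram.one k) • jwProj q k := by
  conv_lhs => rw [Alg.eq_sum_of z, Finset.mul_sum]
  rw [Finset.sum_eq_single (Diagram.one k)]
  · rw [mul_smul_comm, ← Alg.one_def, mul_one]
  · intro Y _ hY
    rw [mul_smul_comm, jwProj_mul_of hq hY, smul_zero]
  · simp

theorem mul_jwProj (hq : 2 < q + q⁻¹) (z : Alg (q + q⁻¹) k) :
    z * jwProj q k = z (Diagram.one k) • jwProj q k := by
  conv_lhs => rw [Alg.eq_sum_of z, Finset.sum_mul]
  rw [Finset.sum_eq_single (Diagram.one k)]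
  · rw [smul_mul_assoc, ← Alg.one_def, one_mul]
  · intro Y _ hY
    rw [smul_mul_assoc, of_mul_jwProj hq hY, smul_zero]
  · simp

theorem tr_one : Alg.tr δ k 1 = (δ : ℂ) ^ k :=
  Alg.tr_of_eq (by rw [mat_one, Matrix.trace_one]; simp)

/-- Removes the normalization from a trace that is known up to a power of the modulus. -/
theorem tr_eq_of_smul (hq : 2 < q + q⁻¹) {x : Alg (q + q⁻¹) k} {r : ℝ}
    (h : (q + q⁻¹) ^ k • Alg.tr (q + q⁻¹) k x =
      r • Alg.tr (q + q⁻¹) k (1 : Alg (q + q⁻¹) k)) : Alg.tr (q + q⁻¹) k x = r := by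
  have h0 : ((q + q⁻¹ : ℝ) : ℂ) ^ k ≠ 0 :=
    pow_ne_zero _ (Complex.ofReal_ne_zero.2 (modulus_ne_zero hq))
  rw [tr_one, Complex.real_smul, Complex.real_smul, mul_comm (r : ℂ), Complex.ofReal_pow] at h
  exact mul_left_cancel₀ h0 h

theorem tr_jwProj (hq : 2 < q + q⁻¹) : Alg.tr _ k (jwProj q k) = qInt q (k + 1) :=
  tr_eq_of_smul hq ((gen_isTL (q + q⁻¹) le_rfl).trace_jw hq (gen_isMarkov (q + q⁻¹) le_rfl)
    (by omega))

theorem IsStack.pair_inl {X Y Z : Diagram k} (h : IsStack X Y Z) {i j : Fin k}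
    (hX : X.pair (Sum.inl i) = Sum.inl j) : Z.pair (Sum.inl i) = Sum.inl j := by
  have h1 := (stackGraph_adj_upper X Y (Sum.inl i)).reachable
  rw [hX] at h1
  rcases h.reachable_iff (p := Sum.inl i) (r := Sum.inl j) |>.1 h1 with h4 | h4
  · exact absurd (hX.trans h4) (X.pair_ne _)
  · exact h4.symm

theorem IsStack.pair_inr {X Y Z : Diagram k} (h : IsStack X Y Z) {i j : Fin k}
    (hY : Y.pair (Sum.inr i) = Sum.inr j) : Z.pair (Sum.inr i) = Sum.inr j := by
  have h1 := (stackGraph_adj_lower X Y (Sum.inr i)).reachable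
  rw [hY] at h1
  rcases h.reachable_iff (p := Sum.inr i) (r := Sum.inr j) |>.1 h1 with h4 | h4
  · exact absurd (hY.trans h4) (Y.pair_ne _)
  · exact h4.symm

theorem left_injective {l : ℕ} (h : k + l = m) : Function.Injective (left h) := fun p r hpr =>
  Sum.inl_injective ((sumElim_left_right_bijective h).1 (a₁ := Sum.inl p) (a₂ := Sum.inl r) hpr)

/-- The diagram on two strands with a cup and a cap. -/
def cupCap : Diagram 2 := Diagram.hook 0 (by omega)

/-- A diagram with a cup and a cap at the right end is obtained by juxtaposition. -/
theorem Diagram.exists_tensor_cupCap (W : Diagram (m + 2))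
    (h1 : W.pair (Sum.inl ⟨m, by omega⟩) = Sum.inl ⟨m + 1, by omega⟩)
    (h2 : W.pair (Sum.inr ⟨m, by omega⟩) = Sum.inr ⟨m + 1, by omega⟩) :
    ∃ Z : Diagram m, W = Z.tensor rfl cupCap := by
  have hr : ∀ p : Point 2, W.pair (right rfl p) = right rfl (cupCap.pair p) := by
    rintro (i | i) <;> fin_cases i
    · exact h1
    · exact (congrArg W.pair h1).symm.trans (W.pair_pair _)
    · exact h2
    · exact (congrArg W.pair h2).symm.trans (W.pair_pair _)
  have hl : ∀ p : Point m, ∃ p', W.pair (left rfl p) = left (l := 2) rfl p' := by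
    intro p
    rcases left_or_right (l := 2) rfl (W.pair (left rfl p)) with ⟨r, hp⟩ | ⟨r, hp⟩
    · exact ⟨r, hp.symm⟩
    · exfalso
      have h3 := congrArg W.pair hp
      rw [W.pair_pair, hr] at h3
      exact absurd ((sumElim_left_right_bijective (k := m) (l := 2) rfl).1
        (a₁ := Sum.inr (cupCap.pair r)) (a₂ := Sum.inl p) h3) (by simp)
  choose f hf using hl
  refine ⟨⟨f, fun p => left_injective (l := 2) rfl ?_, fun p h => ?_, fun p r => ?_⟩,
    (isTensor_iff rfl).1 ⟨hf, hr⟩⟩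
  · rw [← hf, ← hf, W.pair_pair]
  · exact W.pair_ne (left rfl p) (by rw [hf, h])
  · have h3 := W.noncrossing (left rfl p) (left rfl r)
    rw [hf, hf] at h3
    simpa only [pos_left_lt_left] using h3

/-- The map that draws a cup and a cap to the right. -/
def addCupCap (δ : ℝ) (m : ℕ) : Alg δ m →ₗ[ℂ] Alg δ (m + 2) :=
  (tensorHom rfl δ).flip (Alg.of δ cupCap)

theorem addCupCap_of (Z : Diagram m) :
    addCupCap δ m (Alg.of δ Z) = Alg.of δ (Z.tensor rfl cupCap) := tensorHom_of rfl Z cupCap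

/-- Between two copies of the last generator every element is drawn on `m` strands. -/
theorem exists_addCupCap (x : Alg δ (m + 2)) :
    ∃ w, gen δ (m + 2) m * x * gen δ (m + 2) m = addCupCap δ m w := by
  induction x using Alg.induction with
  | add x y hx hy =>
    obtain ⟨w, hw⟩ := hx
    obtain ⟨w', hw'⟩ := hy
    exact ⟨w + w', by rw [mul_add, add_mul, hw, hw', map_add]⟩
  | smul c x hx =>
    obtain ⟨w, hw⟩ := hx
    exact ⟨c • w, by rw [mul_smul_comm, smul_mul_assoc, hw, map_smul]⟩
  | of X =>
    have h : m + 1 < m + 2 := by omega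
    rw [gen_of_lt h, Alg.of_mul_of, smul_mul_assoc, Alg.of_mul_of]
    obtain ⟨Z, hZ⟩ := Diagram.exists_tensor_cupCap
      (((Diagram.hook m h).comp X).comp (Diagram.hook m h))
      ((Diagram.isStack_comp _ _).pair_inl ((Diagram.isStack_comp _ _).pair_inl
        (Diagram.hook_pair h)))
      ((Diagram.isStack_comp _ _).pair_inr (by simp [Diagram.hook, hookPair]))
    exact ⟨_ • _ • Alg.of δ Z, by rw [map_smul, map_smul, addCupCap_of, ← hZ]⟩

theorem exists_tr_addCupCap (m : ℕ) : ∃ e : ℕ, ∀ x y : Alg δ m,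
    Alg.tr δ (m + 2) (addCupCap δ m x * addCupCap δ m y) = (δ : ℂ) ^ e * Alg.tr δ m (x * y) := by
  obtain ⟨e, he, -⟩ := Alg.exists_tr_mul cupCap cupCap
  refine ⟨e, fun x y => ?_⟩
  induction x using Alg.induction with
  | add x z hx hz => simp only [add_mul, map_add, hx, hz, mul_add]
  | smul c x hx => simp only [smul_mul_assoc, map_smul, hx, smul_eq_mul, mul_left_comm]
  | of X =>
  induction y using Alg.induction with
  | add x z hx hz => simp only [mul_add, map_add, hx, hz]
  | smul c x hx => simp only [mul_smul_comm, map_smul, hx, smul_eq_mul, mul_left_comm]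
  | of Y =>
  obtain ⟨f, hf, hf'⟩ := Alg.exists_tr_mul X Y
  rw [hf', addCupCap_of, addCupCap_of, ← pow_add, Alg.tr_mul_of_eq]
  rw [trace_mat_tensor_mul, hf, he, ← pow_add, add_comm]

theorem gen_mul_mul_gen_eq_zero (hq : 2 < q + q⁻¹)
    (ih : ∀ w : Alg (q + q⁻¹) m, (∀ y, Alg.tr _ m (w * y) = 0) → w = 0)
    {z : Alg (q + q⁻¹) (m + 2)} (hz : ∀ y, Alg.tr _ (m + 2) (z * y) = 0) :
    gen _ (m + 2) m * z * gen _ (m + 2) m = 0 := by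
  obtain ⟨w, hw⟩ := exists_addCupCap z
  obtain ⟨e, he⟩ := exists_tr_addCupCap (δ := q + q⁻¹) m
  rw [hw, ih w, map_zero]
  intro y
  have h1 := he w y
  rw [← hw, mul_assoc, mul_assoc, Alg.tr_mul_comm, mul_assoc, hz] at h1
  exact (mul_eq_zero.1 h1.symm).resolve_left
    (pow_ne_zero _ (Complex.ofReal_ne_zero.2 (modulus_ne_zero hq)))

/-- For modulus greater than `2` the trace form is nondegenerate. An element `z` of the radical has
no identity coefficient, so that the Jones-Wenzl projection `f` kills it on both sides; on the other
hand all `u_i z u_j` vanish, by induction for the last generator and by the Temperley-Lieb relations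
for the others, so that `f` acts on `u_i z` and then on `z` as the identity. -/
theorem eq_zero_of_tr_mul_eq_zero (hq : 2 < q + q⁻¹) (z : Alg (q + q⁻¹) k)
    (hz : ∀ y, Alg.tr _ k (z * y) = 0) : z = 0 := by
  induction k using Nat.strong_induction_on with
  | _ k ih =>
    have hpos : ((qInt q (k + 1) : ℝ) : ℂ) ≠ 0 :=
      Complex.ofReal_ne_zero.2 (qInt_succ_pos hq k).ne'
    have hone : z (Diagram.one k) = 0 := by
      -- the trace of the Jones-Wenzl projection does not vanish
      have h1 := hz (jwProj q k)
      rw [mul_jwProj hq, map_smul, tr_jwProj hq, smul_eq_mul] at h1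
      exact (mul_eq_zero.1 h1).resolve_right hpos
    have hfz : jwProj q k * z = 0 := by rw [jwProj_mul hq, hone, zero_smul]
    have hzf : z * jwProj q k = 0 := by rw [mul_jwProj hq, hone, zero_smul]
    have hgen : ∀ i j, i + 1 < k → j + 1 < k → gen (q + q⁻¹) k i * z * gen (q + q⁻¹) k j = 0 := by
      intro i j hi hj
      obtain ⟨m, rfl⟩ : ∃ m, k = m + 2 := ⟨k - 2, by omega⟩
      have hTL := gen_isTL (q + q⁻¹) (k := m + 2) (K := m + 1) le_rfl
      have hmul : ∀ x r : Alg (q + q⁻¹) (m + 2), (∀ y, Alg.tr _ (m + 2) (r * y) = 0) →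
          ∀ y, Alg.tr _ (m + 2) (x * r * y) = 0 := by
        intro x r hr y
        rw [mul_assoc, Alg.tr_mul_comm, mul_assoc, hr]
      have hmul' : ∀ x r : Alg (q + q⁻¹) (m + 2), (∀ y, Alg.tr _ (m + 2) (r * y) = 0) →
          ∀ y, Alg.tr _ (m + 2) (r * x * y) = 0 := by
        intro x r hr y
        rw [mul_assoc, hr]
      have c1 : ∀ d i, i + d = m → ∀ r : Alg (q + q⁻¹) (m + 2),
          (∀ y, Alg.tr _ (m + 2) (r * y) = 0) → gen _ (m + 2) i * r * gen _ (m + 2) m = 0 := by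
        intro d
        induction d with
        | zero =>
          rintro i rfl r hr
          exact gen_mul_mul_gen_eq_zero hq (ih i (by omega)) hr
        | succ d ihd =>
          intro i hi r hr
          have h1 := ihd (i + 1) (by omega) _ (hmul (gen _ (m + 2) i) r hr)
          rw [← hTL.up i (by omega)]
          calc _ = gen (q + q⁻¹) (m + 2) i * (gen (q + q⁻¹) (m + 2) (i + 1) *
                (gen (q + q⁻¹) (m + 2) i * r) * gen (q + q⁻¹) (m + 2) m) := by
                simp only [mul_assoc]
            _ = 0 := by rw [h1, mul_zero]
      have c2 : ∀ d j, j + d = m → ∀ r : Alg (q + q⁻¹) (m + 2),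
          (∀ y, Alg.tr _ (m + 2) (r * y) = 0) → gen _ (m + 2) i * r * gen _ (m + 2) j = 0 := by
        intro d
        induction d with
        | zero =>
          rintro j rfl r hr
          exact c1 (j + 0 - i) i (by omega) r hr
        | succ d ihd =>
          intro j hj r hr
          have h1 := ihd (j + 1) (by omega) _ (hmul' (gen _ (m + 2) j) r hr)
          rw [← hTL.up j (by omega)]
          calc _ = gen (q + q⁻¹) (m + 2) i * (r * gen (q + q⁻¹) (m + 2) j) *
                gen (q + q⁻¹) (m + 2) (j + 1) * gen (q + q⁻¹) (m + 2) j := by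
                simp only [mul_assoc]
            _ = 0 := by rw [h1, zero_mul]
      exact c2 (m - j) j (by omega) z hz
    have hz0 : ∀ i, i + 1 < k → gen (q + q⁻¹) k i * z = 0 := by
      intro i hi
      have h1 : gen (q + q⁻¹) k i * z * jwProj q k = gen (q + q⁻¹) k i * z :=
        mul_jw k fun j hj => hgen i j hi hj
      rw [← h1, mul_assoc, hzf, mul_zero]
    have h2 : jwProj q k * z = z := jw_mul k hz0
    rw [← h2, hfz]

end Nondegenerate

/-! ### The dual of the two-cup diagram -/

section Dual

variable {q : ℝ} {a b : ℕ}

/-- The element `D` in terms of the generators. -/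
def algD (q : ℝ) (a b : ℕ) : Alg (q + q⁻¹) (a + b + 2) := diagramD q a b

theorem star_algD (q : ℝ) (a b : ℕ) : star (algD q a b) =
    jw q (gen (q + q⁻¹) (a + b + 2)) (a + 1) *
      jw q (fun i => gen (q + q⁻¹) (a + b + 2) (i + (a + 1))) (b + 1) *
      star (desc (gen (q + q⁻¹) (a + b + 2)) a b) *
      jw q (gen (q + q⁻¹) (a + b + 2)) (a + b + 1) := by
  have hTL := gen_isTL (q + q⁻¹) (k := a + b + 2) (K := a + b + 1) (by omega)
  rw [algD, diagramD_eq, star_mul, star_mul, star_mul, star_jw star_gen, star_jw star_gen,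
    star_jw fun i => star_gen _, ← mul_assoc]
  congr 2
  exact commute_jw _ fun i hi => (commute_jw _ fun j hj =>
    (hTL.comm i (j + (a + 1)) (by omega) (by omega))).symm

/-- `D` pairs to zero with all diagrams but the identity and the two-cup diagram: a cup at another
place meets a Jones-Wenzl projection. -/
theorem tr_star_algD_mul_of (hq : 2 < q + q⁻¹) {Y : Diagram (a + b + 2)}
    (h1 : Y ≠ Diagram.one _) (h2 : Y ≠ Diagram.twoCup a b) :
    Alg.tr _ _ (star (algD q a b) * Alg.of _ Y) = 0 := by
  have hTL := gen_isTL (q + q⁻¹) (k := a + b + 2) (K := a + b + 1) (by omega)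
  have hw : IsTL (q + q⁻¹) b (fun i => gen (q + q⁻¹) (a + b + 2) (i + (a + 1))) :=
    hTL.shift (by omega)
  by_contra hne
  have h3 := Y.eq_one_or_eq_twoCup (a := a) (b := b) ?_ ?_
  · exact h3.elim h1 h2
  · intro l hl hY
    by_contra hlab
    refine hne ?_
    rw [mul_of_eq_zero (modulus_ne_zero hq) hl _ hY, map_zero]
    rw [star_algD, mul_assoc, hTL.jw_mul_gen hq (by omega) (by omega), mul_zero]
  · intro l hl hY
    by_contra hla
    refine hne ?_
    rw [Alg.tr_mul_comm, of_mul_eq_zero (modulus_ne_zero hq) hl _ hY, map_zero]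
    rw [star_algD]
    simp only [← mul_assoc]
    rcases Nat.lt_or_gt_of_ne hla with hlt | hgt
    · rw [hTL.gen_mul_jw hq (by omega) (by omega), zero_mul, zero_mul, zero_mul]
    · have h4 := hw.gen_mul_jw hq (k := b + 1) le_rfl (i := l - (a + 1)) (by omega)
      rw [show l - (a + 1) + (a + 1) = l by omega] at h4
      rw [(hTL.commute_jw_of_le (by omega) (by omega)).eq, mul_assoc (jw q _ (a + 1)), h4, mul_zero,
        zero_mul, zero_mul]

theorem tr_star_algD (hq : 2 < q + q⁻¹) : Alg.tr _ _ (star (algD q a b)) =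
    (((-1) ^ b * qInt q (a + b + 2) / qInt q (b + 1) : ℝ) : ℂ) := by
  have hTL := gen_isTL (q + q⁻¹) (k := a + b + 2) (K := a + b + 1) (by omega)
  have hM := gen_isMarkov (q + q⁻¹) (k := a + b + 2) (K := a + b + 1) (by omega)
  refine tr_eq_of_smul hq ?_
  rw [star_algD, Alg.tr_mul_comm]
  simp only [← mul_assoc]
  rw [hTL.jw_mul_jw' hq (by omega) (by omega)]
  exact hTL.trace_pairing_one hq hM (by omega)

theorem tr_star_algD_mul_twoCup (hq : 2 < q + q⁻¹) :
    Alg.tr _ _ (star (algD q a b) * Alg.of _ (Diagram.twoCup a b)) =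
      ((qInt q (a + b + 2) ^ 2 / (qInt q (a + 1) * qInt q (b + 1)) : ℝ) : ℂ) := by
  have hTL := gen_isTL (q + q⁻¹) (k := a + b + 2) (K := a + b + 1) (by omega)
  have hM := gen_isMarkov (q + q⁻¹) (k := a + b + 2) (K := a + b + 1) (by omega)
  refine tr_eq_of_smul hq ?_
  rw [star_algD, of_twoCup]
  exact hTL.trace_pairing_twoCup hq hM (by omega)

theorem twoCup_ne_one (a b : ℕ) : Diagram.twoCup a b ≠ Diagram.one (a + b + 2) := by
  intro h
  have h1 := congrArg (fun X : Diagram (a + b + 2) => X.pair (Sum.inl ⟨a + b, by omega⟩)) h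
  simp [Diagram.twoCup, twoCupPair, Diagram.one] at h1

/-- The combination of `D` and the Jones-Wenzl projection that is dual to the two-cup diagram. -/
def dualTwoCup (q : ℝ) (a b : ℕ) : Alg (q + q⁻¹) (a + b + 2) :=
  (qInt q (a + 1) * qInt q (b + 1) / qInt q (a + b + 2) ^ 2) • algD q a b -
    ((-1) ^ b * qInt q (a + 1) / (qInt q (a + b + 2) * qInt q (a + b + 3))) • jwProj q (a + b + 2)

theorem isDualTo_dualTwoCup (hq : 2 < q + q⁻¹) :
    IsDualTo (q + q⁻¹) (dualTwoCup q a b) (Diagram.twoCup a b) := by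
  intro Y
  have p1 := (qInt_succ_pos hq a).ne'
  have p2 := (qInt_succ_pos hq b).ne'
  have p3 := (qInt_succ_pos hq (a + b + 1)).ne'
  have p4 := (qInt_succ_pos hq (a + b + 2)).ne'
  have hf : star (jwProj q (a + b + 2)) = jwProj q (a + b + 2) := star_jw star_gen _
  change Alg.tr _ _ (star (dualTwoCup q a b) * Alg.of _ Y) = _
  rw [dualTwoCup, star_sub, star_smul, star_smul, hf]
  simp only [star_trivial (R := ℝ)]
  rw [sub_mul,
    smul_mul_assoc, smul_mul_assoc, map_sub, Alg.real_smul, Alg.real_smul, map_smul, map_smul]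
  by_cases h1 : Y = Diagram.one (a + b + 2)
  · subst h1
    rw [← Alg.one_def, mul_one, mul_one, tr_star_algD hq, tr_jwProj hq,
      if_neg (twoCup_ne_one a b).symm, smul_eq_mul, smul_eq_mul, ← Complex.ofReal_mul,
      ← Complex.ofReal_mul, ← Complex.ofReal_sub, Complex.ofReal_eq_zero]
    field_simp
    ring
  rw [jwProj_mul_of hq h1, map_zero, smul_zero, sub_zero]
  by_cases h2 : Y = Diagram.twoCup a b
  · subst h2
    rw [tr_star_algD_mul_twoCup hq, if_pos rfl, smul_eq_mul, ← Complex.ofReal_mul,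
      Complex.ofReal_eq_one]
    field_simp
  · rw [tr_star_algD_mul_of hq h1 h2, smul_zero, if_neg h2]

theorem IsDualTo.unique (hq : 2 < q + q⁻¹) {k : ℕ} {v w : TL k} {X : Diagram k}
    (hv : IsDualTo (q + q⁻¹) v X) (hw : IsDualTo (q + q⁻¹) w X) : v = w := by
  let v' : Alg (q + q⁻¹) k := v
  let w' : Alg (q + q⁻¹) k := w
  have h : star (v' - w') = 0 := by
    refine eq_zero_of_tr_mul_eq_zero hq _ fun y => ?_
    induction y using Alg.induction with
    | add x y hx hy => rw [mul_add, map_add, hx, hy, add_zero]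
    | smul c x hx => rw [mul_smul_comm, map_smul, hx, smul_zero]
    | of Y =>
      rw [star_sub, sub_mul, map_sub]
      exact sub_eq_zero.2 ((hv Y).trans (hw Y).symm)
  have h' : v' - w' = 0 := star_eq_zero.1 h
  exact sub_eq_zero.1 h'

/-- Reflection preserves the form and so exchanges the duals of a diagram and of its reflection. -/
theorem isDualTo_reflect_iff {δ : ℝ} {k : ℕ} (v : TL k) (X : Diagram k) :
    IsDualTo δ v X.reflect ↔ IsDualTo δ (reflect v) X := by
  have key : ∀ Y : Diagram k, inner δ (reflect v) (ofDiagram Y.reflect) =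
      inner δ v (ofDiagram Y) := by
    intro Y
    let v' : Alg δ k := v
    change Alg.tr δ k (star (Alg.refl δ k v') * Alg.of δ Y.reflect) =
      Alg.tr δ k (star v' * Alg.of δ Y)
    rw [← Alg.refl_of, Alg.star_refl, Alg.tr_mul_comm, ← Alg.refl_mul, Alg.tr_refl]
  constructor
  · intro h Y
    rw [← Y.reflect_reflect, key, h]
    simp only [Diagram.reflect_eq_iff, Diagram.reflect_reflect]
  · intro h Y
    rw [← key, h]
    simp only [Diagram.reflect_eq_iff]

end Dual

end TemperleyLieb

end

theorem mainTheorem5 (δ q : ℝ) (hδ : 2 < δ) (hq : δ = q + q⁻¹) (a b n : ℕ) (hn : n = a + b) :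
    (∀ v : TemperleyLieb.TL (a + b + 2),
      TemperleyLieb.IsDualTo δ v (TemperleyLieb.Diagram.twoCup a b) ↔
        v = (TemperleyLieb.qInt q (a + 1) * TemperleyLieb.qInt q (b + 1)
              / TemperleyLieb.qInt q (n + 2) ^ 2) • TemperleyLieb.diagramD q a b
            - ((-1) ^ b * TemperleyLieb.qInt q (a + 1)
              / (TemperleyLieb.qInt q (n + 2) * TemperleyLieb.qInt q (n + 3)))
              • TemperleyLieb.jonesWenzl q (a + b + 2)) ∧
    (∀ v : TemperleyLieb.TL (a + b + 2),
      TemperleyLieb.IsDualTo δ v (TemperleyLieb.Diagram.twoCup a b).reflect ↔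
        v = (TemperleyLieb.qInt q (a + 1) * TemperleyLieb.qInt q (b + 1)
              / TemperleyLieb.qInt q (n + 2) ^ 2)
              • TemperleyLieb.reflect (TemperleyLieb.diagramD q a b)
            - ((-1) ^ b * TemperleyLieb.qInt q (a + 1)
              / (TemperleyLieb.qInt q (n + 2) * TemperleyLieb.qInt q (n + 3)))
              • TemperleyLieb.reflect (TemperleyLieb.jonesWenzl q (a + b + 2))) := by
  subst hn
  subst hq
  have hdual : TemperleyLieb.IsDualTo (q + q⁻¹) ((TemperleyLieb.qInt q (a + 1) *
      TemperleyLieb.qInt q (b + 1) / TemperleyLieb.qInt q (a + b + 2) ^ 2) •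
        TemperleyLieb.diagramD q a b - ((-1) ^ b * TemperleyLieb.qInt q (a + 1)
      / (TemperleyLieb.qInt q (a + b + 2) * TemperleyLieb.qInt q (a + b + 3))) •
        TemperleyLieb.jonesWenzl q (a + b + 2)) (TemperleyLieb.Diagram.twoCup a b) := by
    have h := TemperleyLieb.isDualTo_dualTwoCup (a := a) (b := b) hδ
    rw [TemperleyLieb.dualTwoCup, TemperleyLieb.jwProj, ← TemperleyLieb.jonesWenzl_eq_jw] at h
    exact h
  have hrefl : ∀ v : TemperleyLieb.TL (a + b + 2),
      TemperleyLieb.reflect (TemperleyLieb.reflect v) = v :=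
    fun v => TemperleyLieb.Alg.refl_refl (δ := q + q⁻¹) v
  have h1 : ∀ v : TemperleyLieb.TL (a + b + 2), TemperleyLieb.IsDualTo (q + q⁻¹) v
      (TemperleyLieb.Diagram.twoCup a b) ↔ _ :=
    fun v => ⟨fun hv => hv.unique hδ hdual, fun hv => hv ▸ hdual⟩
  refine ⟨h1, fun v => ?_⟩
  rw [TemperleyLieb.isDualTo_reflect_iff, h1]
  constructor
  · intro h
    rw [← hrefl v, h]
    rfl
  · rintro rfl
    -- `reflect` is linear by definition, so that `hrefl` applies to the whole combination
    have h2 := hrefl ((TemperleyLieb.qInt q (a + 1) *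
      TemperleyLieb.qInt q (b + 1) / TemperleyLieb.qInt q (a + b + 2) ^ 2) •
        TemperleyLieb.diagramD q a b - ((-1) ^ b * TemperleyLieb.qInt q (a + 1)
      / (TemperleyLieb.qInt q (a + b + 2) * TemperleyLieb.qInt q (a + b + 3))) •
        TemperleyLieb.jonesWenzl q (a + b + 2))
    exact h2
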